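/- Let $\mathbb{B}=\{u+\mathbf{j}v : u,v\in\mathbb{C}\}$ be the commutative algebra of bicomplex numbers, $\mathbf{j}^2=-1$, with $\operatorname{Sc}(u+\mathbf{j}v)=u$, $\operatorname{Vec}(u+\mathbf{j}v)=v$, $\overline{u+\mathbf{j}v}=u-\mathbf{j}v$, and let $\overline{\boldsymbol{\partial}}=\frac12\left(\frac{\partial}{\partial x}+\mathbf{j}\frac{\partial}{\partial y}\right)$. Let $\Omega\subset\mathbb{C}$ be a bounded open set that contains $0$ and is star-shaped with respect to $0$, and put $\varrho=\sup_{z\in\Omega}|z|$. Let $q\in C^1([0,\varrho];\mathbb{C})$, and let $f\in C^2([0,\varrho];\mathbb{C})$ have no zero in $[0,\varrho]$ and satisfy $f(0)=1$ and $f''(r)+\frac1r f'(r)-q(r)f(r)=0$ for $0<r<\varrho$. Write also $f(z)=f(|z|)$ for $z\in\Omega$, and put $q_f=q$ and $q_{1/f}=2\left(\frac{f'}{f}\right)^2-q$ on $[0,\varrho]$. Let $$\operatorname{Hol}(\Omega;\mathbb{B})=\{W\in C^1(\Omega;\mathbb{B}) : \overline{\boldsymbol{\partial}}W=0\},\qquad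 \operatorname{V}_f(\Omega;\mathbb{B})=\Big\{W\in C^1(\Omega;\mathbb{B}) : \overline{\boldsymbol{\partial}}W=\frac{\overline{\boldsymbol{\partial}}f}{f}\,\overline{W}\ \text{in}\ \Omega\Big\}.$$ For each $p\in\{q_f,q_{1/f}\}$ there is a function $G:[0,\varrho]\times[0,1]\to\mathbb{C}$, continuous on $[0,\varrho]\times[0,1]$ and of class $C^2$ on $[0,\varrho]\times[0,1)$, such that $$r\left(G_{rr}-p(r)G\right)-G_r+2(1-t)G_{rt}=0\ \text{ on } (0,\varrho)\times(0,1),\qquad G(r,0)=\int_0^r\tau p(\tau)\,d\tau,\qquad G(0,t)=0 .\tag{K}$$ For any functions $G^f$ and $G^{1/f}$ of this regularity that satisfy (K) with $p=q_f$ and $p=q_{1/f}$ respectively, define, for $g\in\{f,1/f\}$ and $u\in C(\Omega)$, $$\mathbf{T}_{g}u(z)=u(z)+\int_0^1\sigma\,G^{g}(|z|,1-\sigma^2)\,u(\sigma^2z)\,d\sigma,$$ and put $\mathcal{T}_f W=\mathbf{T}_f[\operatorname{Sc}W]+\mathbf{j}\,\mathbf{T}_{1/f}[\operatorname{Vec}W]$.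 Then $$\operatorname{V}_f(\Omega;\mathbb{B})=\mathcal{T}_f\left(\operatorname{Hol}(\Omega;\mathbb{B})\right).$$ -/

import Mathlib

noncomputable section

open Set

/-- The commutative algebra `𝔹` of bicomplex numbers `u + 𝐣 v` (`u, v ∈ ℂ`, `𝐣 ^ 2 = -1`).
The scalar part of `W` is `W.re`, the vectorial part is `W.im`, and the bicomplex conjugate
`u - 𝐣 v` is `star W`. -/
abbrev Bicomplex : Type := QuadraticAlgebra ℂ (-1) 0

namespace Bicomplex

/-- The bicomplex unit `𝐣`. -/
def j : Bicomplex := ⟨0, 1⟩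

theorem j_mul_j : j * j = -1 := by
  ext <;> simp [j, QuadraticAlgebra.re_one, QuadraticAlgebra.im_one]

theorem star_mk_eq (u v : ℂ) : star (⟨u, v⟩ : Bicomplex) = ⟨u, -v⟩ := by
  ext <;> simp

/-- `W ∈ C^k(Ω; 𝔹)`: both components are of class `C^k` in the real sense. -/
def ContDiffOnB (k : ℕ) (W : ℂ → Bicomplex) (Ω : Set ℂ) : Prop :=
  ContDiffOn ℝ k (fun z => (W z).re) Ω ∧ ContDiffOn ℝ k (fun z => (W z).im) Ω

/-- The derivative of `W` at `z` in the (real) direction `e ∈ ℂ`, taken componentwise. -/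
def dirDeriv (e : ℂ) (W : ℂ → Bicomplex) (z : ℂ) : Bicomplex :=
  ⟨fderiv ℝ (fun ζ => (W ζ).re) z e, fderiv ℝ (fun ζ => (W ζ).im) z e⟩

/-- The bicomplex Cauchy-Riemann operator `(1/2) (∂/∂x + 𝐣 ∂/∂y)`. -/
def dbar (W : ℂ → Bicomplex) (z : ℂ) : Bicomplex :=
  (1 / 2 : ℂ) • (dirDeriv 1 W z + j * dirDeriv Complex.I W z)

/-- The radial scalar function `z ↦ f(|z|)`, as a `𝔹`-valued function. -/
def radial (f : ℝ → ℂ) (z : ℂ) : Bicomplex := algebraMap ℂ Bicomplex (f ‖z‖)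

/-- `Hol(Ω; 𝔹)`. Functions on `Ω` are represented by functions on `ℂ` of which only the values
on `Ω` matter. -/
def Hol (Ω : Set ℂ) : Set (ℂ → Bicomplex) :=
  {W | ContDiffOnB 1 W Ω ∧ ∀ z ∈ Ω, dbar W z = 0}

/-- `V_f(Ω; 𝔹)`: the `C^1` solutions in `Ω` of the main Vekua equation
`∂̄ W = (∂̄ f / f) W̄`, where `f` is identified with `z ↦ f(|z|)`. -/
def VekuaSol (Ω : Set ℂ) (f : ℝ → ℂ) : Set (ℂ → Bicomplex) :=
  {W | ContDiffOnB 1 W Ω ∧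
    ∀ z ∈ Ω, dbar W z = ((f ‖z‖)⁻¹ • dbar (radial f) z) * star (W z)}

/-- The number `ϱ_Ω = sup {|z| : z ∈ Ω}`. -/
def outerRadius (Ω : Set ℂ) : ℝ := sSup (norm '' Ω)

/-- The Darboux transformed potential `2 (f' / f)^2 - q` on `[0, ϱ]`. -/
def darbouxPotential (ϱ : ℝ) (f q : ℝ → ℂ) (r : ℝ) : ℂ :=
  2 * (derivWithin f (Icc 0 ϱ) r / f r) ^ 2 - q r

/-- `G` is the kernel of the transmutation operator of `Δ - q(|z|)`: it is continuous on
`[0, ϱ] × [0, 1]`, of class `C^2` on `[0, ϱ] × [0, 1)`, and solves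
`r (G_rr - q G) - G_r + 2 (1 - t) G_rt = 0` with `G(r, 0) = ∫_0^r τ q(τ) dτ` and `G(0, t) = 0`.
Class `C^2` is not asked for at `t = 1`, where it fails in general: if `q(r) = r` then
`G(r, t) = r^3 √(1 - t) / 3 + O(r^6)` as `r → 0`. -/
structure IsTransmutationKernel (ϱ : ℝ) (q : ℝ → ℂ) (G : ℝ → ℝ → ℂ) : Prop where
  continuousOn : ContinuousOn (fun p : ℝ × ℝ => G p.1 p.2) (Icc 0 ϱ ×ˢ Icc 0 1)
  contDiffOn : ContDiffOn ℝ 2 (fun p : ℝ × ℝ => G p.1 p.2) (Icc 0 ϱ ×ˢ Ico 0 1)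
  pde : ∀ r ∈ Ioo 0 ϱ, ∀ t ∈ Ioo (0 : ℝ) 1,
    (r : ℂ) * (deriv (fun s => deriv (fun s' => G s' t) s) r - q r * G r t)
      - deriv (fun s => G s t) r
      + 2 * (1 - (t : ℂ)) * deriv (fun τ => deriv (fun s => G s τ) r) t = 0
  initial : ∀ r ∈ Icc 0 ϱ, G r 0 = ∫ τ in (0 : ℝ)..r, (τ : ℂ) * q τ
  zero : ∀ t ∈ Icc (0 : ℝ) 1, G 0 t = 0

/-- The scalar operator with kernel `G`:
`(T u)(z) = u(z) + ∫_0^1 σ G(|z|, 1 - σ^2) u(σ^2 z) dσ`. -/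
def scalarT (G : ℝ → ℝ → ℂ) (u : ℂ → ℂ) (z : ℂ) : ℂ :=
  u z + ∫ σ in (0 : ℝ)..1, (σ : ℂ) * G ‖z‖ (1 - σ ^ 2) * u ((σ : ℂ) ^ 2 * z)

/-- The operator `𝒯 = T₁ Sc + 𝐣 T₂ Vec`, where `T₁`, `T₂` have the kernels `G₁`, `G₂`. -/
def vekuaT (G₁ G₂ : ℝ → ℝ → ℂ) (W : ℂ → Bicomplex) (z : ℂ) : Bicomplex :=
  ⟨scalarT G₁ (fun ζ => (W ζ).re) z, scalarT G₂ (fun ζ => (W ζ).im) z⟩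

end Bicomplex

end

noncomputable section

open Set Filter Topology MeasureTheory

namespace Bicomplex

/-! Put h = f'/f and use polar coordinates r, θ. Taken in the directions z and iz, the Vekua
equation for W = U + jV becomes, off the origin, r U_r - V_θ = r h U and r V_r + U_θ = -r h V; for f
= 1 these are the Cauchy-Riemann equations. The scalar operators T₁ and T₂ (for f and 1/f) integrate
along rays with a radial kernel, so they commute with ∂_θ. Everything therefore rests on r(∂_r -
h)T₁ = T₂ r∂_r and r(∂_r + h)T₂ = T₁ r∂_r (`rayIntertwines`), which carry holomorphic pairs to
solutions (`isPolarSol_scalarT`).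

In the variable σ = √(1 - t) these two identities follow, after an integration by parts in σ, from a
first-order relation between the two kernels and from their values at σ = 1. The kernels only
satisfy separate second-order equations, so the failure of the first-order relations is measured by
two defects X and Y. The sum and the difference of the kernel equations, with the Riccati equation
h' = q - h² - h/r, give a homogeneous linear system: X/r is transported along rσ = const with source
hY/r², and Y is transported in r with source rhX. The data vanish, X at σ = 1 and Y at r = 0, so
both defects vanish (`defects_eq_zero`). This applies to any kernels satisfying (K).

Conversely, T₁ and T₂ are identity plus Volterra operators because their kernels vanish at r = 0;
they are onto on continuous functions (`exists_scalarT_eq`) and injective on each ray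
(`eq_zero_of_rayT_eq_zero`). The preimage of a solution is a priori only continuous. Its derivatives
are found by inverting the operators on the expected derivatives, integrating the result along
circles or rays, and identifying the integral with the preimage by injectivity
(`hasDerivAt_angle_of_scalarT`, `hasDerivAt_dilation_of_scalarT`). Polar coordinates lose the
origin, so first-order behaviour there is followed separately (`contDiffOn_of_polar`,
`isLittleO_scalarT`).

Kernels exist because A = G_r/r solves the transport problem r A_r - σ A_σ = pG with A = p at σ = 1,
a Volterra equation along rσ = const (`exists_kernel_density`). Its continuous solution makes G of
class C² for σ > 0 (`IsKernelDensity.contDiffOn_ker`). -/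

/-! ### Differentiability from continuous partial derivatives. -/

/-- A function on `[a, b]` whose derivative inside is bounded by `C` grows by at most `C (b - a)`. -/
theorem norm_sub_le_of_hasDerivAt_Ioo {f f' : ℝ → ℂ} {a b C : ℝ} (hab : a ≤ b)
    (hc : ContinuousOn f (Icc a b)) (hd : ∀ x ∈ Ioo a b, HasDerivAt f (f' x) x)
    (hC : ∀ x ∈ Ioo a b, ‖f' x‖ ≤ C) : ‖f b - f a‖ ≤ C * (b - a) := by
  rcases hab.eq_or_lt with rfl | hab'
  · simp
  have key : ∀ x ∈ Ioo a b, ∀ y ∈ Ioo a b, ‖f y - f x‖ ≤ C * ‖y - x‖ := fun x hx y hy =>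
    (convex_Ioo a b).norm_image_sub_le_of_norm_hasDerivWithin_le
      (fun z hz => (hd z hz).hasDerivWithinAt) hC hx hy
  have hIcc : closure (Ioo a b) = Icc a b := closure_Ioo hab'.ne
  have hc2 : ContinuousOn (fun p : ℝ × ℝ => ‖f p.2 - f p.1‖) (closure (Ioo a b ×ˢ Ioo a b)) := by
    rw [closure_prod_eq, hIcc]
    exact ((hc.comp continuousOn_snd fun p hp => hp.2).sub
      (hc.comp continuousOn_fst fun p hp => hp.1)).norm
  have := le_on_closure (s := Ioo a b ×ˢ Ioo a b)
    (f := fun p : ℝ × ℝ => ‖f p.2 - f p.1‖) (g := fun p : ℝ × ℝ => C * ‖p.2 - p.1‖)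
    (fun p hp => key p.1 hp.1 p.2 hp.2) hc2 (by fun_prop) (x := (a, b))
    (by rw [closure_prod_eq, hIcc]; exact ⟨left_mem_Icc.2 hab, right_mem_Icc.2 hab⟩)
  simpa [abs_of_nonneg (sub_nonneg.2 hab)] using this

/-- The real linear map `ℝ × ℝ → ℂ` with the given values on the coordinate vectors. -/
def ofPartials (a b : ℂ) : ℝ × ℝ →L[ℝ] ℂ :=
  (ContinuousLinearMap.fst ℝ ℝ ℝ).smulRight a + (ContinuousLinearMap.snd ℝ ℝ ℝ).smulRight b

@[simp] theorem ofPartials_apply (a b : ℂ) (v : ℝ × ℝ) :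
    ofPartials a b v = v.1 • a + v.2 • b := rfl

theorem contDiffOn_ofPartials {n : WithTop ℕ∞} {s : Set (ℝ × ℝ)} {g₁ g₂ : ℝ × ℝ → ℂ}
    (h₁ : ContDiffOn ℝ n g₁ s) (h₂ : ContDiffOn ℝ n g₂ s) :
    ContDiffOn ℝ n (fun p => ofPartials (g₁ p) (g₂ p)) s :=
  (contDiffOn_const.smulRight h₁).add (contDiffOn_const.smulRight h₂)

theorem continuousOn_ofPartials {s : Set (ℝ × ℝ)} {g₁ g₂ : ℝ × ℝ → ℂ}
    (h₁ : ContinuousOn g₁ s) (h₂ : ContinuousOn g₂ s) :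
    ContinuousOn (fun p => ofPartials (g₁ p) (g₂ p)) s :=
  (contDiffOn_ofPartials (contDiffOn_zero.2 h₁) (contDiffOn_zero.2 h₂)).continuousOn

theorem hasFDerivAt_of_partials {g g₁ g₂ : ℝ × ℝ → ℂ} {u : ℝ × ℝ}
    (h₁ : ∀ᶠ v in 𝓝 u, HasDerivAt (fun r => g (r, v.2)) (g₁ v) v.1)
    (h₂ : ∀ᶠ v in 𝓝 u, HasDerivAt (fun r => g (v.1, r)) (g₂ v) v.2)
    (c₁ : ContinuousAt g₁ u) (c₂ : ContinuousAt g₂ u) :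
    HasFDerivAt g (ofPartials (g₁ u) (g₂ u)) u := by
  have key : ∀ {k : ℝ × ℝ → ℂ}, ContinuousAt k u →
      ContinuousAt (fun v : ℝ × ℝ => ContinuousLinearMap.toSpanSingleton ℝ (k v)) u := fun hk =>
    (ContinuousLinearMap.toSpanSingletonCLE (𝕜 := ℝ) (E := ℂ)).continuous.continuousAt.comp hk
  have := hasStrictFDerivAt_uncurry_coprod (𝕜 := ℝ) (u := u) (f := fun a b => g (a, b))
    (f₁ := fun a b => ContinuousLinearMap.toSpanSingleton ℝ (g₁ (a, b)))
    (f₂ := fun a b => ContinuousLinearMap.toSpanSingleton ℝ (g₂ (a, b)))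
    (h₁.mono fun v hv => hv.hasFDerivAt) (h₂.mono fun v hv => hv.hasFDerivAt)
    (key c₁) (key c₂)
  refine this.hasFDerivAt.congr_fderiv ?_
  ext <;> simp [Function.HasUncurry.uncurry]

/-- A continuous function on `[a, b] × (c, d]` whose partial derivatives inside extend
continuously to the whole set is differentiable there. -/
theorem hasFDerivWithinAt_of_partials {a b c d : ℝ} (hab : a < b) {g g₁ g₂ : ℝ × ℝ → ℂ}
    (hg : ContinuousOn g (Icc a b ×ˢ Ioc c d)) (hg₁ : ContinuousOn g₁ (Icc a b ×ˢ Ioc c d))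
    (hg₂ : ContinuousOn g₂ (Icc a b ×ˢ Ioc c d))
    (h₁ : ∀ r ∈ Ioo a b, ∀ s ∈ Ioo c d, HasDerivAt (fun r => g (r, s)) (g₁ (r, s)) r)
    (h₂ : ∀ r ∈ Ioo a b, ∀ s ∈ Ioo c d, HasDerivAt (fun s => g (r, s)) (g₂ (r, s)) s)
    {p : ℝ × ℝ} (hp : p ∈ Icc a b ×ˢ Ioc c d) :
    HasFDerivWithinAt g (ofPartials (g₁ p) (g₂ p)) (Icc a b ×ˢ Ioc c d) p := by
  -- Moving the open side from c to c' < p.2 puts p in a closed box on which everything is still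
  -- continuous, so the closure criterion for derivatives applies.
  obtain ⟨c', hc', hc'p⟩ := exists_between hp.2.1
  have hc'd : c' < d := hc'p.trans_le hp.2.2
  set s : Set (ℝ × ℝ) := Ioo a b ×ˢ Ioo c' d with hs
  have hso : IsOpen s := isOpen_Ioo.prod isOpen_Ioo
  have hcl : closure s = Icc a b ×ˢ Icc c' d := by
    rw [hs, closure_prod_eq, closure_Ioo hab.ne, closure_Ioo hc'd.ne]
  have hclQ : closure s ⊆ Icc a b ×ˢ Ioc c d := by
    rw [hcl]; exact prod_mono_right fun x hx => ⟨hc'.trans_le hx.1, hx.2⟩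
  have hsQ : s ⊆ Icc a b ×ˢ Ioc c d := subset_closure.trans hclQ
  have hfd : ∀ v ∈ s, HasFDerivAt g (ofPartials (g₁ v) (g₂ v)) v := by
    intro v hv
    have hn : ∀ᶠ w in 𝓝 v, w ∈ s := hso.mem_nhds hv
    exact hasFDerivAt_of_partials
      (hn.mono fun w hw => h₁ w.1 hw.1 w.2 ⟨hc'.trans hw.2.1, hw.2.2⟩)
      (hn.mono fun w hw => h₂ w.1 hw.1 w.2 ⟨hc'.trans hw.2.1, hw.2.2⟩)
      ((hg₁.mono hsQ).continuousAt (hso.mem_nhds hv))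
      ((hg₂.mono hsQ).continuousAt (hso.mem_nhds hv))
  have hpc : p ∈ closure s := by rw [hcl]; exact ⟨hp.1, hc'p.le, hp.2.2⟩
  have hmain : HasFDerivWithinAt g (ofPartials (g₁ p) (g₂ p)) (closure s) p := by
    refine hasFDerivWithinAt_closure_of_tendsto_fderiv
      (fun v hv => (hfd v hv).differentiableAt.differentiableWithinAt)
      ((convex_Ioo a b).prod (convex_Ioo c' d)) hso
      (fun y hy => (hg y (hclQ hy)).mono hsQ) ?_
    have ht : Tendsto (fun v => ofPartials (g₁ v) (g₂ v)) (𝓝[s] p)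
        (𝓝 (ofPartials (g₁ p) (g₂ p))) :=
      (continuousOn_ofPartials hg₁ hg₂ p hp).mono_left (nhdsWithin_mono _ hsQ)
    refine ht.congr' ?_
    filter_upwards [self_mem_nhdsWithin] with v hv using (hfd v hv).fderiv.symm
  refine hmain.mono_of_mem_nhdsWithin ?_
  rw [hcl]
  have : Icc a b ×ˢ Ioc c d ∩ {v : ℝ × ℝ | c' < v.2} ⊆ Icc a b ×ˢ Icc c' d :=
    fun v hv => ⟨hv.1.1, le_of_lt hv.2, hv.1.2.2⟩
  exact mem_of_superset (inter_mem_nhdsWithin _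
    ((isOpen_lt continuous_const continuous_snd).mem_nhds hc'p)) this

theorem contDiffOn_succ_of_partials {n : ℕ} {a b c d : ℝ} (hab : a < b)
    {g g₁ g₂ : ℝ × ℝ → ℂ} (hg : ContinuousOn g (Icc a b ×ˢ Ioc c d))
    (hg₁ : ContDiffOn ℝ n g₁ (Icc a b ×ˢ Ioc c d)) (hg₂ : ContDiffOn ℝ n g₂ (Icc a b ×ˢ Ioc c d))
    (h₁ : ∀ r ∈ Ioo a b, ∀ s ∈ Ioo c d, HasDerivAt (fun r => g (r, s)) (g₁ (r, s)) r)
    (h₂ : ∀ r ∈ Ioo a b, ∀ s ∈ Ioo c d, HasDerivAt (fun s => g (r, s)) (g₂ (r, s)) s) :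
    ContDiffOn ℝ (n + 1) g (Icc a b ×ˢ Ioc c d) := by
  rw [contDiffOn_succ_iff_hasFDerivWithinAt_of_uniqueDiffOn
    ((uniqueDiffOn_Icc hab).prod (uniqueDiffOn_Ioc c d))]
  exact ⟨by simp, _, contDiffOn_ofPartials hg₁ hg₂, fun p hp =>
    hasFDerivWithinAt_of_partials hab hg hg₁.continuousOn hg₂.continuousOn h₁ h₂ hp⟩

/-! ### Differentiability in polar coordinates. -/

/-- The real linear map taking the values `a` at `z` and `b` at `i z`. -/
def ofPolar (z a b : ℂ) : ℂ →L[ℝ] ℂ :=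
  (Complex.reCLM.smulRight a + Complex.imCLM.smulRight b).comp (ContinuousLinearMap.mul ℝ ℂ z⁻¹)

theorem ofPolar_apply (z a b e : ℂ) :
    ofPolar z a b e = ((z⁻¹ * e).re : ℂ) * a + ((z⁻¹ * e).im : ℂ) * b := by
  simp [ofPolar]

/-- In the chart (a, b) ↦ z₀ exp(a + ib) the partial derivatives are exactly P and Q, and the chart
is inverted near z₀ by the logarithm of z/z₀, which is near 1 and so off the branch cut. -/
theorem hasFDerivAt_of_polar {U P Q : ℂ → ℂ} {z₀ : ℂ} (hz : z₀ ≠ 0)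
    (hrad : ∀ᶠ z in 𝓝 z₀, HasDerivAt (fun t : ℝ => U (t * z)) (P z) 1)
    (hang : ∀ᶠ z in 𝓝 z₀, HasDerivAt (fun t : ℝ => U (Complex.exp (t * Complex.I) * z)) (Q z) 0)
    (hP : ContinuousAt P z₀) (hQ : ContinuousAt Q z₀) :
    HasFDerivAt U (ofPolar z₀ (P z₀) (Q z₀)) z₀ := by
  set E : ℝ × ℝ → ℂ := fun v => z₀ * Complex.exp (v.1 + v.2 * Complex.I) with hE
  have hEc : Continuous E := by rw [hE]; fun_prop
  have hE0 : E 0 = z₀ := by simp [hE]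
  have hET : Tendsto E (𝓝 0) (𝓝 z₀) := by simpa [hE0] using hEc.tendsto 0
  have hg : HasFDerivAt (fun v => U (E v)) (ofPartials (P (E 0)) (Q (E 0))) 0 := by
    refine hasFDerivAt_of_partials (g₁ := fun v => P (E v)) (g₂ := fun v => Q (E v))
      ?_ ?_ ?_ ?_
    · filter_upwards [hET.eventually hrad] with v hv
      have h1 : HasDerivAt (fun t : ℝ => Real.exp (t - v.1)) 1 v.1 := by
        simpa using ((hasDerivAt_id v.1).sub_const v.1).exp
      have h2 : HasDerivAt (fun t : ℝ => U (t * E v)) (P (E v)) (Real.exp (v.1 - v.1)) := by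
        simpa using hv
      have h3 := h2.scomp v.1 h1
      simp only [one_smul] at h3
      refine h3.congr_of_eventuallyEq (Eventually.of_forall fun t => ?_)
      simp only [Function.comp, hE]
      congr 1
      push_cast
      rw [mul_left_comm, ← Complex.exp_add]
      ring_nf
    · filter_upwards [hET.eventually hang] with v hv
      have h1 : HasDerivAt (fun t : ℝ => t - v.2) 1 v.2 := (hasDerivAt_id v.2).sub_const v.2
      have h2 : HasDerivAt (fun t : ℝ => U (Complex.exp (t * Complex.I) * E v)) (Q (E v))
        (v.2 - v.2) := by simpa using hv
      have h3 := HasDerivAt.scomp (h := fun t : ℝ => t - v.2) v.2 h2 h1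
      simp only [one_smul] at h3
      refine h3.congr_of_eventuallyEq (Eventually.of_forall fun t => ?_)
      simp only [Function.comp, hE]
      congr 1
      push_cast
      rw [mul_left_comm, ← Complex.exp_add]
      ring_nf
    · exact ContinuousAt.comp (by rwa [hE0]) hEc.continuousAt
    · exact ContinuousAt.comp (by rwa [hE0]) hEc.continuousAt
  rw [hE0] at hg
  set ℓ : ℂ → ℝ × ℝ := fun z => ((Complex.log (z₀⁻¹ * z)).re, (Complex.log (z₀⁻¹ * z)).im) with hℓ
  have hlog : HasFDerivAt (fun z : ℂ => Complex.log (z₀⁻¹ * z))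
      (ContinuousLinearMap.mul ℝ ℂ z₀⁻¹) z₀ := by
    have h1 : HasDerivAt (fun z : ℂ => Complex.log (z₀⁻¹ * z)) z₀⁻¹ z₀ := by
      have := ((hasDerivAt_id z₀).const_mul z₀⁻¹).clog (by simp [hz])
      simpa [hz] using this
    refine (h1.hasFDerivAt.restrictScalars ℝ).congr_fderiv ?_
    ext
    simp [mul_comm]
  have hℓd : HasFDerivAt ℓ ((Complex.reCLM.prod Complex.imCLM).comp
      (ContinuousLinearMap.mul ℝ ℂ z₀⁻¹)) z₀ :=
    (Complex.reCLM.prod Complex.imCLM).hasFDerivAt.comp z₀ hlog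
  have hℓ0 : ℓ z₀ = 0 := by simp [hℓ, hz]
  have hcomp := HasFDerivAt.comp z₀ (g := fun v => U (E v)) (by rw [hℓ0]; exact hg) hℓd
  have hne : ∀ᶠ z in 𝓝 z₀, z ≠ 0 := isOpen_ne.mem_nhds hz
  have heq : (fun z => U (E (ℓ z))) =ᶠ[𝓝 z₀] U := by
    filter_upwards [hne] with z hz1
    simp only [hE, hℓ]
    rw [Complex.re_add_im, Complex.exp_log (by simp [hz, hz1])]
    simp [hz]
  refine (hcomp.congr_of_eventuallyEq heq.symm).congr_fderiv ?_
  ext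
  simp [ofPolar]

/-- A continuous function on an open set having continuous radial and angular derivatives, with
the right behaviour at the origin, is of class `C^1`. -/
theorem contDiffOn_of_polar {Ω : Set ℂ} (ho : IsOpen Ω) {U P Q : ℂ → ℂ} {L : ℂ →L[ℝ] ℂ}
    (hU : ContinuousOn U Ω) (hP : ContinuousOn P Ω) (hQ : ContinuousOn Q Ω)
    (hrad : ∀ z ∈ Ω, z ≠ 0 → HasDerivAt (fun t : ℝ => U (t * z)) (P z) 1)
    (hang : ∀ z ∈ Ω, z ≠ 0 → HasDerivAt (fun t : ℝ => U (Complex.exp (t * Complex.I) * z)) (Q z) 0)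
    (hP0 : (fun z => P z - L z) =o[𝓝 0] fun z => z)
    (hQ0 : (fun z => Q z - L (Complex.I * z)) =o[𝓝 0] fun z => z) :
    ContDiffOn ℝ 1 U Ω ∧
      (∀ z ∈ Ω, fderiv ℝ U z z = P z ∧ fderiv ℝ U z (Complex.I * z) = Q z) ∧
      (0 ∈ Ω → fderiv ℝ U 0 = L) := by
  have hne : ∀ z ∈ Ω, z ≠ 0 → HasFDerivAt U (ofPolar z (P z) (Q z)) z := by
    intro z hz hz0
    have hn : ∀ᶠ w in 𝓝 z, w ∈ Ω ∧ w ≠ 0 :=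
      (ho.eventually_mem hz).and (isOpen_ne.eventually_mem hz0)
    exact hasFDerivAt_of_polar hz0 (hn.mono fun w hw => hrad w hw.1 hw.2)
      (hn.mono fun w hw => hang w hw.1 hw.2) (hP.continuousAt (ho.mem_nhds hz))
      (hQ.continuousAt (ho.mem_nhds hz))
  -- In the frame z, iz the coordinates of e are at most |e|/|z|, which the o(|z|) errors in P and Q
  -- absorb.
  have hclose : ∀ c > 0, ∀ᶠ z in 𝓝 (0 : ℂ), z ≠ 0 → ‖ofPolar z (P z) (Q z) - L‖ ≤ c := by
    intro c hc
    have hc2 : 0 < c / 2 := half_pos hc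
    filter_upwards [hP0.bound hc2, hQ0.bound hc2] with z h1 h2 hz
    refine ContinuousLinearMap.opNorm_le_bound _ hc.le fun e => ?_
    have hzn : 0 < ‖z‖ := norm_pos_iff.2 hz
    have he : e = ((z⁻¹ * e).re : ℝ) • z + ((z⁻¹ * e).im : ℝ) • (Complex.I * z) := by
      have := Complex.re_add_im (z⁻¹ * e)
      calc e = (z⁻¹ * e) * z := by field_simp
        _ = _ := by rw [← this]; simp; ring
    have hL : L e = ((z⁻¹ * e).re : ℂ) * L z + ((z⁻¹ * e).im : ℂ) * L (Complex.I * z) := by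
      conv_lhs => rw [he, map_add, map_smul, map_smul]
      simp
    have : (ofPolar z (P z) (Q z) - L) e = ((z⁻¹ * e).re : ℂ) * (P z - L z) +
        ((z⁻¹ * e).im : ℂ) * (Q z - L (Complex.I * z)) := by
      rw [sub_apply, ofPolar_apply, hL]; ring
    rw [this]
    have hb : ‖z⁻¹ * e‖ = ‖e‖ / ‖z‖ := by rw [norm_mul, norm_inv]; field_simp
    have hre : |(z⁻¹ * e).re| ≤ ‖e‖ / ‖z‖ := hb ▸ Complex.abs_re_le_norm _
    have him : |(z⁻¹ * e).im| ≤ ‖e‖ / ‖z‖ := hb ▸ Complex.abs_im_le_norm _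
    calc _ ≤ |(z⁻¹ * e).re| * ‖P z - L z‖ + |(z⁻¹ * e).im| * ‖Q z - L (Complex.I * z)‖ := by
          refine (norm_add_le _ _).trans ?_
          rw [norm_mul, norm_mul, Complex.norm_real, Complex.norm_real, Real.norm_eq_abs,
            Real.norm_eq_abs]
      _ ≤ ‖e‖ / ‖z‖ * (c / 2 * ‖z‖) + ‖e‖ / ‖z‖ * (c / 2 * ‖z‖) := by gcongr
      _ = c * ‖e‖ := by field_simp; ring
  have hzero : 0 ∈ Ω → HasFDerivAt U L 0 := by
    intro h0
    rw [hasFDerivAt_iff_isLittleO_nhds_zero, Asymptotics.isLittleO_iff]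
    intro c hc
    obtain ⟨δ, hδ, hball⟩ := Metric.eventually_nhds_iff_ball.1
      ((hP0.bound hc).and (ho.mem_nhds h0))
    filter_upwards [Metric.ball_mem_nhds (0 : ℂ) hδ] with z hz
    have hmem : ∀ t ∈ Icc (0 : ℝ) 1, (t : ℂ) * z ∈ Metric.ball (0 : ℂ) δ := by
      intro t ht
      rw [mem_ball_zero_iff] at hz ⊢
      rw [norm_mul, Complex.norm_real, Real.norm_of_nonneg ht.1]
      exact (mul_le_of_le_one_left (norm_nonneg _) ht.2).trans_lt hz
    rcases eq_or_ne z 0 with rfl | hz0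
    · simp
    -- Mean value estimate on the segment from 0 to z, where only the radial derivative enters.
    have key := norm_sub_le_of_hasDerivAt_Ioo (f := fun t : ℝ => U (t * z) - t * L z)
      (f' := fun t : ℝ => (t : ℂ)⁻¹ * P (t * z) - L z) (C := c * ‖z‖) zero_le_one ?_ ?_ ?_
    · simpa [sub_sub, add_comm] using key
    · refine ContinuousOn.sub ?_ (by fun_prop)
      exact hU.comp (by fun_prop) fun t ht => (hball _ (hmem t ht)).2
    · intro t ht
      have htC : (t : ℂ) ≠ 0 := by exact_mod_cast ht.1.ne'
      have h1 := hrad (t * z) (hball _ (hmem t ⟨ht.1.le, ht.2.le⟩)).2 (mul_ne_zero htC hz0)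
      have h2 : HasDerivAt (fun s : ℝ => s / t) (1 / t) t := (hasDerivAt_id t).div_const t
      have h3 : HasDerivAt (fun s : ℝ => U (s * (t * z))) (P (t * z)) (t / t) := by
        rwa [div_self ht.1.ne']
      have h4 := HasDerivAt.scomp (h := fun s : ℝ => s / t) t h3 h2
      have h5 : HasDerivAt (fun s : ℝ => U (s * z)) ((t : ℂ)⁻¹ * P (t * z)) t := by
        refine (h4.congr_deriv (by simp)).congr_of_eventuallyEq (Eventually.of_forall fun s => ?_)
        simp only [Function.comp]
        congr 1
        push_cast
        field_simp
      have h6 : HasDerivAt (fun s : ℝ => (s : ℂ) * L z) (L z) t := by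
        simpa using (Complex.ofRealCLM.hasDerivAt (x := t)).mul_const (L z)
      exact h5.sub h6
    · intro t ht
      have htC : (t : ℂ) ≠ 0 := by exact_mod_cast ht.1.ne'
      have hb := (hball _ (hmem t ⟨ht.1.le, ht.2.le⟩)).1
      have hLt : L (t * z) = t * L z := by
        have := L.map_smul t z
        simpa using this
      have : (t : ℂ)⁻¹ * P (t * z) - L z = (t : ℂ)⁻¹ * (P (t * z) - L (t * z)) := by
        rw [hLt]; field_simp
      rw [this, norm_mul, norm_inv, Complex.norm_real, Real.norm_of_nonneg ht.1.le]
      rw [norm_mul, Complex.norm_real, Real.norm_of_nonneg ht.1.le] at hb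
      calc t⁻¹ * _ ≤ t⁻¹ * (c * (t * ‖z‖)) := by
            have := ht.1
            gcongr
        _ = c * ‖z‖ := by have := ht.1.ne'; field_simp
  set D : ℂ → ℂ →L[ℝ] ℂ := fun z => if z = 0 then L else ofPolar z (P z) (Q z) with hD
  have hDU : ∀ z ∈ Ω, HasFDerivAt U (D z) z := by
    intro z hz
    by_cases h : z = 0
    · subst h; simpa [hD] using hzero hz
    · simpa [hD, h] using hne z hz h
  refine ⟨?_, ?_, fun h0 => (hzero h0).fderiv⟩
  · rw [show (1 : WithTop ℕ∞) = 0 + 1 from (zero_add 1).symm,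
      contDiffOn_succ_iff_fderiv_of_isOpen ho, contDiffOn_zero]
    refine ⟨fun z hz => (hDU z hz).differentiableAt.differentiableWithinAt, by simp, ?_⟩
    refine ContinuousOn.congr (f := D) ?_ fun z hz => (hDU z hz).fderiv
    intro z hz
    refine ContinuousAt.continuousWithinAt ?_
    by_cases h : z = 0
    · subst h
      rw [Metric.continuousAt_iff']
      intro ε hε
      filter_upwards [hclose (ε / 2) (half_pos hε)] with w hw
      by_cases hw0 : w = 0
      · simp [hw0, hε]
      · simp only [hD, hw0, if_false, if_true, dist_eq_norm]
        exact (hw hw0).trans_lt (half_lt_self hε)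
    · have heq : D =ᶠ[𝓝 z] fun w => ofPolar w (P w) (Q w) := by
        filter_upwards [isOpen_ne.mem_nhds h] with w hw
        simp only [hD]; rw [if_neg hw]
      refine ContinuousAt.congr ?_ heq.symm
      have hPz := hP.continuousAt (ho.mem_nhds hz)
      have hQz := hQ.continuousAt (ho.mem_nhds hz)
      unfold ofPolar
      refine ContinuousAt.clm_comp (ContinuousAt.add ?_ ?_) ?_
      · exact ((ContinuousLinearMap.smulRightL ℝ ℂ ℂ) Complex.reCLM).continuous.continuousAt.comp hPz
      · exact ((ContinuousLinearMap.smulRightL ℝ ℂ ℂ) Complex.imCLM).continuous.continuousAt.comp hQz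
      · exact (ContinuousLinearMap.mul ℝ ℂ).continuous.continuousAt.comp (continuousAt_inv₀ h)
  · intro z hz
    rw [(hDU z hz).fderiv]
    by_cases h : z = 0
    · subst h
      have h1 := hP0.bound one_pos |>.self_of_nhds
      have h2 := hQ0.bound one_pos |>.self_of_nhds
      simp at h1 h2
      simp [h1, h2]
    · have h' : z⁻¹ * (Complex.I * z) = Complex.I := by field_simp
      simp only [hD, h, if_false, ofPolar_apply, inv_mul_cancel₀ h, h']
      simp

/-! ### Neumann series and parametric integrals. -/

/-- Neumann series: an affine equation `u = U + K u` whose linear part halves a weight locally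
has a continuous solution. -/
theorem exists_eq_add_of_weighted_contraction {X : Type*} [TopologicalSpace X] {Ω : Set X}
    (K : (X → ℂ) → X → ℂ) (w : X → ℝ) (hw : ∀ x, 0 ≤ w x) {U : X → ℂ} (hU : ContinuousOn U Ω)
    (hcont : ∀ u, ContinuousOn u Ω → ContinuousOn (K u) Ω)
    (hsub : ∀ u v, ContinuousOn u Ω → ContinuousOn v Ω → ∀ x ∈ Ω, K (u - v) x = K u x - K v x)
    (hloc : ∀ x ∈ Ω, ∃ C, C ∈ 𝓝[Ω] x ∧ C ⊆ Ω ∧ (∃ B, ∀ y ∈ C, ‖U y‖ ≤ B * w y) ∧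
      (∃ M, ∀ y ∈ C, w y ≤ M) ∧
      ∀ u B, ContinuousOn u Ω → (∀ y ∈ C, ‖u y‖ ≤ B * w y) → ∀ y ∈ C, ‖K u y‖ ≤ B / 2 * w y) :
    ∃ u, ContinuousOn u Ω ∧ ∀ x ∈ Ω, u x = U x + K u x := by
  obtain ⟨s, hs0, hs1⟩ : ∃ s : ℕ → X → ℂ, s 0 = 0 ∧ ∀ n, s (n + 1) = U + K (s n) :=
    ⟨fun n => Nat.rec 0 (fun _ u => U + K u) n, rfl, fun n => rfl⟩
  have hsc : ∀ n, ContinuousOn (s n) Ω := by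
    intro n
    induction n with
    | zero => rw [hs0]; exact continuousOn_const
    | succ n ih => rw [hs1]; exact hU.add (hcont _ ih)
  have hK0 : ∀ x ∈ Ω, K 0 x = 0 := by
    intro x hx
    have := hsub 0 0 continuousOn_const continuousOn_const x hx
    simpa using this
  have hstep : ∀ n, ∀ x ∈ Ω, K (s (n + 1) - s n) x = s (n + 2) x - s (n + 1) x := by
    intro n x hx
    rw [hsub _ _ (hsc _) (hsc _) x hx, hs1 (n + 1), hs1 n]
    simp
  have hgeom : ∀ C ⊆ Ω, ∀ B, (∀ y ∈ C, ‖U y‖ ≤ B * w y) →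
      (∀ u B, ContinuousOn u Ω → (∀ y ∈ C, ‖u y‖ ≤ B * w y) → ∀ y ∈ C, ‖K u y‖ ≤ B / 2 * w y) →
      ∀ n, ∀ y ∈ C, ‖s (n + 1) y - s n y‖ ≤ (B * (1 / 2) ^ n) * w y := by
    intro C hC B hB hK n
    induction n with
    | zero =>
      intro y hy
      simpa [hs1, hs0, hK0 y (hC hy)] using hB y hy
    | succ n ih =>
      intro y hy
      have := hK (s (n + 1) - s n) (B * (1 / 2) ^ n) ((hsc _).sub (hsc _)) ih y hy
      rw [hstep n y (hC hy)] at this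
      rw [pow_succ]
      convert this using 2
      ring
  have hdist : ∀ C ⊆ Ω, ∀ B, (∀ y ∈ C, ‖U y‖ ≤ B * w y) →
      (∀ u B, ContinuousOn u Ω → (∀ y ∈ C, ‖u y‖ ≤ B * w y) → ∀ y ∈ C, ‖K u y‖ ≤ B / 2 * w y) →
      ∀ y ∈ C, ∀ n, dist (s n y) (s (n + 1) y) ≤ (B * w y) * (1 / 2) ^ n := by
    intro C hC B hB hK y hy n
    rw [dist_comm, dist_eq_norm]
    convert hgeom C hC B hB hK n y hy using 1
    ring
  have hlim : ∀ x ∈ Ω, ∃ l, Tendsto (fun n => s n x) atTop (𝓝 l) := by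
    intro x hx
    obtain ⟨C, hCx, hC, ⟨B, hB⟩, -, hK⟩ := hloc x hx
    exact cauchySeq_tendsto_of_complete (cauchySeq_of_le_geometric (1 / 2) _ (by norm_num)
      (hdist C hC B hB hK x (mem_of_mem_nhdsWithin hx hCx)))
  set u : X → ℂ := fun x => limUnder atTop (fun n => s n x) with hu
  have hut : ∀ x ∈ Ω, Tendsto (fun n => s n x) atTop (𝓝 (u x)) := fun x hx =>
    tendsto_nhds_limUnder (hlim x hx)
  -- The factor 2 is the sum of the geometric tail with ratio 1/2.
  have herr : ∀ C ⊆ Ω, ∀ B, (∀ y ∈ C, ‖U y‖ ≤ B * w y) →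
      (∀ u B, ContinuousOn u Ω → (∀ y ∈ C, ‖u y‖ ≤ B * w y) → ∀ y ∈ C, ‖K u y‖ ≤ B / 2 * w y) →
      ∀ n, ∀ y ∈ C, ‖(u - s n) y‖ ≤ (2 * B * (1 / 2) ^ n) * w y := by
    intro C hC B hB hK n y hy
    have := dist_le_of_le_geometric_of_tendsto (1 / 2) _ (by norm_num)
      (hdist C hC B hB hK y hy) (hut y (hC hy)) n
    rw [Pi.sub_apply, ← dist_eq_norm, dist_comm]
    refine this.trans (le_of_eq ?_)
    ring
  have huc : ContinuousOn u Ω := by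
    refine TendstoLocallyUniformlyOn.continuousOn (F := s) (p := atTop) ?_
      (Frequently.of_forall hsc)
    rw [Metric.tendstoLocallyUniformlyOn_iff]
    intro ε hε x hx
    obtain ⟨C, hCx, hC, ⟨B, hB⟩, ⟨M, hM⟩, hK⟩ := hloc x hx
    refine ⟨C, hCx, ?_⟩
    have ht : Tendsto (fun n : ℕ => 2 * |B| * (1 / 2) ^ n * |M|) atTop (𝓝 0) := by
      have := (tendsto_pow_atTop_nhds_zero_of_lt_one (r := (1 / 2 : ℝ)) (by norm_num)
        (by norm_num)).const_mul (2 * |B|) |>.mul_const |M|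
      simpa using this
    filter_upwards [ht.eventually_lt_const hε] with n hn y hy
    rw [dist_eq_norm]
    refine lt_of_le_of_lt ?_ hn
    have h1 := herr C hC B hB hK n y hy
    rw [Pi.sub_apply] at h1
    refine h1.trans ?_
    have hwM : w y ≤ |M| := (hM y hy).trans (le_abs_self M)
    have hBB := le_abs_self B
    have hwy := hw y
    gcongr
  refine ⟨u, huc, fun x hx => ?_⟩
  obtain ⟨C, hCx, hC, ⟨B, hB⟩, -, hK⟩ := hloc x hx
  have hxC := mem_of_mem_nhdsWithin hx hCx
  have h1 : Tendsto (fun n => s (n + 1) x) atTop (𝓝 (u x)) :=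
    (hut x hx).comp (tendsto_add_atTop_nat 1)
  have h2 : Tendsto (fun n => K (s n) x) atTop (𝓝 (K u x)) := by
    rw [tendsto_iff_norm_sub_tendsto_zero]
    have ht : Tendsto (fun n : ℕ => 2 * B * (1 / 2) ^ n / 2 * w x) atTop (𝓝 0) := by
      have := (((tendsto_pow_atTop_nhds_zero_of_lt_one (r := (1 / 2 : ℝ)) (by norm_num)
        (by norm_num)).const_mul (2 * B)).div_const 2).mul_const (w x)
      simpa using this
    refine squeeze_zero (fun n => norm_nonneg _) (fun n => ?_) ht
    rw [norm_sub_rev, ← hsub u (s n) huc (hsc n) x hx]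
    exact hK _ _ (huc.sub (hsc n)) (herr C hC B hB hK n) x hxC
  have h3 : Tendsto (fun n => s (n + 1) x) atTop (𝓝 (U x + K u x)) := by
    simpa [hs1] using h2.const_add (U x)
  exact tendsto_nhds_unique h1 h3

theorem continuousOn_intervalIntegral {X E : Type*} [TopologicalSpace X] [NormedAddCommGroup E]
    [NormedSpace ℝ E] {s : Set X} {F : X → ℝ → E} {a b : ℝ} (hab : a ≤ b)
    (hF : ContinuousOn (fun p : X × ℝ => F p.1 p.2) (s ×ˢ Icc a b)) :
    ContinuousOn (fun x => ∫ y in a..b, F x y) s := by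
  rw [continuousOn_iff_continuous_domRestrict]
  -- Clamping y to [a, b] gives a continuous integrand for all real y without changing the integral.
  have h1 : Continuous (fun p : s × ℝ => F p.1 (projIcc a b hab p.2)) := by
    have : Continuous (fun p : s × ℝ => ((p.1 : X), (projIcc a b hab p.2 : ℝ))) := by
      have := continuous_projIcc (h := hab)
      fun_prop
    exact hF.comp_continuous this fun p => ⟨p.1.2, (projIcc a b hab p.2).2⟩
  have h2 := intervalIntegral.continuous_parametric_intervalIntegral_of_continuous'
    (f := fun (x : s) y => F x (projIcc a b hab y)) (μ := volume) h1 a b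
  refine h2.congr fun x => ?_
  refine intervalIntegral.integral_congr fun y hy => ?_
  rw [uIcc_of_le hab] at hy
  simp only [projIcc_of_mem hab hy]

/-! ### Inverting T on continuous functions. -/

/-- The operator `T` on functions of one radial variable. -/
def rayT (G : ℝ → ℝ → ℂ) (φ : ℝ → ℂ) (r : ℝ) : ℂ :=
  φ r + ∫ σ in (0 : ℝ)..1, (σ : ℂ) * G r (1 - σ ^ 2) * φ (σ ^ 2 * r)

theorem scalarT_ray (G : ℝ → ℝ → ℂ) (u : ℂ → ℂ) {e : ℂ} (he : ‖e‖ = 1) {t : ℝ} (ht : 0 ≤ t) :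
    scalarT G u (t * e) = rayT G (fun s => u (s * e)) t := by
  simp [scalarT, rayT, he, abs_of_nonneg ht, mul_assoc]

theorem one_sub_sq_mem {σ : ℝ} (hσ : σ ∈ Icc (0 : ℝ) 1) : 1 - σ ^ 2 ∈ Icc (0 : ℝ) 1 :=
  ⟨by nlinarith [hσ.1, hσ.2], by nlinarith [sq_nonneg σ]⟩

theorem sq_mem_unit {σ : ℝ} (hσ : σ ∈ Icc (0 : ℝ) 1) : σ ^ 2 ∈ Icc (0 : ℝ) 1 :=
  ⟨sq_nonneg σ, by nlinarith [hσ.1, hσ.2]⟩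

/-- A kernel that is continuous on `[0, ρ] × [0, 1]` and vanishes at `r = 0`. -/
structure IsVolterraKernel (ρ : ℝ) (G : ℝ → ℝ → ℂ) : Prop where
  continuousOn : ContinuousOn (fun p : ℝ × ℝ => G p.1 p.2) (Icc 0 ρ ×ˢ Icc 0 1)
  zero : ∀ t ∈ Icc (0 : ℝ) 1, G 0 t = 0

theorem IsVolterraKernel.one_sub_mul {ρ : ℝ} {G : ℝ → ℝ → ℂ} (hG : IsVolterraKernel ρ G) :
    IsVolterraKernel ρ (fun r t => (1 - t) * G r t) where
  continuousOn := ContinuousOn.mul (by fun_prop) hG.continuousOn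
  zero t ht := by simp [hG.zero t ht]

theorem IsVolterraKernel.continuousOn_sq {ρ : ℝ} {G : ℝ → ℝ → ℂ} (hG : IsVolterraKernel ρ G) :
    ContinuousOn (fun p : ℝ × ℝ => G p.1 (1 - p.2 ^ 2)) (Icc 0 ρ ×ˢ Icc 0 1) :=
  hG.continuousOn.comp (f := fun p : ℝ × ℝ => (p.1, 1 - p.2 ^ 2)) (by fun_prop)
    fun p hp => ⟨hp.1, one_sub_sq_mem hp.2⟩

theorem IsVolterraKernel.exists_bound {ρ : ℝ} {G : ℝ → ℝ → ℂ} (hG : IsVolterraKernel ρ G) :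
    ∃ M, 0 < M ∧ ∀ r ∈ Icc 0 ρ, ∀ t ∈ Icc (0 : ℝ) 1, ‖G r t‖ ≤ M := by
  obtain ⟨M, hM⟩ := (isCompact_Icc.prod isCompact_Icc).exists_bound_of_continuousOn hG.continuousOn
  exact ⟨max M 1, by positivity, fun r hr t ht => (hM (r, t) ⟨hr, ht⟩).trans (le_max_left _ _)⟩

theorem integral_mul_exp_sq {c : ℝ} (hc : 0 < c) :
    ∫ σ in (0 : ℝ)..1, σ * Real.exp (c * σ ^ 2) = (Real.exp c - 1) / (2 * c) := by
  have h : ∀ σ ∈ uIcc (0 : ℝ) 1, HasDerivAt (fun σ => Real.exp (c * σ ^ 2) / (2 * c))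
      (σ * Real.exp (c * σ ^ 2)) σ := by
    intro σ _
    have h1 : HasDerivAt (fun σ : ℝ => c * σ ^ 2) (c * (2 * σ)) σ := by
      simpa using (hasDerivAt_pow 2 σ).const_mul c
    refine (h1.exp.div_const (2 * c)).congr_deriv ?_
    field_simp
  rw [intervalIntegral.integral_eq_sub_of_hasDerivAt h
    (Continuous.intervalIntegrable (by fun_prop) _ _)]
  simp
  ring

/-- In an exponentially weighted norm the integral part of `T` has norm at most `1 / 2`. -/
theorem IsVolterraKernel.exists_weight {ρ : ℝ} {G : ℝ → ℝ → ℂ} (hG : IsVolterraKernel ρ G) :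
    ∃ c : ℝ, 0 < c ∧ ∀ r ∈ Icc 0 ρ, ∀ (B : ℝ) (φ : ℝ → ℂ),
      (∀ σ ∈ Icc (0 : ℝ) 1, ‖φ σ‖ ≤ B * Real.exp (c * (σ ^ 2 * r))) →
      ‖∫ σ in (0 : ℝ)..1, (σ : ℂ) * G r (1 - σ ^ 2) * φ σ‖ ≤ B / 2 * Real.exp (c * r) := by
  obtain ⟨M, hM0, hM⟩ := hG.exists_bound
  obtain ⟨δ, hδ, hδ'⟩ := Metric.uniformContinuousOn_iff.1
    ((isCompact_Icc.prod isCompact_Icc).uniformContinuousOn_of_continuous hG.continuousOn)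
    (1 / 2) (by norm_num)
  have hsmall : ∀ r ∈ Icc 0 ρ, r < δ → ∀ t ∈ Icc (0 : ℝ) 1, ‖G r t‖ ≤ 1 / 2 := by
    intro r hr hrδ t ht
    have := hδ' (r, t) ⟨hr, ht⟩ (0, t) ⟨⟨le_rfl, hr.1.trans hr.2⟩, ht⟩
      (by simpa [Prod.dist_eq, abs_of_nonneg hr.1] using ⟨hrδ, hδ⟩)
    rw [hG.zero t ht, dist_zero_right] at this
    exact this.le
  -- For r < δ the kernel is at most 1/2. For r ≥ δ the exact integral of σ exp(crσ²) yields the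
  -- factor M/(2cr) ≤ M/(2cδ), which is 1/2 for c = M/δ.
  refine ⟨M / δ, by positivity, fun r hr B φ hφ => ?_⟩
  have hB : 0 ≤ B := by
    have := (norm_nonneg _).trans (hφ 0 ⟨le_rfl, zero_le_one⟩)
    simpa using this
  rcases lt_or_ge r δ with hrδ | hrδ
  · have hb : ∀ σ ∈ uIoc (0 : ℝ) 1, ‖(σ : ℂ) * G r (1 - σ ^ 2) * φ σ‖ ≤
        B / 2 * Real.exp (M / δ * r) := by
      intro σ hσ
      rw [uIoc_of_le zero_le_one] at hσ
      have hσ' : σ ∈ Icc (0 : ℝ) 1 := ⟨hσ.1.le, hσ.2⟩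
      have h1 := hφ σ hσ'
      have h2 : Real.exp (M / δ * (σ ^ 2 * r)) ≤ Real.exp (M / δ * r) := by
        apply Real.exp_le_exp.2
        have := (sq_mem_unit hσ').2
        have := hr.1
        gcongr
        exact mul_le_of_le_one_left hr.1 (sq_mem_unit hσ').2
      rw [norm_mul, norm_mul, Complex.norm_real, Real.norm_of_nonneg hσ.1.le]
      calc σ * ‖G r (1 - σ ^ 2)‖ * ‖φ σ‖
          ≤ 1 * (1 / 2) * (B * Real.exp (M / δ * r)) := by
            gcongr
            · exact hσ.2
            · exact hsmall r hr hrδ _ (one_sub_sq_mem hσ')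
            · exact h1.trans (by gcongr)
        _ = _ := by ring
    simpa using intervalIntegral.norm_integral_le_of_norm_le_const hb
  · have hr0 : 0 < r := hδ.trans_le hrδ
    have hb : ∀ᵐ σ, σ ∈ Ioc (0 : ℝ) 1 → ‖(σ : ℂ) * G r (1 - σ ^ 2) * φ σ‖ ≤
        M * B * (σ * Real.exp (M / δ * r * σ ^ 2)) := by
      refine Eventually.of_forall fun σ hσ => ?_
      have hσ' : σ ∈ Icc (0 : ℝ) 1 := ⟨hσ.1.le, hσ.2⟩
      have h1 := hφ σ hσ'
      rw [norm_mul, norm_mul, Complex.norm_real, Real.norm_of_nonneg hσ.1.le]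
      calc σ * ‖G r (1 - σ ^ 2)‖ * ‖φ σ‖
          ≤ σ * M * (B * Real.exp (M / δ * (σ ^ 2 * r))) := by
            have := hσ.1.le
            gcongr
            exact hM r hr _ (one_sub_sq_mem hσ')
        _ = _ := by rw [mul_comm (σ ^ 2) r, ← mul_assoc (M / δ)]; ring
    refine (intervalIntegral.norm_integral_le_of_norm_le zero_le_one hb
      (Continuous.intervalIntegrable (by fun_prop) _ _)).trans ?_
    rw [intervalIntegral.integral_const_mul, integral_mul_exp_sq (by positivity)]
    have he := Real.exp_pos (M / δ * r)
    calc M * B * ((Real.exp (M / δ * r) - 1) / (2 * (M / δ * r)))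
        ≤ M * B * (Real.exp (M / δ * r) / (2 * (M / δ * δ))) := by
          gcongr
          linarith
      _ = B / 2 * Real.exp (M / δ * r) := by field_simp

/-- The points σ²r stay in [0, R], so φ is minus its own Volterra integral and each substitution
halves its weighted bound. -/
theorem eq_zero_of_rayT_eq_zero {ρ R : ℝ} {G : ℝ → ℝ → ℂ} (hG : IsVolterraKernel ρ G)
    (hR : R ≤ ρ) {φ : ℝ → ℂ} (hφ : ContinuousOn φ (Icc 0 R))
    (h0 : ∀ r ∈ Icc 0 R, rayT G φ r = 0) : ∀ r ∈ Icc 0 R, φ r = 0 := by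
  obtain ⟨c, hc, hw⟩ := hG.exists_weight
  obtain ⟨B, hB⟩ := isCompact_Icc.exists_bound_of_continuousOn hφ
  have key : ∀ n : ℕ, ∀ r ∈ Icc 0 R, ‖φ r‖ ≤ |B| * (1 / 2) ^ n * Real.exp (c * r) := by
    intro n
    induction n with
    | zero =>
      intro r hr
      have h1 : 1 ≤ Real.exp (c * r) := Real.one_le_exp (mul_nonneg hc.le hr.1)
      calc ‖φ r‖ ≤ |B| * 1 := by simpa using (hB r hr).trans (le_abs_self B)
        _ ≤ |B| * Real.exp (c * r) := by gcongr
        _ = _ := by simp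
    | succ n ih =>
      intro r hr
      have h1 : φ r = -∫ σ in (0 : ℝ)..1, (σ : ℂ) * G r (1 - σ ^ 2) * φ (σ ^ 2 * r) :=
        eq_neg_of_add_eq_zero_left (h0 r hr)
      rw [h1, norm_neg]
      have := hw r ⟨hr.1, hr.2.trans hR⟩ (|B| * (1 / 2) ^ n) (fun σ => φ (σ ^ 2 * r))
        fun σ hσ => ih _ ⟨mul_nonneg (sq_nonneg σ) hr.1,
          (mul_le_of_le_one_left hr.1 (sq_mem_unit hσ).2).trans hr.2⟩
      refine this.trans (le_of_eq ?_)
      rw [pow_succ]; ring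
  intro r hr
  have ht : Tendsto (fun n : ℕ => |B| * (1 / 2) ^ n * Real.exp (c * r)) atTop (𝓝 0) := by
    have := ((tendsto_pow_atTop_nhds_zero_of_lt_one (r := (1 / 2 : ℝ)) (by norm_num)
      (by norm_num)).const_mul |B|).mul_const (Real.exp (c * r))
    simpa using this
  exact norm_le_zero_iff.1 (ge_of_tendsto' ht fun n => key n r hr)

section StarShaped

variable {Ω : Set ℂ} {ρ : ℝ} {G : ℝ → ℝ → ℂ}

theorem ofReal_mul_mem (hs : StarConvex ℝ (0 : ℂ) Ω) {z : ℂ} (hz : z ∈ Ω) {t : ℝ}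
    (ht : t ∈ Icc (0 : ℝ) 1) : (t : ℂ) * z ∈ Ω := by
  simpa using hs.smul_mem hz ht.1 ht.2

theorem sq_mul_mem (hs : StarConvex ℝ (0 : ℂ) Ω) {z : ℂ} (hz : z ∈ Ω) {σ : ℝ}
    (hσ : σ ∈ Icc (0 : ℝ) 1) : (σ : ℂ) ^ 2 * z ∈ Ω := by
  simpa using ofReal_mul_mem hs hz (sq_mem_unit hσ)

theorem continuousOn_scalarT_integrand (hG : IsVolterraKernel ρ G)
    (hs : StarConvex ℝ (0 : ℂ) Ω) (hρ : ∀ z ∈ Ω, ‖z‖ ≤ ρ) {u : ℂ → ℂ} (hu : ContinuousOn u Ω) :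
    ContinuousOn (fun p : ℂ × ℝ => (p.2 : ℂ) * G ‖p.1‖ (1 - p.2 ^ 2) * u ((p.2 : ℂ) ^ 2 * p.1))
      (Ω ×ˢ Icc 0 1) := by
  refine ContinuousOn.mul (ContinuousOn.mul (by fun_prop) ?_) ?_
  · exact hG.continuousOn_sq.comp (f := fun p : ℂ × ℝ => (‖p.1‖, p.2)) (by fun_prop)
      fun p hp => ⟨⟨norm_nonneg _, hρ _ hp.1⟩, hp.2⟩
  · exact hu.comp (by fun_prop) fun p hp => sq_mul_mem hs hp.1 hp.2

theorem continuousOn_scalarT (hG : IsVolterraKernel ρ G)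
    (hs : StarConvex ℝ (0 : ℂ) Ω) (hρ : ∀ z ∈ Ω, ‖z‖ ≤ ρ) {u : ℂ → ℂ} (hu : ContinuousOn u Ω) :
    ContinuousOn (scalarT G u) Ω :=
  hu.add (continuousOn_intervalIntegral zero_le_one (continuousOn_scalarT_integrand hG hs hρ hu))

theorem intervalIntegrable_scalarT (hG : IsVolterraKernel ρ G)
    (hs : StarConvex ℝ (0 : ℂ) Ω) (hρ : ∀ z ∈ Ω, ‖z‖ ≤ ρ) {u : ℂ → ℂ} (hu : ContinuousOn u Ω)
    {z : ℂ} (hz : z ∈ Ω) :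
    IntervalIntegrable (fun σ : ℝ => (σ : ℂ) * G ‖z‖ (1 - σ ^ 2) * u ((σ : ℂ) ^ 2 * z))
      volume 0 1 := by
  refine ContinuousOn.intervalIntegrable ?_
  rw [uIcc_of_le zero_le_one]
  exact (continuousOn_scalarT_integrand hG hs hρ hu).comp (f := fun σ : ℝ => (z, σ)) (by fun_prop)
    fun σ hσ => ⟨hz, hσ⟩

/-- The operator `T` is onto on the continuous functions in a star-shaped open set. -/
theorem exists_scalarT_eq (hG : IsVolterraKernel ρ G) (ho : IsOpen Ω)
    (hs : StarConvex ℝ (0 : ℂ) Ω) (hρ : ∀ z ∈ Ω, ‖z‖ ≤ ρ) {U : ℂ → ℂ} (hU : ContinuousOn U Ω) :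
    ∃ u, ContinuousOn u Ω ∧ ∀ z ∈ Ω, scalarT G u z = U z := by
  obtain ⟨c, hc, hw⟩ := hG.exists_weight
  have := exists_eq_add_of_weighted_contraction (Ω := Ω)
    (fun u z => -∫ σ in (0 : ℝ)..1, (σ : ℂ) * G ‖z‖ (1 - σ ^ 2) * u ((σ : ℂ) ^ 2 * z))
    (fun z => Real.exp (c * ‖z‖)) (fun z => (Real.exp_pos _).le) hU
    (fun u hu => (continuousOn_intervalIntegral zero_le_one
      (continuousOn_scalarT_integrand hG hs hρ hu)).neg) ?_ ?_
  · obtain ⟨u, huc, hu⟩ := this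
    refine ⟨u, huc, fun z hz => ?_⟩
    have := hu z hz
    rw [scalarT]
    linear_combination this
  · intro u v hu hv z hz
    have h := intervalIntegral.integral_sub (intervalIntegrable_scalarT hG hs hρ hu hz)
      (intervalIntegrable_scalarT hG hs hρ hv hz)
    simp only [Pi.sub_apply, mul_sub]
    rw [h]
    ring
  · intro z hz
    obtain ⟨ε, hε, hball⟩ := Metric.nhds_basis_closedBall.mem_iff.1 (ho.mem_nhds hz)
    -- The cone from 0 over a closed ball around z: compact, a neighbourhood of z, inside Ω by
    -- star-shapedness, and stable under z ↦ σ²z, so the integral operator acts on functions on it.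
    set C : Set ℂ := (fun p : ℝ × ℂ => (p.1 : ℂ) * p.2) '' (Icc 0 1 ×ˢ Metric.closedBall z ε)
      with hC
    have hCc : IsCompact C :=
      (isCompact_Icc.prod (isCompact_closedBall z ε)).image (by fun_prop)
    have hCΩ : C ⊆ Ω := by
      rintro _ ⟨p, hp, rfl⟩
      exact ofReal_mul_mem hs (hball hp.2) hp.1
    have hCz : C ∈ 𝓝 z := by
      refine mem_of_superset (Metric.closedBall_mem_nhds z hε) fun w hw => ?_
      exact ⟨(1, w), ⟨⟨zero_le_one, le_rfl⟩, hw⟩, by simp⟩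
    have hCs : ∀ y ∈ C, ∀ σ ∈ Icc (0 : ℝ) 1, (σ : ℂ) ^ 2 * y ∈ C := by
      rintro _ ⟨p, hp, rfl⟩ σ hσ
      refine ⟨(σ ^ 2 * p.1, p.2), ⟨⟨mul_nonneg (sq_nonneg _) hp.1.1, ?_⟩, hp.2⟩, ?_⟩
      · exact mul_le_one₀ (sq_mem_unit hσ).2 hp.1.1 hp.1.2
      · push_cast; ring
    refine ⟨C, mem_nhdsWithin_of_mem_nhds hCz, hCΩ, ?_, ?_, ?_⟩
    · obtain ⟨B, hB⟩ := hCc.exists_bound_of_continuousOn (hU.mono hCΩ)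
      refine ⟨|B|, fun y hy => ((hB y hy).trans (le_abs_self B)).trans ?_⟩
      exact le_mul_of_one_le_right (abs_nonneg B)
        (Real.one_le_exp (mul_nonneg hc.le (norm_nonneg _)))
    · refine ⟨Real.exp (c * ρ), fun y hy => Real.exp_le_exp.2 ?_⟩
      have := hρ y (hCΩ hy)
      gcongr
    · intro u B _ hb y hy
      rw [norm_neg]
      refine hw ‖y‖ ⟨norm_nonneg _, hρ y (hCΩ hy)⟩ B (fun σ => u ((σ : ℂ) ^ 2 * y)) fun σ hσ => ?_
      have := hb _ (hCs y hy σ hσ)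
      rwa [norm_mul, norm_pow, Complex.norm_real, Real.norm_of_nonneg hσ.1] at this

end StarShaped

/-- Continuity of F' up to both ends of [a, b] supplies the dominating constant on a smaller
parameter interval. The derivative itself is asked for only at interior t, the endpoint being null;
this matters below, where kernels are differentiated only for σ < 1. -/
theorem hasDerivAt_intervalIntegral {F F' : ℝ → ℝ → ℂ} {a b l r x₀ : ℝ} (hab : a ≤ b)
    (hx : x₀ ∈ Ioo l r)
    (hF : ContinuousOn (fun p : ℝ × ℝ => F p.1 p.2) (Ioo l r ×ˢ Icc a b))
    (hF' : ContinuousOn (fun p : ℝ × ℝ => F' p.1 p.2) (Ioo l r ×ˢ Icc a b))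
    (hd : ∀ x ∈ Ioo l r, ∀ t ∈ Ioo a b, HasDerivAt (fun x => F x t) (F' x t) x) :
    HasDerivAt (fun x => ∫ t in a..b, F x t) (∫ t in a..b, F' x₀ t) x₀ := by
  obtain ⟨l', hl, hl'⟩ := exists_between hx.1
  obtain ⟨r', hr, hr'⟩ := exists_between hx.2
  have hsub : Icc l' r' ⊆ Ioo l r := fun x hx => ⟨hl.trans_le hx.1, hx.2.trans_lt hr'⟩
  obtain ⟨M, hM⟩ := (isCompact_Icc.prod isCompact_Icc).exists_bound_of_continuousOn
    (hF'.mono (prod_mono_left hsub))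
  have hslice : ∀ {H : ℝ → ℝ → ℂ}, ContinuousOn (fun p : ℝ × ℝ => H p.1 p.2) (Ioo l r ×ˢ Icc a b) →
      ∀ x ∈ Ioo l r, ContinuousOn (H x) (Icc a b) := fun hH x hx =>
    hH.comp (f := fun t : ℝ => (x, t)) (by fun_prop) fun t ht => ⟨hx, ht⟩
  have hmeas : ∀ {H : ℝ → ℝ → ℂ}, ContinuousOn (fun p : ℝ × ℝ => H p.1 p.2) (Ioo l r ×ˢ Icc a b) →
      ∀ x ∈ Ioo l r, AEStronglyMeasurable (H x) (volume.restrict (uIoc a b)) := fun hH x hx => by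
    rw [uIoc_of_le hab]
    exact ((hslice hH x hx).mono Ioc_subset_Icc_self).aestronglyMeasurable measurableSet_Ioc
  refine (intervalIntegral.hasDerivAt_integral_of_dominated_loc_of_deriv_le (bound := fun _ => M)
    (s := Ioo l' r') (F := F) (F' := F') (Ioo_mem_nhds hl' hr) ?_ ?_ (hmeas hF' x₀ hx) ?_
    (by simp) ?_).2
  · filter_upwards [Ioo_mem_nhds hl' hr] with x hx
    exact hmeas hF x (hsub (Ioo_subset_Icc_self hx))
  · refine ContinuousOn.intervalIntegrable ?_
    rw [uIcc_of_le hab]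
    exact hslice hF x₀ hx
  · refine Eventually.of_forall fun t ht x hx => ?_
    rw [uIoc_of_le hab] at ht
    exact hM (x, t) ⟨Ioo_subset_Icc_self hx, Ioc_subset_Icc_self ht⟩
  · have : ∀ᵐ t : ℝ, t ≠ b := by simp [ae_iff, measure_singleton]
    filter_upwards [this] with t htb ht x hx
    rw [uIoc_of_le hab] at ht
    exact hd x (hsub (Ioo_subset_Icc_self hx)) t ⟨ht.1, lt_of_le_of_ne ht.2 htb⟩

/-! ### Integrals along characteristics and along the radius. -/

/-- The integral of `Z` over the characteristic `rσ = const` through `(r, σ)`. -/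
def charInt (Z : ℝ × ℝ → ℂ) (p : ℝ × ℝ) : ℂ := ∫ b in p.2..1, Z (p.1 * b, p.2 / b)

theorem char_mem {ρ : ℝ} {p : ℝ × ℝ} (hp : p ∈ Icc (0 : ℝ) ρ ×ˢ Icc (0 : ℝ) 1) {b : ℝ}
    (hb : b ∈ Icc p.2 1) : (p.1 * b, p.2 / b) ∈ Icc (0 : ℝ) ρ ×ˢ Icc (0 : ℝ) 1 := by
  have hb0 : 0 ≤ b := hp.2.1.trans hb.1
  exact ⟨⟨mul_nonneg hp.1.1 hb0, (mul_le_of_le_one_right hp.1.1 hb.2).trans hp.1.2⟩,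
    div_nonneg hp.2.1 hb0, div_le_one_of_le₀ hb.1 hb0⟩

theorem continuousOn_char {ρ : ℝ} {Z : ℝ × ℝ → ℂ}
    (hZ : ContinuousOn Z (Icc 0 ρ ×ˢ Icc 0 1)) {p : ℝ × ℝ} (hp : p ∈ Icc 0 ρ ×ˢ Icc (0 : ℝ) 1) :
    ContinuousOn (fun b => Z (p.1 * b, p.2 / b)) (Ioc p.2 1) := by
  refine hZ.comp (f := fun b : ℝ => (p.1 * b, p.2 / b)) ?_
    fun b hb => char_mem hp (Ioc_subset_Icc_self hb)
  refine ContinuousOn.prodMk (by fun_prop) (continuousOn_const.div continuousOn_id fun b hb => ?_)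
  exact (hp.2.1.trans_lt hb.1).ne'

/-- The lower limit moves and σ/b has no limit at (0, 0), so continuity up to σ = 0 comes from
dominated convergence. With the domain written as an indicator, the integrand is continuous at p for
every b except b = p.2, a null set. -/
theorem continuousOn_charInt {ρ : ℝ} {Z : ℝ × ℝ → ℂ}
    (hZ : ContinuousOn Z (Icc 0 ρ ×ˢ Icc 0 1)) :
    ContinuousOn (charInt Z) (Icc 0 ρ ×ˢ Icc 0 1) := by
  set R : Set (ℝ × ℝ) := Icc 0 ρ ×ˢ Icc 0 1 with hR
  obtain ⟨M, hM⟩ := (isCompact_Icc.prod isCompact_Icc).exists_bound_of_continuousOn hZ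
  set F : ℝ × ℝ → ℝ → ℂ := fun p => (Ioc p.2 1).indicator fun b => Z (p.1 * b, p.2 / b) with hF
  have heq : ∀ p ∈ R, charInt Z p = ∫ b in (0 : ℝ)..1, F p b := by
    intro p hp
    rw [charInt, intervalIntegral.integral_of_le hp.2.2, intervalIntegral.integral_of_le zero_le_one,
      setIntegral_indicator measurableSet_Ioc, inter_eq_self_of_subset_right]
    exact Ioc_subset_Ioc_left hp.2.1
  refine ContinuousOn.congr ?_ heq
  intro p hp
  refine intervalIntegral.continuousWithinAt_of_dominated_interval (bound := fun _ => |M|)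
    ?_ ?_ (by simp) ?_
  · filter_upwards [self_mem_nhdsWithin] with x hx
    refine (aestronglyMeasurable_indicator_iff measurableSet_Ioc).2 ?_ |>.mono_measure
      Measure.restrict_le_self
    exact (continuousOn_char hZ hx).aestronglyMeasurable measurableSet_Ioc
  · filter_upwards [self_mem_nhdsWithin] with x hx
    refine Eventually.of_forall fun b _ => ?_
    by_cases hb : b ∈ Ioc x.2 1
    · simp only [hF, indicator_of_mem hb]
      exact (hM _ (char_mem hx (Ioc_subset_Icc_self hb))).trans (le_abs_self M)
    · simp [hF, indicator_of_notMem hb]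
  · have : ∀ᵐ b : ℝ, b ≠ p.2 := by simp [ae_iff, measure_singleton]
    filter_upwards [this] with b hbp hb
    rw [uIoc_of_le zero_le_one] at hb
    rcases lt_or_gt_of_ne hbp with h | h
    · have : (fun x : ℝ × ℝ => F x b) =ᶠ[𝓝[R] p] fun _ => 0 := by
        refine eventually_nhdsWithin_of_eventually_nhds ?_
        filter_upwards [(isOpen_lt continuous_const continuous_snd).mem_nhds h] with x hx
        exact indicator_of_notMem (fun h' => lt_asymm hx h'.1) _
      exact continuousWithinAt_const.congr_of_eventuallyEq_of_mem this hp
    · have hev : ∀ᶠ x : ℝ × ℝ in 𝓝 p, x.2 < b :=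
        (isOpen_lt continuous_snd continuous_const).mem_nhds h
      have : (fun x : ℝ × ℝ => F x b) =ᶠ[𝓝[R] p] fun x => Z (x.1 * b, x.2 / b) := by
        refine eventually_nhdsWithin_of_eventually_nhds ?_
        filter_upwards [hev] with x hx
        exact indicator_of_mem (show b ∈ Ioc x.2 1 from ⟨hx, hb.2⟩) _
      refine ContinuousWithinAt.congr_of_eventuallyEq_of_mem ?_ this hp
      have hmap : ContinuousWithinAt (fun x : ℝ × ℝ => (x.1 * b, x.2 / b)) (R ∩ {x | x.2 < b}) p :=
        Continuous.continuousWithinAt (by fun_prop)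
      refine (ContinuousWithinAt.comp (f := fun x : ℝ × ℝ => (x.1 * b, x.2 / b)) (x := p)
        (hZ (p.1 * b, p.2 / b) (char_mem hp ⟨h.le, hb.2⟩)) hmap
        fun x hx => char_mem hx.1 ⟨le_of_lt hx.2, hb.2⟩).mono_of_mem_nhdsWithin ?_
      exact inter_mem_nhdsWithin _ hev

/-- Change of variables `β = σ / b` along a characteristic. -/
theorem charInt_eq {ρ : ℝ} {Z : ℝ × ℝ → ℂ}
    (hZ : ContinuousOn Z (Icc 0 ρ ×ˢ Icc 0 1)) {r σ : ℝ} (hr : r ∈ Icc 0 ρ) (hσ : σ ∈ Ioc (0 : ℝ) 1) :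
    charInt Z (r, σ) = ∫ β in σ..1, (σ : ℂ) / β ^ 2 * Z (r * σ / β, β) := by
  have hσ0 := hσ.1
  have key := intervalIntegral.integral_deriv_smul_comp'' (a := σ) (b := 1)
    (f := fun b : ℝ => σ / b) (f' := fun b : ℝ => -σ / b ^ 2)
    (g := fun β : ℝ => (σ : ℂ) / β ^ 2 * Z (r * σ / β, β)) ?_ ?_ ?_ ?_
  · simp only [div_self hσ0.ne', div_one] at key
    rw [intervalIntegral.integral_symm σ 1, ← neg_eq_iff_eq_neg, ← intervalIntegral.integral_neg] at key
    rw [← key, charInt]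
    refine intervalIntegral.integral_congr fun b hb => ?_
    rw [uIcc_of_le hσ.2] at hb
    have hb0 : 0 < b := hσ0.trans_le hb.1
    have hbC : (b : ℂ) ≠ 0 := by exact_mod_cast hb0.ne'
    have hσC : (σ : ℂ) ≠ 0 := by exact_mod_cast hσ0.ne'
    simp only [Function.comp, Complex.real_smul]
    have h1 : r * σ / (σ / b) = r * b := by field_simp
    rw [h1]
    push_cast
    field_simp
  · rw [uIcc_of_le hσ.2]
    exact continuousOn_const.div continuousOn_id fun b hb => (hσ0.trans_le hb.1).ne'
  · intro b hb
    rw [min_eq_left hσ.2, max_eq_right hσ.2] at hb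
    have hb0 : b ≠ 0 := (hσ0.trans hb.1).ne'
    have := (hasDerivAt_inv hb0).const_mul σ
    refine HasDerivAt.hasDerivWithinAt ?_
    refine (this.congr_deriv ?_).congr_of_eventuallyEq (Eventually.of_forall fun b => ?_)
    · field_simp
    · exact div_eq_mul_inv _ _
  · rw [uIcc_of_le hσ.2]
    exact continuousOn_const.div (by fun_prop) fun b hb => by
      have := hσ0.trans_le hb.1
      positivity
  · have himg : (fun b : ℝ => σ / b) '' uIcc σ 1 ⊆ Icc σ 1 := by
      rintro _ ⟨b, hb, rfl⟩
      rw [uIcc_of_le hσ.2] at hb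
      have hb0 : 0 < b := hσ0.trans_le hb.1
      exact ⟨(le_div_iff₀ hb0).2 (mul_le_of_le_one_right hσ0.le hb.2), div_le_one_of_le₀ hb.1 hb0.le⟩
    refine ContinuousOn.mono ?_ himg
    refine ContinuousOn.mul (continuousOn_const.div (by fun_prop) fun b hb => ?_) ?_
    · have := hσ0.trans_le hb.1
      exact_mod_cast (by positivity : b ^ 2 ≠ 0)
    · refine hZ.comp (f := fun β : ℝ => (r * σ / β, β)) (ContinuousOn.prodMk
        (continuousOn_const.div continuousOn_id fun b hb => (hσ0.trans_le hb.1).ne')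
        continuousOn_id) fun b hb => ?_
      have hb0 : 0 < b := hσ0.trans_le hb.1
      refine ⟨⟨by have := hr.1; positivity, ?_⟩, hb0.le, hb.2⟩
      rw [div_le_iff₀ hb0]
      exact mul_le_mul hr.2 hb.1 hσ0.le (hr.1.trans hr.2)

/-- The primitive `∫_0^r k(τ, σ) dτ`, in scaled form. -/
def radInt (k : ℝ × ℝ → ℂ) (p : ℝ × ℝ) : ℂ := p.1 * ∫ a in (0 : ℝ)..1, k (p.1 * a, p.2)

theorem scale_mem {ρ r a : ℝ} (hr : r ∈ Icc 0 ρ) (ha : a ∈ Icc (0 : ℝ) 1) : r * a ∈ Icc 0 ρ :=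
  ⟨mul_nonneg hr.1 ha.1, (mul_le_of_le_one_right hr.1 ha.2).trans hr.2⟩

theorem radInt_eq (k : ℝ × ℝ → ℂ) (r σ : ℝ) : radInt k (r, σ) = ∫ τ in (0 : ℝ)..r, k (τ, σ) := by
  have := intervalIntegral.smul_integral_comp_mul_left (a := 0) (b := 1) (fun τ => k (τ, σ)) r
  simpa [radInt] using this

theorem continuousOn_radInt {ρ : ℝ} {S : Set ℝ} {k : ℝ × ℝ → ℂ}
    (hk : ContinuousOn k (Icc 0 ρ ×ˢ S)) : ContinuousOn (radInt k) (Icc 0 ρ ×ˢ S) := by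
  refine ContinuousOn.mul (by fun_prop) (continuousOn_intervalIntegral zero_le_one
    (F := fun (p : ℝ × ℝ) a => k (p.1 * a, p.2)) ?_)
  exact hk.comp (f := fun p : (ℝ × ℝ) × ℝ => (p.1.1 * p.2, p.1.2)) (by fun_prop)
    fun p hp => ⟨scale_mem hp.1.1 hp.2, hp.1.2⟩

theorem hasDerivAt_radInt {ρ : ℝ} {S : Set ℝ} {k : ℝ × ℝ → ℂ}
    (hk : ContinuousOn k (Icc 0 ρ ×ˢ S)) {r σ : ℝ} (hr : r ∈ Ioo 0 ρ) (hσ : σ ∈ S) :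
    HasDerivAt (fun r => radInt k (r, σ)) (k (r, σ)) r := by
  simp only [radInt_eq]
  have hc : ContinuousOn (fun τ => k (τ, σ)) (Icc 0 ρ) :=
    hk.comp (f := fun τ : ℝ => (τ, σ)) (by fun_prop) fun τ hτ => ⟨hτ, hσ⟩
  refine intervalIntegral.integral_hasDerivAt_right ?_ ?_ ?_
  · refine ContinuousOn.intervalIntegrable ?_
    rw [uIcc_of_le hr.1.le]
    exact hc.mono (Icc_subset_Icc_right hr.2.le)
  · exact (hc.mono Ioo_subset_Icc_self).stronglyMeasurableAtFilter isOpen_Ioo r hr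
  · exact hc.continuousAt (Icc_mem_nhds hr.1 hr.2)

theorem hasDerivAt_radInt_snd {ρ : ℝ} {k k' : ℝ × ℝ → ℂ}
    (hk : ContinuousOn k (Icc 0 ρ ×ˢ Ioc 0 1)) (hk' : ContinuousOn k' (Icc 0 ρ ×ˢ Ioc 0 1))
    (hd : ∀ r ∈ Ioo 0 ρ, ∀ σ ∈ Ioo (0 : ℝ) 1, HasDerivAt (fun σ => k (r, σ)) (k' (r, σ)) σ)
    {r σ : ℝ} (hr : r ∈ Ioo 0 ρ) (hσ : σ ∈ Ioo (0 : ℝ) 1) :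
    HasDerivAt (fun σ => radInt k (r, σ)) (radInt k' (r, σ)) σ := by
  simp only [radInt_eq]
  have hsub : ∀ p ∈ Ioo (0 : ℝ) 1 ×ˢ Icc 0 r, (p.2, p.1) ∈ Icc 0 ρ ×ˢ Ioc (0 : ℝ) 1 :=
    fun p hp => ⟨⟨hp.2.1, hp.2.2.trans hr.2.le⟩, hp.1.1, hp.1.2.le⟩
  exact hasDerivAt_intervalIntegral (F := fun σ τ => k (τ, σ)) (F' := fun σ τ => k' (τ, σ)) hr.1.le hσ
    (hk.comp (f := fun p : ℝ × ℝ => (p.2, p.1)) (by fun_prop) hsub)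
    (hk'.comp (f := fun p : ℝ × ℝ => (p.2, p.1)) (by fun_prop) hsub)
    fun σ hσ τ hτ => hd τ ⟨hτ.1, hτ.2.trans hr.2⟩ σ hσ

theorem contDiffOn_radInt {ρ : ℝ} (hρ : 0 < ρ) {k k' : ℝ × ℝ → ℂ}
    (hk : ContinuousOn k (Icc 0 ρ ×ˢ Ioc 0 1)) (hk' : ContinuousOn k' (Icc 0 ρ ×ˢ Ioc 0 1))
    (hd : ∀ r ∈ Ioo 0 ρ, ∀ σ ∈ Ioo (0 : ℝ) 1, HasDerivAt (fun σ => k (r, σ)) (k' (r, σ)) σ) :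
    ContDiffOn ℝ 1 (radInt k) (Icc 0 ρ ×ˢ Ioc 0 1) := by
  have := contDiffOn_succ_of_partials (n := 0) hρ (continuousOn_radInt hk)
    (contDiffOn_zero.2 hk) (contDiffOn_zero.2 (continuousOn_radInt hk'))
    (fun r hr σ hσ => hasDerivAt_radInt hk hr (Ioo_subset_Ioc_self hσ))
    (fun r hr σ hσ => hasDerivAt_radInt_snd hk hk' hd hr hσ)
  simpa using this

theorem integral_exp_scale {c : ℝ} (hc : 0 < c) :
    ∫ a in (0 : ℝ)..1, Real.exp (c * a) = (Real.exp c - 1) / c := by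
  rw [intervalIntegral.integral_comp_mul_left (fun x => Real.exp x) hc.ne']
  simp
  ring

/-! ### Existence of the kernel: the integral equation. -/

/-- The integral operator such that `A = G_r / r` satisfies `A(r, σ) = p(rσ) + r charInt(..)(r, σ)`. -/
def densInt (p : ℝ → ℂ) (A : ℝ × ℝ → ℂ) (y : ℝ × ℝ) : ℂ :=
  p y.1 * ∫ a in (0 : ℝ)..1, ((y.1 * a : ℝ) : ℂ) * A (y.1 * a, y.2)

/-- With G the primitive of rA, the kernel equation in (r, σ) is r A_r - σ A_σ = pG, that is dA/dσ =
-pG/σ on rσ = const. Taking a factor r out of pG leaves an integrand without the division by σ, so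
the equation makes sense at σ = 0. -/
theorem mul_densInt (p : ℝ → ℂ) (A : ℝ × ℝ → ℂ) (y : ℝ × ℝ) :
    y.1 * densInt p A y = p y.1 * radInt (fun y => (y.1 : ℂ) * A y) y := by
  simp only [densInt, radInt]; ring

section Density

variable {ρ : ℝ} {p : ℝ → ℂ} {A : ℝ × ℝ → ℂ}

theorem continuousOn_scaled (hA : ContinuousOn A (Icc 0 ρ ×ˢ Icc 0 1)) : ContinuousOn
    (fun q : (ℝ × ℝ) × ℝ => ((q.1.1 * q.2 : ℝ) : ℂ) * A (q.1.1 * q.2, q.1.2))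
    ((Icc 0 ρ ×ˢ Icc 0 1) ×ˢ Icc 0 1) := by
  refine ContinuousOn.mul (by fun_prop) ?_
  exact hA.comp (f := fun q : (ℝ × ℝ) × ℝ => (q.1.1 * q.2, q.1.2)) (by fun_prop)
    fun q hq => ⟨scale_mem hq.1.1 hq.2, hq.1.2⟩

theorem continuousOn_densInt (hp : ContinuousOn p (Icc 0 ρ))
    (hA : ContinuousOn A (Icc 0 ρ ×ˢ Icc 0 1)) :
    ContinuousOn (densInt p A) (Icc 0 ρ ×ˢ Icc 0 1) :=
  (hp.comp continuousOn_fst fun _ hx => hx.1).mul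
    (continuousOn_intervalIntegral zero_le_one
      (F := fun (x : ℝ × ℝ) a => ((x.1 * a : ℝ) : ℂ) * A (x.1 * a, x.2)) (continuousOn_scaled hA))

theorem densInt_sub {A' : ℝ × ℝ → ℂ} (hA : ContinuousOn A (Icc 0 ρ ×ˢ Icc 0 1))
    (hA' : ContinuousOn A' (Icc 0 ρ ×ˢ Icc 0 1)) {x : ℝ × ℝ} (hx : x ∈ Icc 0 ρ ×ˢ Icc (0 : ℝ) 1) :
    densInt p (A - A') x = densInt p A x - densInt p A' x := by
  have hi : ∀ {A : ℝ × ℝ → ℂ}, ContinuousOn A (Icc 0 ρ ×ˢ Icc 0 1) → IntervalIntegrable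
      (fun a => ((x.1 * a : ℝ) : ℂ) * A (x.1 * a, x.2)) volume 0 1 := by
    intro A hA
    refine ContinuousOn.intervalIntegrable ?_
    rw [uIcc_of_le zero_le_one]
    exact (continuousOn_scaled hA).comp (f := fun a : ℝ => (x, a)) (by fun_prop)
      fun a ha => ⟨hx, ha⟩
  simp only [densInt, Pi.sub_apply]
  rw [← mul_sub, ← intervalIntegral.integral_sub (hi hA) (hi hA')]
  simp only [mul_sub]

theorem intervalIntegrable_char {Z : ℝ × ℝ → ℂ} (hZ : ContinuousOn Z (Icc 0 ρ ×ˢ Icc 0 1))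
    {x : ℝ × ℝ} (hx : x ∈ Icc 0 ρ ×ˢ Icc (0 : ℝ) 1) :
    IntervalIntegrable (fun b => Z (x.1 * b, x.2 / b)) volume x.2 1 := by
  obtain ⟨K, hK⟩ := (isCompact_Icc.prod isCompact_Icc).exists_bound_of_continuousOn hZ
  rw [intervalIntegrable_iff, uIoc_of_le hx.2.2]
  refine Integrable.of_bound
    ((continuousOn_char hZ hx).aestronglyMeasurable measurableSet_Ioc) K ?_
  rw [ae_restrict_iff' measurableSet_Ioc]
  exact Eventually.of_forall fun b hb => hK _ (char_mem hx (Ioc_subset_Icc_self hb))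

theorem norm_densInt_le {c B M : ℝ} (hc : 0 < c) (hB : 0 ≤ B) (hM0 : 0 ≤ M)
    (hM : ∀ r ∈ Icc 0 ρ, ‖p r‖ ≤ M)
    (hA : ∀ y ∈ Icc 0 ρ ×ˢ Icc (0 : ℝ) 1, ‖A y‖ ≤ B * Real.exp (c * y.1))
    {x : ℝ × ℝ} (hx : x ∈ Icc 0 ρ ×ˢ Icc (0 : ℝ) 1) :
    ‖densInt p A x‖ ≤ M * (B / c * Real.exp (c * x.1)) := by
  have hx0 : (0 : ℝ) ≤ x.1 := hx.1.1
  rw [densInt, norm_mul]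
  refine mul_le_mul (hM _ hx.1) ?_ (norm_nonneg _) hM0
  rcases hx0.eq_or_lt with h0 | h0
  · simp only [← h0]
    simp only [zero_mul, Complex.ofReal_zero, intervalIntegral.integral_zero, norm_zero]
    positivity
  have h1 : ‖∫ a in (0 : ℝ)..1, ((x.1 * a : ℝ) : ℂ) * A (x.1 * a, x.2)‖ ≤
      ∫ a in (0 : ℝ)..1, x.1 * B * Real.exp (c * x.1 * a) := by
    refine intervalIntegral.norm_integral_le_of_norm_le zero_le_one
      (Eventually.of_forall fun a ha => ?_) (Continuous.intervalIntegrable (by fun_prop) _ _)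
    have ha' : a ∈ Icc (0 : ℝ) 1 := Ioc_subset_Icc_self ha
    rw [norm_mul, Complex.norm_real, Real.norm_of_nonneg (mul_nonneg hx0 ha'.1)]
    have := hA (x.1 * a, x.2) ⟨scale_mem hx.1 ha', hx.2⟩
    calc x.1 * a * _ ≤ x.1 * 1 * (B * Real.exp (c * (x.1 * a))) := by
          gcongr
          exact ha.2
      _ = _ := by rw [← mul_assoc c]; ring
  rw [intervalIntegral.integral_const_mul, integral_exp_scale (by positivity)] at h1
  refine h1.trans ?_
  calc x.1 * B * ((Real.exp (c * x.1) - 1) / (c * x.1))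
      ≤ x.1 * B * (Real.exp (c * x.1) / (c * x.1)) := by gcongr; linarith
    _ = _ := by field_simp

theorem norm_mul_charInt_densInt_le {B M : ℝ} (hB : 0 ≤ B) (hM0 : 0 ≤ M)
    (hM : ∀ r ∈ Icc 0 ρ, ‖p r‖ ≤ M)
    (hA : ∀ y ∈ Icc 0 ρ ×ˢ Icc (0 : ℝ) 1, ‖A y‖ ≤ B * Real.exp ((2 * |ρ| * M + 1) * y.1))
    {y : ℝ × ℝ} (hy : y ∈ Icc 0 ρ ×ˢ Icc (0 : ℝ) 1) :
    ‖y.1 * charInt (densInt p A) y‖ ≤ B / 2 * Real.exp ((2 * |ρ| * M + 1) * y.1) := by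
  -- Chosen so that |ρ|M/c ≤ 1/2; the extra 1 keeps c positive when M = 0. The weight does not grow
  -- along the characteristic, where the radius is y.1 * b ≤ y.1.
  set c := 2 * |ρ| * M + 1 with hcdef
  have hc : 0 < c := by positivity
  have hy1 : (0 : ℝ) ≤ y.1 := hy.1.1
  have hInt : ‖charInt (densInt p A) y‖ ≤ M * (B / c * Real.exp (c * y.1)) * |1 - y.2| := by
    refine intervalIntegral.norm_integral_le_of_norm_le_const fun b hb => ?_
    rw [uIoc_of_le hy.2.2] at hb
    have hb' := Ioc_subset_Icc_self hb
    refine (norm_densInt_le hc hB hM0 hM hA (char_mem hy hb')).trans ?_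
    have : y.1 * b ≤ y.1 := mul_le_of_le_one_right hy1 hb.2
    gcongr
  have h1 : |1 - y.2| ≤ 1 := by
    rw [abs_of_nonneg (by linarith [hy.2.2])]; linarith [hy.2.1]
  rw [norm_mul, Complex.norm_real, Real.norm_of_nonneg hy1]
  calc y.1 * ‖charInt (densInt p A) y‖ ≤ |ρ| * (M * (B / c * Real.exp (c * y.1)) * 1) := by
        gcongr
        · exact hy.1.2.trans (le_abs_self ρ)
        · exact hInt.trans (by gcongr)
    _ = (|ρ| * M / c) * (B * Real.exp (c * y.1)) := by ring
    _ ≤ (1 / 2) * (B * Real.exp (c * y.1)) := by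
        refine mul_le_mul_of_nonneg_right ?_ (by positivity)
        rw [div_le_iff₀ hc, hcdef]
        linarith
    _ = _ := by ring

/-- The weighted estimate holds on the whole rectangle, which serves as the neighbourhood of each of
its points in the Neumann series. Continuity of p suffices here. -/
theorem exists_kernel_density (hp : ContinuousOn p (Icc 0 ρ)) :
    ∃ A : ℝ × ℝ → ℂ, ContinuousOn A (Icc 0 ρ ×ˢ Icc 0 1) ∧
      ∀ x ∈ Icc 0 ρ ×ˢ Icc (0 : ℝ) 1, A x = p (x.1 * x.2) + x.1 * charInt (densInt p A) x := by
  obtain ⟨M', hM'⟩ := isCompact_Icc.exists_bound_of_continuousOn hp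
  have hM : ∀ r ∈ Icc 0 ρ, ‖p r‖ ≤ |M'| := fun r hr => (hM' r hr).trans (le_abs_self _)
  have hM0 : 0 ≤ |M'| := abs_nonneg _
  generalize |M'| = M at hM hM0
  have hc : 0 < 2 * |ρ| * M + 1 := by positivity
  refine exists_eq_add_of_weighted_contraction (Ω := Icc 0 ρ ×ˢ Icc (0 : ℝ) 1)
    (fun A x => x.1 * charInt (densInt p A) x)
    (fun x => Real.exp ((2 * |ρ| * M + 1) * x.1)) (fun x => (Real.exp_pos _).le)
    (U := fun x => p (x.1 * x.2))
    (hp.comp (by fun_prop) fun x hx => scale_mem hx.1 hx.2)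
    (fun A hA => ContinuousOn.mul (by fun_prop)
      (continuousOn_charInt (continuousOn_densInt hp hA))) ?_ ?_
  · intro A A' hA hA' x hx
    simp only [charInt]
    rw [← mul_sub, ← intervalIntegral.integral_sub
      (intervalIntegrable_char (continuousOn_densInt hp hA) hx)
      (intervalIntegrable_char (continuousOn_densInt hp hA') hx)]
    congr 1
    refine intervalIntegral.integral_congr fun b hb => ?_
    rw [uIcc_of_le hx.2.2] at hb
    exact densInt_sub hA hA' (char_mem hx hb)
  · intro x hx
    refine ⟨_, self_mem_nhdsWithin, subset_rfl, ⟨M, fun y hy => ?_⟩,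
      ⟨Real.exp ((2 * |ρ| * M + 1) * ρ), fun y hy => ?_⟩, fun A B hA hAB y hy => ?_⟩
    · refine (hM _ (scale_mem hy.1 hy.2)).trans (le_mul_of_one_le_right hM0 (Real.one_le_exp ?_))
      exact mul_nonneg hc.le hy.1.1
    · have : y.1 ≤ ρ := hy.1.2
      gcongr
    · have hB : 0 ≤ B := nonneg_of_mul_nonneg_left ((norm_nonneg _).trans (hAB x hx)) (Real.exp_pos _)
      exact norm_mul_charInt_densInt_le hB hM0 hM hAB hy

end Density

/-! ### Regularity of the kernel density. -/

/-- The integrand of the derivative of the kernel density along characteristics. -/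
def charSlope (p p' : ℝ → ℂ) (A : ℝ × ℝ → ℂ) (y : ℝ × ℝ) : ℂ :=
  p' y.1 * radInt (fun y => (y.1 : ℂ) * A y) y + p y.1 * (y.1 * A y)

/-- The integral part of the kernel density, as a function of `x = rσ` and `σ`. -/
def charPrim (p : ℝ → ℂ) (A : ℝ × ℝ → ℂ) (x : ℝ × ℝ) : ℂ :=
  ∫ β in x.2..1, p (x.1 / β) * radInt (fun y => (y.1 : ℂ) * A y) (x.1 / β, β) / β

/-- `∂A/∂r` -/
def densDerivFst (p p' : ℝ → ℂ) (A : ℝ × ℝ → ℂ) (x : ℝ × ℝ) : ℂ :=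
  x.2 * p' (x.1 * x.2) + charInt (charSlope p p' A) x

/-- `∂A/∂σ` -/
def densDerivSnd (p p' : ℝ → ℂ) (A : ℝ × ℝ → ℂ) (x : ℝ × ℝ) : ℂ :=
  (x.1 * densDerivFst p p' A x - p x.1 * radInt (fun y => (y.1 : ℂ) * A y) x) / x.2

section Density

variable {ρ : ℝ} {p p' : ℝ → ℂ} {A : ℝ × ℝ → ℂ}

theorem continuousOn_fst_mul {S : Set ℝ} (hA : ContinuousOn A (Icc 0 ρ ×ˢ S)) :
    ContinuousOn (fun y : ℝ × ℝ => (y.1 : ℂ) * A y) (Icc 0 ρ ×ˢ S) :=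
  ContinuousOn.mul (by fun_prop) hA

theorem continuousOn_comp_fst {S : Set ℝ} (hp : ContinuousOn p (Icc 0 ρ)) :
    ContinuousOn (fun y : ℝ × ℝ => p y.1) (Icc 0 ρ ×ˢ S) :=
  hp.comp continuousOn_fst fun _ hx => hx.1

theorem continuousOn_charSlope (hp : ContinuousOn p (Icc 0 ρ)) (hp' : ContinuousOn p' (Icc 0 ρ))
    (hA : ContinuousOn A (Icc 0 ρ ×ˢ Icc 0 1)) :
    ContinuousOn (charSlope p p' A) (Icc 0 ρ ×ˢ Icc 0 1) :=
  ((continuousOn_comp_fst hp').mul (continuousOn_radInt (continuousOn_fst_mul hA))).add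
    ((continuousOn_comp_fst hp).mul (continuousOn_fst_mul hA))

/-- In the coordinates x = rσ and σ the characteristic is x = const, so σ enters only through the
lower limit and x only through the integrand. -/
theorem charPrim_eq (hp : ContinuousOn p (Icc 0 ρ)) (hA : ContinuousOn A (Icc 0 ρ ×ˢ Icc 0 1))
    {r σ : ℝ} (hr : r ∈ Icc 0 ρ) (hσ : σ ∈ Ioc (0 : ℝ) 1) :
    r * charInt (densInt p A) (r, σ) = charPrim p A (r * σ, σ) := by
  rw [charInt_eq (continuousOn_densInt hp hA) hr hσ, charPrim, ← intervalIntegral.integral_const_mul]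
  refine intervalIntegral.integral_congr fun β hβ => ?_
  simp only
  rw [uIcc_of_le hσ.2] at hβ
  have hβ0 : (β : ℂ) ≠ 0 := by exact_mod_cast (hσ.1.trans_le hβ.1).ne'
  have := mul_densInt p A (r * σ / β, β)
  simp only at this
  rw [← this]
  push_cast
  field_simp

theorem integral_charSlope (hp : ContinuousOn p (Icc 0 ρ)) (hp' : ContinuousOn p' (Icc 0 ρ))
    (hA : ContinuousOn A (Icc 0 ρ ×ˢ Icc 0 1)) {x σ : ℝ} (hx : x / σ ∈ Icc 0 ρ)
    (hσ : σ ∈ Ioc (0 : ℝ) 1) :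
    ∫ β in σ..1, charSlope p p' A (x / β, β) / (β : ℂ) ^ 2 =
      charInt (charSlope p p' A) (x / σ, σ) / σ := by
  have hσ0 : (σ : ℂ) ≠ 0 := by exact_mod_cast hσ.1.ne'
  rw [charInt_eq (continuousOn_charSlope hp hp' hA) hx hσ, eq_div_iff hσ0, mul_comm,
    ← intervalIntegral.integral_const_mul]
  refine intervalIntegral.integral_congr fun β hβ => ?_
  simp only [div_mul_cancel₀ x hσ.1.ne']
  ring

theorem tri_mem {x σ β : ℝ} (hx : x ∈ Ioo 0 (ρ * σ)) (hσ : 0 < σ) (hβ : β ∈ Icc σ 1)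
    (hρ : 0 ≤ ρ) : (x / β, β) ∈ Icc 0 ρ ×ˢ Icc (0 : ℝ) 1 := by
  have hβ0 : 0 < β := hσ.trans_le hβ.1
  refine ⟨⟨div_nonneg hx.1.le hβ0.le, ?_⟩, hβ0.le, hβ.2⟩
  rw [div_le_iff₀ hβ0]
  exact hx.2.le.trans (mul_le_mul_of_nonneg_left hβ.1 hρ)

theorem continuousOn_tri {Z : ℝ × ℝ → ℂ} (hZ : ContinuousOn Z (Icc 0 ρ ×ˢ Icc 0 1)) (hρ : 0 ≤ ρ)
    {σ : ℝ} (hσ : 0 < σ) :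
    ContinuousOn (fun q : ℝ × ℝ => Z (q.1 / q.2, q.2)) (Ioo 0 (ρ * σ) ×ˢ Icc σ 1) :=
  hZ.comp (f := fun q : ℝ × ℝ => (q.1 / q.2, q.2))
    ((continuousOn_fst.div continuousOn_snd fun _ hq => (hσ.trans_le hq.2.1).ne').prodMk
      continuousOn_snd) fun _ hq => tri_mem hq.1 hσ hq.2 hρ

/-- No derivative of A is needed: in x the integrand contains p, which is differentiable, and the
radial primitive of rA, whose derivative is rA; in σ only the endpoint moves. Hence a merely
continuous solution A turns out to be C¹. -/
theorem hasFDerivAt_charPrim (hρ : 0 ≤ ρ) (hp : ContinuousOn p (Icc 0 ρ))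
    (hp' : ContinuousOn p' (Icc 0 ρ)) (hd : ∀ x ∈ Ioo 0 ρ, HasDerivAt p (p' x) x)
    (hA : ContinuousOn A (Icc 0 ρ ×ˢ Icc 0 1)) {x : ℝ × ℝ} (hσ : x.2 ∈ Ioo (0 : ℝ) 1)
    (hx : x.1 ∈ Ioo 0 (ρ * x.2)) :
    HasFDerivAt (charPrim p A)
      (ofPartials (charInt (charSlope p p' A) (x.1 / x.2, x.2) / x.2)
        (-(p (x.1 / x.2) * radInt (fun y => (y.1 : ℂ) * A y) (x.1 / x.2, x.2) / x.2))) x := by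
  have hopen : ∀ᶠ v : ℝ × ℝ in 𝓝 x, v.2 ∈ Ioo (0 : ℝ) 1 ∧ v.1 ∈ Ioo 0 (ρ * v.2) := by
    have h1 : IsOpen {v : ℝ × ℝ | v.2 ∈ Ioo (0 : ℝ) 1 ∧ v.1 ∈ Ioo 0 (ρ * v.2)} := by
      refine (isOpen_Ioo.preimage continuous_snd).inter ?_
      exact (isOpen_lt continuous_const continuous_fst).inter
        (isOpen_lt continuous_fst (by fun_prop))
    exact h1.mem_nhds ⟨hσ, hx⟩
  have hg := continuousOn_radInt (continuousOn_fst_mul hA)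
  have hpg : ContinuousOn (fun y : ℝ × ℝ => p y.1 * radInt (fun y => (y.1 : ℂ) * A y) y)
      (Icc 0 ρ ×ˢ Icc 0 1) := (continuousOn_comp_fst hp).mul hg
  have hquot : ∀ v : ℝ × ℝ, v.2 ∈ Ioo (0 : ℝ) 1 → v.1 ∈ Ioo 0 (ρ * v.2) → v.1 / v.2 ∈ Ioo 0 ρ :=
    fun v hv hv' => ⟨div_pos hv'.1 hv.1, (div_lt_iff₀ hv.1).2 hv'.2⟩
  have hmapc : ContinuousAt (fun v : ℝ × ℝ => (v.1 / v.2, v.2)) x :=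
    ContinuousAt.prodMk (continuousAt_fst.div continuousAt_snd hσ.1.ne') continuousAt_snd
  have hnhds : Icc 0 ρ ×ˢ Icc 0 1 ∈ 𝓝 (x.1 / x.2, x.2) :=
    prod_mem_nhds (Icc_mem_nhds (hquot x hσ hx).1 (hquot x hσ hx).2) (Icc_mem_nhds hσ.1 hσ.2)
  have hσC : (x.2 : ℂ) ≠ 0 := by exact_mod_cast hσ.1.ne'
  refine hasFDerivAt_of_partials
    (g₁ := fun x => charInt (charSlope p p' A) (x.1 / x.2, x.2) / x.2)
    (g₂ := fun x => -(p (x.1 / x.2) * radInt (fun y => (y.1 : ℂ) * A y) (x.1 / x.2, x.2) / x.2))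
    ?_ ?_ ?_ ?_
  · filter_upwards [hopen] with v ⟨hv, hv'⟩
    rw [← integral_charSlope hp hp' hA (Ioo_subset_Icc_self (hquot v hv hv'))
      (Ioo_subset_Ioc_self hv)]
    have hβC : ∀ q ∈ Ioo 0 (ρ * v.2) ×ˢ Icc v.2 1, (q.2 : ℂ) ≠ 0 := fun q hq => by
      exact_mod_cast (hv.1.trans_le hq.2.1).ne'
    refine hasDerivAt_intervalIntegral
      (F := fun x β => p (x / β) * radInt (fun y => (y.1 : ℂ) * A y) (x / β, β) / β)
      (F' := fun x β => charSlope p p' A (x / β, β) / (β : ℂ) ^ 2) hv.2.le hv' ?_ ?_ ?_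
    · exact (continuousOn_tri hpg hρ hv.1).div (by fun_prop) hβC
    · exact (continuousOn_tri (continuousOn_charSlope hp hp' hA) hρ hv.1).div (by fun_prop)
        fun q hq => pow_ne_zero 2 (hβC q hq)
    · intro y hy β hβ
      have hβ0 : 0 < β := hv.1.trans hβ.1
      have hyβ : y / β ∈ Ioo 0 ρ := by
        refine ⟨div_pos hy.1 hβ0, (div_lt_iff₀ hβ0).2 (hy.2.trans_le ?_)⟩
        exact mul_le_mul_of_nonneg_left hβ.1.le hρ
      have h1 : HasDerivAt (fun y : ℝ => y / β) (1 / β) y := (hasDerivAt_id y).div_const β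
      have h2 := HasDerivAt.scomp (h := fun y : ℝ => y / β) y (hd _ hyβ) h1
      have h3 := HasDerivAt.scomp (h := fun y : ℝ => y / β) y
        (hasDerivAt_radInt (continuousOn_fst_mul hA) hyβ ⟨hβ0.le, hβ.2.le⟩) h1
      refine ((h2.mul h3).div_const (β : ℂ)).congr_deriv ?_
      have hβC : (β : ℂ) ≠ 0 := by exact_mod_cast hβ0.ne'
      simp only [charSlope, Complex.real_smul, Function.comp]
      push_cast
      field_simp
  · filter_upwards [hopen] with v ⟨hv, hv'⟩
    have hc : ContinuousOn
        (fun β : ℝ => p (v.1 / β) * radInt (fun y => (y.1 : ℂ) * A y) (v.1 / β, β) / β)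
        (Ioc (v.1 / ρ) 1) := by
      have hρ0 : 0 < ρ := pos_of_mul_pos_left (hv'.1.trans hv'.2) hv.1.le
      have hpos : ∀ β ∈ Ioc (v.1 / ρ) 1, 0 < β := fun β hβ => (div_pos hv'.1 hρ0).trans hβ.1
      refine ContinuousOn.div ?_ (by fun_prop) fun β hβ => by exact_mod_cast (hpos β hβ).ne'
      refine hpg.comp (f := fun β : ℝ => (v.1 / β, β)) (ContinuousOn.prodMk
        (continuousOn_const.div continuousOn_id fun β hβ => (hpos β hβ).ne') continuousOn_id)
        fun β hβ => ⟨⟨div_nonneg hv'.1.le (hpos β hβ).le, ?_⟩, (hpos β hβ).le, hβ.2⟩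
      rw [div_le_iff₀ (hpos β hβ), mul_comm]
      exact ((div_lt_iff₀ hρ0).1 hβ.1).le
    have hρ0 : 0 < ρ := pos_of_mul_pos_left (hv'.1.trans hv'.2) hv.1.le
    have hlt : v.1 / ρ < v.2 := by rw [div_lt_iff₀ hρ0, mul_comm]; exact hv'.2
    refine intervalIntegral.integral_hasDerivAt_left (f := fun β : ℝ =>
      p (v.1 / β) * radInt (fun y => (y.1 : ℂ) * A y) (v.1 / β, β) / β) ?_ ?_ ?_
    · refine ContinuousOn.intervalIntegrable (hc.mono ?_)
      rw [uIcc_of_le hv.2.le]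
      exact fun β hβ => ⟨hlt.trans_le hβ.1, hβ.2⟩
    · exact (hc.mono Ioo_subset_Ioc_self).stronglyMeasurableAtFilter isOpen_Ioo _ ⟨hlt, hv.2⟩
    · exact hc.continuousAt (Ioc_mem_nhds hlt hv.2)
  · refine ContinuousAt.div ?_ (by fun_prop) hσC
    exact ContinuousAt.comp (f := fun v : ℝ × ℝ => (v.1 / v.2, v.2))
      ((continuousOn_charInt (continuousOn_charSlope hp hp' hA)).continuousAt hnhds) hmapc
  · refine ContinuousAt.neg (f := fun x : ℝ × ℝ =>
      p (x.1 / x.2) * radInt (fun y => (y.1 : ℂ) * A y) (x.1 / x.2, x.2) / x.2)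
      (ContinuousAt.div ?_ (by fun_prop) hσC)
    exact ContinuousAt.comp (f := fun v : ℝ × ℝ => (v.1 / v.2, v.2))
      (hpg.continuousAt hnhds) hmapc

/-- The solution of the integral equation for `G_r / r`. -/
structure IsKernelDensity (ρ : ℝ) (p p' : ℝ → ℂ) (A : ℝ × ℝ → ℂ) : Prop where
  pos : 0 < ρ
  cont_pot : ContinuousOn p (Icc 0 ρ)
  cont_deriv : ContinuousOn p' (Icc 0 ρ)
  hasDerivAt : ∀ x ∈ Ioo 0 ρ, HasDerivAt p (p' x) x
  cont : ContinuousOn A (Icc 0 ρ ×ˢ Icc 0 1)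
  eq : ∀ x ∈ Icc 0 ρ ×ˢ Icc (0 : ℝ) 1, A x = p (x.1 * x.2) + x.1 * charInt (densInt p A) x

namespace IsKernelDensity

theorem eq_charPrim (h : IsKernelDensity ρ p p' A) {r σ : ℝ} (hr : r ∈ Icc 0 ρ)
    (hσ : σ ∈ Ioc (0 : ℝ) 1) :
    A (r, σ) = p (r * σ) + charPrim p A (r * σ, σ) := by
  rw [h.eq (r, σ) ⟨hr, Ioc_subset_Icc_self hσ⟩, ← charPrim_eq h.cont_pot h.cont hr hσ]

theorem prod_mem {r σ : ℝ} (hr : r ∈ Ioo 0 ρ) (hσ : σ ∈ Ioo (0 : ℝ) 1) :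
    r * σ ∈ Ioo 0 ρ :=
  ⟨mul_pos hr.1 hσ.1, (mul_le_of_le_one_right hr.1.le hσ.2.le).trans_lt hr.2⟩

theorem hasDerivAt_fst (h : IsKernelDensity ρ p p' A) {r σ : ℝ} (hr : r ∈ Ioo 0 ρ)
    (hσ : σ ∈ Ioo (0 : ℝ) 1) :
    HasDerivAt (fun r => A (r, σ)) (densDerivFst p p' A (r, σ)) r := by
  have hJ := hasFDerivAt_charPrim h.pos.le h.cont_pot h.cont_deriv h.hasDerivAt h.cont
    (x := (r * σ, σ)) hσ ⟨mul_pos hr.1 hσ.1, mul_lt_mul_of_pos_right hr.2 hσ.1⟩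
  have hc : HasDerivAt (fun r : ℝ => (r * σ, σ)) (σ, 0) r := by
    simpa using ((hasDerivAt_id r).mul_const σ).prodMk (hasDerivAt_const r σ)
  have h1 := HasFDerivAt.comp_hasDerivAt (f := fun r : ℝ => (r * σ, σ)) r hJ hc
  have h2 := HasDerivAt.scomp (h := fun r : ℝ => r * σ) r (h.hasDerivAt _ (prod_mem hr hσ))
    ((hasDerivAt_id r).mul_const σ)
  refine ((h2.add h1).congr_deriv ?_).congr_of_eventuallyEq ?_
  · have hσC : (σ : ℂ) ≠ 0 := by exact_mod_cast hσ.1.ne'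
    simp only [ofPartials_apply, densDerivFst, mul_div_cancel_right₀ r hσ.1.ne', Complex.real_smul,
      zero_smul, add_zero, one_mul]
    field_simp
  · filter_upwards [Ioo_mem_nhds hr.1 hr.2] with y hy
    exact h.eq_charPrim (Ioo_subset_Icc_self hy) (Ioo_subset_Ioc_self hσ)

/-- The value is the transport equation r A_r - σ A_σ = pG solved for A_σ; the division by σ is why
regularity is claimed only for σ > 0. -/
theorem hasDerivAt_snd (h : IsKernelDensity ρ p p' A) {r σ : ℝ} (hr : r ∈ Ioo 0 ρ)
    (hσ : σ ∈ Ioo (0 : ℝ) 1) :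
    HasDerivAt (fun σ => A (r, σ)) (densDerivSnd p p' A (r, σ)) σ := by
  have hJ := hasFDerivAt_charPrim h.pos.le h.cont_pot h.cont_deriv h.hasDerivAt h.cont
    (x := (r * σ, σ)) hσ ⟨mul_pos hr.1 hσ.1, mul_lt_mul_of_pos_right hr.2 hσ.1⟩
  have hm : HasDerivAt (fun σ : ℝ => r * σ) r σ := by
    simpa using (hasDerivAt_id σ).const_mul r
  have hc : HasDerivAt (fun σ : ℝ => (r * σ, σ)) (r, 1) σ := hm.prodMk (hasDerivAt_id σ)
  have h1 := HasFDerivAt.comp_hasDerivAt (f := fun σ : ℝ => (r * σ, σ)) σ hJ hc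
  have h2 := HasDerivAt.scomp (h := fun σ : ℝ => r * σ) σ (h.hasDerivAt _ (prod_mem hr hσ)) hm
  refine ((h2.add h1).congr_deriv ?_).congr_of_eventuallyEq ?_
  · have hσC : (σ : ℂ) ≠ 0 := by exact_mod_cast hσ.1.ne'
    simp only [ofPartials_apply, densDerivSnd, densDerivFst, mul_div_cancel_right₀ r hσ.1.ne',
      Complex.real_smul, one_smul]
    field_simp
    ring
  · filter_upwards [Ioo_mem_nhds hσ.1 hσ.2] with y hy
    exact h.eq_charPrim (Ioo_subset_Icc_self hr) (Ioo_subset_Ioc_self hy)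

theorem continuousOn_densDerivFst (h : IsKernelDensity ρ p p' A) :
    ContinuousOn (densDerivFst p p' A) (Icc 0 ρ ×ˢ Icc 0 1) := by
  refine ContinuousOn.add (ContinuousOn.mul (by fun_prop) ?_)
    (continuousOn_charInt (continuousOn_charSlope h.cont_pot h.cont_deriv h.cont))
  exact h.cont_deriv.comp (by fun_prop) fun x hx => scale_mem hx.1 hx.2

theorem cont_Ioc (h : IsKernelDensity ρ p p' A) : ContinuousOn A (Icc 0 ρ ×ˢ Ioc 0 1) :=
  h.cont.mono (prod_mono_right Ioc_subset_Icc_self)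

theorem continuousOn_densDerivSnd (h : IsKernelDensity ρ p p' A) :
    ContinuousOn (densDerivSnd p p' A) (Icc 0 ρ ×ˢ Ioc 0 1) := by
  refine ContinuousOn.div (ContinuousOn.sub (ContinuousOn.mul (by fun_prop)
    (h.continuousOn_densDerivFst.mono (prod_mono_right Ioc_subset_Icc_self)))
    ((continuousOn_comp_fst h.cont_pot).mul (continuousOn_radInt (continuousOn_fst_mul h.cont_Ioc))))
    (by fun_prop) fun x hx => by exact_mod_cast hx.2.1.ne'

theorem contDiffOn_density (h : IsKernelDensity ρ p p' A) : ContDiffOn ℝ 1 A (Icc 0 ρ ×ˢ Ioc 0 1) := by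
  have := contDiffOn_succ_of_partials (n := 0) h.pos h.cont_Ioc
    (contDiffOn_zero.2 (h.continuousOn_densDerivFst.mono (prod_mono_right Ioc_subset_Icc_self)))
    (contDiffOn_zero.2 h.continuousOn_densDerivSnd)
    (fun r hr σ hσ => h.hasDerivAt_fst hr hσ) (fun r hr σ hσ => h.hasDerivAt_snd hr hσ)
  simpa using this

end IsKernelDensity

end Density

/-! ### Regularity of the kernel and return to (K). -/

theorem hasDerivAt_coe (x : ℝ) : HasDerivAt (fun t : ℝ => (t : ℂ)) 1 x := by
  simpa using (hasDerivAt_id x).ofReal_comp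

namespace IsKernelDensity

variable {ρ : ℝ} {p p' : ℝ → ℂ} {A : ℝ × ℝ → ℂ}

/-- The kernel in the variables `r` and `σ = √(1 - t)`. -/
abbrev ker (A : ℝ × ℝ → ℂ) : ℝ × ℝ → ℂ := radInt fun y => (y.1 : ℂ) * A y

/-- `∂G/∂σ` -/
def kerDerivSnd (p : ℝ → ℂ) (A : ℝ × ℝ → ℂ) (x : ℝ × ℝ) : ℂ :=
  ((x.1 : ℂ) ^ 2 * A x - 2 * ker A x - radInt (fun y => (y.1 : ℂ) * (p y.1 * ker A y)) x) / x.2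

theorem continuousOn_ker (h : IsKernelDensity ρ p p' A) :
    ContinuousOn (ker A) (Icc 0 ρ ×ˢ Icc 0 1) :=
  continuousOn_radInt (continuousOn_fst_mul h.cont)

theorem continuousOn_ker_Ioc (h : IsKernelDensity ρ p p' A) :
    ContinuousOn (ker A) (Icc 0 ρ ×ˢ Ioc 0 1) :=
  h.continuousOn_ker.mono (prod_mono_right Ioc_subset_Icc_self)

theorem continuousOn_pot_mul_ker (h : IsKernelDensity ρ p p' A) :
    ContinuousOn (fun y : ℝ × ℝ => (y.1 : ℂ) * (p y.1 * ker A y)) (Icc 0 ρ ×ˢ Ioc 0 1) :=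
  continuousOn_fst_mul ((continuousOn_comp_fst h.cont_pot).mul h.continuousOn_ker_Ioc)

/-- The transport equation gives σ τ A_σ = τ²A_τ - τ pG, which is the τ-derivative of τ²A - 2G minus
the primitive of τ pG. Thus G_σ has an expression without derivatives of A, so it is C¹ and G is C².
-/
theorem radInt_densDerivSnd (h : IsKernelDensity ρ p p' A) {r σ : ℝ} (hr : r ∈ Ioo 0 ρ)
    (hσ : σ ∈ Ioo (0 : ℝ) 1) :
    radInt (fun y => (y.1 : ℂ) * densDerivSnd p p' A y) (r, σ) = kerDerivSnd p A (r, σ) := by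
  have hσ' : σ ∈ Ioc (0 : ℝ) 1 := Ioo_subset_Ioc_self hσ
  have hσC : (σ : ℂ) ≠ 0 := by exact_mod_cast hσ.1.ne'
  have hslice : ∀ {k : ℝ × ℝ → ℂ}, ContinuousOn k (Icc 0 ρ ×ˢ Ioc 0 1) →
      ContinuousOn (fun τ => k (τ, σ)) (Icc 0 r) := fun hk =>
    hk.comp (f := fun τ : ℝ => (τ, σ)) (by fun_prop)
      fun τ hτ => ⟨⟨hτ.1, hτ.2.trans hr.2.le⟩, hσ'⟩
  set F : ℝ → ℂ := fun τ => (τ : ℂ) ^ 2 * A (τ, σ) - 2 * ker A (τ, σ) -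
    radInt (fun y => (y.1 : ℂ) * (p y.1 * ker A y)) (τ, σ) with hF
  have hFc : ContinuousOn F (Icc 0 r) :=
    ((ContinuousOn.mul (by fun_prop) (hslice h.cont_Ioc)).sub
      (continuousOn_const.mul (hslice h.continuousOn_ker_Ioc))).sub
      (hslice (continuousOn_radInt h.continuousOn_pot_mul_ker))
  have hFd : ∀ τ ∈ Ioo 0 r, HasDerivAt F (σ * (τ * densDerivSnd p p' A (τ, σ))) τ := by
    intro τ hτ
    have hτ' : τ ∈ Ioo 0 ρ := ⟨hτ.1, hτ.2.trans hr.2⟩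
    have h1 : HasDerivAt (fun τ : ℝ => (τ : ℂ) ^ 2) (2 * τ) τ := by
      simpa using (hasDerivAt_coe τ).fun_pow 2
    have h2 := hasDerivAt_radInt (continuousOn_fst_mul h.cont_Ioc) hτ' hσ'
    have h3 := hasDerivAt_radInt h.continuousOn_pot_mul_ker hτ' hσ'
    refine (((h1.mul (h.hasDerivAt_fst hτ' hσ)).sub (h2.const_mul 2)).sub h3).congr_deriv ?_
    simp only [densDerivSnd]
    field_simp
    ring
  have hInt := intervalIntegral.integral_eq_sub_of_hasDerivAt_of_le hr.1.le hFc hFd (by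
    refine ContinuousOn.intervalIntegrable ?_
    rw [uIcc_of_le hr.1.le]
    exact continuousOn_const.mul (hslice (continuousOn_fst_mul h.continuousOn_densDerivSnd)))
  rw [intervalIntegral.integral_const_mul] at hInt
  have hF0 : F 0 = 0 := by simp [hF, radInt]
  rw [radInt_eq, kerDerivSnd, eq_div_iff hσC, mul_comm]
  simp only
  rw [hInt, hF0, sub_zero]

theorem hasDerivAt_ker_snd (h : IsKernelDensity ρ p p' A) {r σ : ℝ} (hr : r ∈ Ioo 0 ρ)
    (hσ : σ ∈ Ioo (0 : ℝ) 1) :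
    HasDerivAt (fun σ => ker A (r, σ)) (kerDerivSnd p A (r, σ)) σ := by
  rw [← h.radInt_densDerivSnd hr hσ]
  exact hasDerivAt_radInt_snd (continuousOn_fst_mul h.cont_Ioc)
    (continuousOn_fst_mul h.continuousOn_densDerivSnd)
    (fun r hr σ hσ => (h.hasDerivAt_snd hr hσ).const_mul (r : ℂ)) hr hσ

theorem contDiffOn_ker_one (h : IsKernelDensity ρ p p' A) :
    ContDiffOn ℝ 1 (ker A) (Icc 0 ρ ×ˢ Ioc 0 1) :=
  contDiffOn_radInt h.pos (continuousOn_fst_mul h.cont_Ioc)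
    (continuousOn_fst_mul h.continuousOn_densDerivSnd)
    (fun r hr _ hσ => (h.hasDerivAt_snd hr hσ).const_mul (r : ℂ))

theorem continuousOn_kerDerivSnd (h : IsKernelDensity ρ p p' A) :
    ContinuousOn (kerDerivSnd p A) (Icc 0 ρ ×ˢ Ioc 0 1) := by
  refine ContinuousOn.div (((ContinuousOn.mul (by fun_prop) h.cont_Ioc).sub
    (continuousOn_const.mul h.continuousOn_ker_Ioc)).sub
    (continuousOn_radInt h.continuousOn_pot_mul_ker)) (by fun_prop)
    fun x hx => by exact_mod_cast hx.2.1.ne'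

theorem contDiffOn_kerDerivSnd (h : IsKernelDensity ρ p p' A) :
    ContDiffOn ℝ 1 (kerDerivSnd p A) (Icc 0 ρ ×ˢ Ioc 0 1) := by
  have h1 : ContDiffOn ℝ 1 (radInt fun y => (y.1 : ℂ) * (p y.1 * ker A y))
      (Icc 0 ρ ×ˢ Ioc 0 1) :=
    contDiffOn_radInt h.pos h.continuousOn_pot_mul_ker
      (continuousOn_fst_mul ((continuousOn_comp_fst h.cont_pot).mul h.continuousOn_kerDerivSnd))
      (fun r hr σ hσ => ((h.hasDerivAt_ker_snd hr hσ).const_mul (p r)).const_mul (r : ℂ))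
  have hof : ∀ {k : ℝ × ℝ → ℝ}, ContDiff ℝ 1 k →
      ContDiffOn ℝ 1 (fun x => (k x : ℂ)) (Icc 0 ρ ×ˢ Ioc 0 1) := fun hk =>
    (Complex.ofRealCLM.contDiff.comp hk).contDiffOn
  have h2 : ContDiffOn ℝ 1 (fun x : ℝ × ℝ => (x.2 : ℂ)⁻¹) (Icc 0 ρ ×ˢ Ioc 0 1) :=
    (hof contDiff_snd).inv fun x hx => by exact_mod_cast hx.2.1.ne'
  exact (((((hof contDiff_fst).pow 2).mul h.contDiffOn_density).sub
    (contDiffOn_const.mul h.contDiffOn_ker_one)).sub h1).mul h2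

theorem contDiffOn_ker (h : IsKernelDensity ρ p p' A) :
    ContDiffOn ℝ 2 (ker A) (Icc 0 ρ ×ˢ Ioc 0 1) := by
  have hof : ContDiffOn ℝ 1 (fun x : ℝ × ℝ => (x.1 : ℂ)) (Icc 0 ρ ×ˢ Ioc 0 1) :=
    (Complex.ofRealCLM.contDiff.comp contDiff_fst).contDiffOn
  have := contDiffOn_succ_of_partials (n := 1) h.pos h.continuousOn_ker_Ioc
    (by simpa using hof.mul h.contDiffOn_density) (by simpa using h.contDiffOn_kerDerivSnd)
    (fun r hr σ hσ => hasDerivAt_radInt (continuousOn_fst_mul h.cont_Ioc) hr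
      (Ioo_subset_Ioc_self hσ))
    (fun r hr σ hσ => h.hasDerivAt_ker_snd hr hσ)
  convert this using 1
  norm_num

theorem sqrt_one_sub_mem {t : ℝ} (ht : t ∈ Icc (0 : ℝ) 1) : √(1 - t) ∈ Icc (0 : ℝ) 1 :=
  ⟨Real.sqrt_nonneg _, Real.sqrt_le_one.2 (by linarith [ht.1])⟩

theorem isTransmutationKernel (h : IsKernelDensity ρ p p' A) :
    IsTransmutationKernel ρ p fun r t => ker A (r, √(1 - t)) where
  continuousOn := h.continuousOn_ker.comp (f := fun x : ℝ × ℝ => (x.1, √(1 - x.2)))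
    (by fun_prop) fun x hx => ⟨hx.1, sqrt_one_sub_mem hx.2⟩
  contDiffOn := by
    refine h.contDiffOn_ker.comp (f := fun x : ℝ × ℝ => (x.1, √(1 - x.2))) ?_
      fun x hx => ⟨hx.1, Real.sqrt_pos.2 (by linarith [hx.2.2]),
        (sqrt_one_sub_mem ⟨hx.2.1, hx.2.2.le⟩).2⟩
    refine contDiffOn_fst.prodMk (ContDiffOn.sqrt (contDiffOn_const.sub contDiffOn_snd) ?_)
    intro x hx
    have := hx.2.2
    exact (by linarith : 0 < 1 - x.2).ne'
  pde := by
    intro r hr t ht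
    have hs : ∀ t ∈ Ioo (0 : ℝ) 1, √(1 - t) ∈ Ioo (0 : ℝ) 1 := fun t ht =>
      ⟨Real.sqrt_pos.2 (by linarith [ht.2]),
        by rw [Real.sqrt_lt' one_pos]; linarith [ht.1]⟩
    set σ := √(1 - t) with hσdef
    have hσ := hs t ht
    rw [← hσdef] at hσ
    have hd : ∀ t ∈ Ioo (0 : ℝ) 1, ∀ s ∈ Ioo 0 ρ,
        deriv (fun s => ker A (s, √(1 - t))) s = s * A (s, √(1 - t)) := fun t ht s hs' =>
      (hasDerivAt_radInt (continuousOn_fst_mul h.cont_Ioc) hs' (Ioo_subset_Ioc_self (hs t ht))).deriv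
    have h1 : deriv (fun s => deriv (fun s' => ker A (s', σ)) s) r =
        A (r, σ) + r * densDerivFst p p' A (r, σ) := by
      have heq : (fun s => deriv (fun s' => ker A (s', σ)) s) =ᶠ[𝓝 r] fun s : ℝ => s * A (s, σ) := by
        filter_upwards [Ioo_mem_nhds hr.1 hr.2] with s hs' using hd t ht s hs'
      rw [heq.deriv_eq]
      have := (hasDerivAt_coe r).fun_mul (h.hasDerivAt_fst hr hσ)
      simpa using this.deriv
    have h2 : deriv (fun τ => deriv (fun s => ker A (s, √(1 - τ))) r) t =
        r * ((-1 / (2 * σ) : ℝ) * densDerivSnd p p' A (r, σ)) := by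
      have heq : (fun τ => deriv (fun s => ker A (s, √(1 - τ))) r) =ᶠ[𝓝 t]
          fun τ : ℝ => r * A (r, √(1 - τ)) := by
        filter_upwards [Ioo_mem_nhds ht.1 ht.2] with τ hτ using hd τ hτ r hr
      rw [heq.deriv_eq]
      have hsq : HasDerivAt (fun τ : ℝ => √(1 - τ)) (-1 / (2 * σ)) t := by
        have := ((hasDerivAt_id t).const_sub 1).sqrt
          (by simpa using (by linarith [ht.2] : 0 < 1 - t).ne')
        simpa using this
      have h3 := HasDerivAt.scomp (h := fun τ : ℝ => √(1 - τ)) t (h.hasDerivAt_snd hr hσ) hsq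
      simpa using (h3.const_mul (r : ℂ)).deriv
    have ht' : (1 - t : ℂ) = (σ : ℂ) ^ 2 := by
      rw [hσdef]
      norm_cast
      rw [Real.sq_sqrt (by linarith [ht.2])]
    have hσC : (σ : ℂ) ≠ 0 := by exact_mod_cast hσ.1.ne'
    rw [h1, h2, ht', hd t ht r hr, ← hσdef]
    simp only [densDerivSnd]
    push_cast
    field_simp
    ring
  initial := by
    intro r hr
    simp only [sub_zero, Real.sqrt_one]
    rw [ker, radInt_eq]
    refine intervalIntegral.integral_congr fun τ hτ => ?_
    rw [uIcc_of_le hr.1] at hτ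
    simp only
    -- At σ = 1 the characteristic integral runs over [1, 1], leaving A(τ, 1) = p(τ).
    rw [h.eq (τ, 1) ⟨⟨hτ.1, hτ.2.trans hr.2⟩, zero_le_one, le_rfl⟩]
    simp [charInt]
  zero := by
    intro t _
    simp [radInt]

end IsKernelDensity

theorem hasDerivAt_of_contDiffOn_Icc {ρ : ℝ} {p : ℝ → ℂ} (hp : ContDiffOn ℝ 1 p (Icc 0 ρ)) {x : ℝ}
    (hx : x ∈ Ioo 0 ρ) : HasDerivAt p (derivWithin p (Icc 0 ρ) x) x :=
  ((hp.differentiableOn one_ne_zero x (Ioo_subset_Icc_self hx)).hasDerivWithinAt).hasDerivAt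
    (Icc_mem_nhds hx.1 hx.2)

theorem exists_isTransmutationKernel {ρ : ℝ} (hρ : 0 < ρ) {p : ℝ → ℂ}
    (hp : ContDiffOn ℝ 1 p (Icc 0 ρ)) : ∃ G, IsTransmutationKernel ρ p G := by
  obtain ⟨A, hA, heq⟩ := exists_kernel_density hp.continuousOn
  have h : IsKernelDensity ρ p (derivWithin p (Icc 0 ρ)) A :=
    { pos := hρ
      cont_pot := hp.continuousOn
      cont_deriv := hp.continuousOn_derivWithin (uniqueDiffOn_Icc hρ) le_rfl
      hasDerivAt := fun x hx => hasDerivAt_of_contDiffOn_Icc hp hx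
      cont := hA
      eq := heq }
  exact ⟨_, h.isTransmutationKernel⟩

/-! ### A given kernel in the variables r and σ. -/

/-- A transmutation kernel `g` in the variables `r` and `σ = √(1 - t)`, together with its partial
derivatives. -/
structure IsPolarKernel (ρ : ℝ) (p : ℝ → ℂ) (g gr gs grr grs : ℝ × ℝ → ℂ) : Prop where
  cont : ContinuousOn g (Icc 0 ρ ×ˢ Icc 0 1)
  cont_r : ContinuousOn gr (Icc 0 ρ ×ˢ Ioc 0 1)
  cont_s : ContinuousOn gs (Icc 0 ρ ×ˢ Ioc 0 1)
  hasFDerivAt : ∀ x ∈ Ioo 0 ρ ×ˢ Ioo (0 : ℝ) 1, HasFDerivAt g (ofPartials (gr x) (gs x)) x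
  hasFDerivAt_r : ∀ x ∈ Ioo 0 ρ ×ˢ Ioo (0 : ℝ) 1, HasFDerivAt gr (ofPartials (grr x) (grs x)) x
  hasDerivAt_s : ∀ x ∈ Ioo 0 ρ ×ˢ Ioo (0 : ℝ) 1, HasDerivAt (fun r => gs (r, x.2)) (grs x) x.1
  pde : ∀ x ∈ Ioo 0 ρ ×ˢ Ioo (0 : ℝ) 1,
    x.1 * (grr x - p x.1 * g x) - gr x - x.2 * grs x = 0
  initial : ∀ r ∈ Icc 0 ρ, g (r, 1) = ∫ τ in (0 : ℝ)..r, (τ : ℂ) * p τ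
  initial_r : ∀ r ∈ Ioo 0 ρ, gr (r, 1) = r * p r
  zero : ∀ σ ∈ Icc (0 : ℝ) 1, g (0, σ) = 0
  zero_s : ∀ σ ∈ Ioo (0 : ℝ) 1, gs (0, σ) = 0

theorem ofPartials_apply_basis (L : ℝ × ℝ →L[ℝ] ℂ) : ofPartials (L (1, 0)) (L (0, 1)) = L := by
  ext <;> simp

theorem hasDerivAt_integral_mul {ρ : ℝ} {p : ℝ → ℂ} (hp : ContinuousOn p (Icc 0 ρ)) {r : ℝ}
    (hr : r ∈ Ioo 0 ρ) :
    HasDerivAt (fun r : ℝ => ∫ τ in (0 : ℝ)..r, (τ : ℂ) * p τ) (r * p r) r := by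
  have hk : ContinuousOn (fun y : ℝ × ℝ => (y.1 : ℂ) * p y.1) (Icc 0 ρ ×ˢ univ) :=
    continuousOn_fst_mul (continuousOn_comp_fst hp)
  have := hasDerivAt_radInt hk hr (mem_univ (0 : ℝ))
  simpa only [radInt_eq] using this

/-- Derivatives are taken within [0, ρ] × (0, 1], so the edges σ = 1 and r = 0 carry the one-sided
values obtained by differentiating the boundary conditions; σ = 0 is left out since C² is not
assumed at t = 1. The equation contains g_rσ, while the defects need the r-derivative of g_σ; these
agree by symmetry of the second derivative. -/
theorem IsTransmutationKernel.exists_isPolarKernel {ρ : ℝ} {p : ℝ → ℂ} {G : ℝ → ℝ → ℂ} (hρ : 0 < ρ)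
    (hp : ContinuousOn p (Icc 0 ρ)) (hG : IsTransmutationKernel ρ p G) :
    ∃ gr gs grr grs, IsPolarKernel ρ p (fun x => G x.1 (1 - x.2 ^ 2)) gr gs grr grs := by
  set g : ℝ × ℝ → ℂ := fun x => G x.1 (1 - x.2 ^ 2) with hg
  set Q : Set (ℝ × ℝ) := Icc 0 ρ ×ˢ Ioc 0 1 with hQ
  have hQu : UniqueDiffOn ℝ Q := (uniqueDiffOn_Icc hρ).prod (uniqueDiffOn_Ioc 0 1)
  set I : Set (ℝ × ℝ) := Ioo 0 ρ ×ˢ Ioo (0 : ℝ) 1 with hI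
  have hIo : IsOpen I := isOpen_Ioo.prod isOpen_Ioo
  have hIQ : I ⊆ Q := prod_mono Ioo_subset_Icc_self Ioo_subset_Ioc_self
  have hnhds : ∀ x ∈ I, Q ∈ 𝓝 x := fun x hx => mem_of_superset (hIo.mem_nhds hx) hIQ
  have hgc : ContinuousOn g (Icc 0 ρ ×ˢ Icc 0 1) :=
    hG.continuousOn.comp (f := fun x : ℝ × ℝ => (x.1, 1 - x.2 ^ 2)) (by fun_prop)
      fun x hx => ⟨hx.1, one_sub_sq_mem hx.2⟩
  have hg2 : ContDiffOn ℝ 2 g Q := by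
    refine hG.contDiffOn.comp (f := fun x : ℝ × ℝ => (x.1, 1 - x.2 ^ 2))
      (contDiff_fst.prodMk (contDiff_const.sub (contDiff_snd.pow 2))).contDiffOn fun x hx => ?_
    have := one_sub_sq_mem (Ioc_subset_Icc_self hx.2)
    refine ⟨hx.1, this.1, ?_⟩
    have := hx.2.1
    have : 0 < x.2 ^ 2 := by positivity
    show 1 - x.2 ^ 2 < 1
    linarith
  have hfd1 : ContDiffOn ℝ 1 (fderivWithin ℝ g Q) Q := hg2.fderivWithin hQu (by norm_num)
  set gr : ℝ × ℝ → ℂ := fun x => fderivWithin ℝ g Q x (1, 0) with hgr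
  set gs : ℝ × ℝ → ℂ := fun x => fderivWithin ℝ g Q x (0, 1) with hgs
  have hgr1 : ContDiffOn ℝ 1 gr Q := hfd1.clm_apply contDiffOn_const
  have hgs1 : ContDiffOn ℝ 1 gs Q := hfd1.clm_apply contDiffOn_const
  have hdiffQ : ∀ x ∈ Q, HasFDerivWithinAt g (fderivWithin ℝ g Q x) Q x := fun x hx =>
    (hg2.differentiableOn two_ne_zero x hx).hasFDerivWithinAt
  have hfd : ∀ x ∈ I, HasFDerivAt g (ofPartials (gr x) (gs x)) x := by
    intro x hx
    rw [hgr, hgs]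
    simp only
    rw [ofPartials_apply_basis]
    exact (hdiffQ x (hIQ hx)).hasFDerivAt (hnhds x hx)
  have hfdr : ∀ x ∈ I, HasFDerivAt gr (fderiv ℝ gr x) x := fun x hx =>
    ((hgr1.contDiffAt (hnhds x hx)).differentiableAt one_ne_zero).hasFDerivAt
  have hfds : ∀ x ∈ I, HasFDerivAt gs (fderiv ℝ gs x) x := fun x hx =>
    ((hgs1.contDiffAt (hnhds x hx)).differentiableAt one_ne_zero).hasFDerivAt
  have hsymm : ∀ x ∈ I, fderiv ℝ gs x (1, 0) = fderiv ℝ gr x (0, 1) := by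
    intro x hx
    have hat : ContDiffAt ℝ 2 g x := hg2.contDiffAt (hnhds x hx)
    have hev : ∀ᶠ y in 𝓝 x, fderivWithin ℝ g Q y = fderiv ℝ g y := by
      filter_upwards [hIo.mem_nhds hx] with y hy
      exact fderivWithin_of_mem_nhds (hnhds y hy)
    have hd : DifferentiableAt ℝ (fderiv ℝ g) x :=
      (hat.fderiv_right (m := 1) (by norm_num)).differentiableAt one_ne_zero
    have hr : fderiv ℝ gr x (0, 1) = fderiv ℝ (fderiv ℝ g) x (0, 1) (1, 0) := by
      have : gr =ᶠ[𝓝 x] fun y => fderiv ℝ g y (1, 0) := by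
        filter_upwards [hev] with y hy
        simp only [hgr, hy]
      rw [this.fderiv_eq, fderiv_clm_apply hd (by fun_prop)]
      simp
    have hs : fderiv ℝ gs x (1, 0) = fderiv ℝ (fderiv ℝ g) x (1, 0) (0, 1) := by
      have : gs =ᶠ[𝓝 x] fun y => fderiv ℝ g y (0, 1) := by
        filter_upwards [hev] with y hy
        simp only [hgs, hy]
      rw [this.fderiv_eq, fderiv_clm_apply hd (by fun_prop)]
      simp
    rw [hr, hs]
    exact (hat.isSymmSndFDerivAt (by simp)).eq _ _
  have hline : ∀ r σ : ℝ, HasDerivAt (fun r : ℝ => (r, σ)) ((1, 0) : ℝ × ℝ) r := fun r σ =>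
    (hasDerivAt_id r).prodMk (hasDerivAt_const r σ)
  have hline' : ∀ r σ : ℝ, HasDerivAt (fun σ : ℝ => (r, σ)) ((0, 1) : ℝ × ℝ) σ := fun r σ =>
    (hasDerivAt_const σ r).prodMk (hasDerivAt_id σ)
  have hgd : ∀ x ∈ I, HasDerivAt (fun r => g (r, x.2)) (gr x) x.1 := fun x hx => by
    have := (hfd x hx).comp_hasDerivAt (f := fun r : ℝ => (r, x.2)) x.1 (hline x.1 x.2)
    exact this.congr_deriv (by simp)
  refine ⟨gr, gs, fun x => fderiv ℝ gr x (1, 0), fun x => fderiv ℝ gr x (0, 1), ?_⟩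
  constructor
  · exact hgc
  · exact hgr1.continuousOn
  · exact hgs1.continuousOn
  · exact hfd
  · intro x hx
    rw [ofPartials_apply_basis]
    exact hfdr x hx
  · intro x hx
    rw [← hsymm x hx]
    exact (hfds x hx).comp_hasDerivAt (f := fun r : ℝ => (r, x.2)) x.1 (hline x.1 x.2)
  · rintro ⟨r, σ⟩ hx
    have hr : r ∈ Ioo 0 ρ := hx.1
    have hσ : σ ∈ Ioo (0 : ℝ) 1 := hx.2
    have hσ2 : 1 - σ ^ 2 ∈ Ioo (0 : ℝ) 1 := by
      constructor <;> nlinarith [hσ.1, hσ.2]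
    have hpde := hG.pde r hr (1 - σ ^ 2) hσ2
    have h1 : ∀ s ∈ Ioo 0 ρ, deriv (fun s' => G s' (1 - σ ^ 2)) s = gr (s, σ) := fun s hs =>
      (hgd (s, σ) ⟨hs, hσ⟩).deriv
    have h2 : deriv (fun s => deriv (fun s' => G s' (1 - σ ^ 2)) s) r = fderiv ℝ gr (r, σ) (1, 0) := by
      have : (fun s => deriv (fun s' => G s' (1 - σ ^ 2)) s) =ᶠ[𝓝 r] fun s => gr (s, σ) := by
        filter_upwards [Ioo_mem_nhds hr.1 hr.2] with s hs using h1 s hs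
      rw [this.deriv_eq]
      exact ((hfdr (r, σ) hx).comp_hasDerivAt (f := fun r : ℝ => (r, σ)) r (hline r σ)).deriv
    have hsq : √(1 - (1 - σ ^ 2)) = σ := by
      rw [sub_sub_cancel, Real.sqrt_sq hσ.1.le]
    have h3 : deriv (fun τ => deriv (fun s => G s τ) r) (1 - σ ^ 2) =
        (-1 / (2 * σ) : ℝ) * fderiv ℝ gr (r, σ) (0, 1) := by
      have : (fun τ => deriv (fun s => G s τ) r) =ᶠ[𝓝 (1 - σ ^ 2)] fun τ => gr (r, √(1 - τ)) := by
        filter_upwards [Ioo_mem_nhds hσ2.1 hσ2.2] with τ hτ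
        have hpos : 0 < 1 - τ := by linarith [hτ.2]
        have hmem : (r, √(1 - τ)) ∈ I := ⟨hr, Real.sqrt_pos.2 hpos,
          by rw [Real.sqrt_lt' one_pos]; linarith [hτ.1]⟩
        have := (hgd _ hmem).deriv
        simp only [hg, Real.sq_sqrt hpos.le, sub_sub_cancel] at this
        exact this
      rw [this.deriv_eq]
      have hd : HasDerivAt (fun τ : ℝ => √(1 - τ)) (-1 / (2 * σ)) (1 - σ ^ 2) := by
        have := ((hasDerivAt_id (1 - σ ^ 2)).const_sub 1).sqrt
          (by simpa using hσ.1.ne')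
        simpa [hsq, Real.sqrt_sq hσ.1.le] using this
      have hc := HasDerivAt.scomp (h := fun τ : ℝ => √(1 - τ)) (1 - σ ^ 2)
        (g₁ := fun σ => gr (r, σ)) (g₁' := fderiv ℝ gr (r, σ) (0, 1)) (by
          rw [hsq]
          exact (hfdr (r, σ) hx).comp_hasDerivAt (f := fun σ : ℝ => (r, σ)) σ (hline' r σ)) hd
      exact hc.deriv.trans (by simp)
    rw [h2, h1 r hr, h3] at hpde
    have hσC : (σ : ℂ) ≠ 0 := by exact_mod_cast hσ.1.ne'
    simp only [hg]
    rw [← hpde]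
    push_cast
    field_simp
    ring
  · intro r hr
    simpa [hg] using hG.initial r hr
  · intro r hr
    have hmem : (r, (1 : ℝ)) ∈ Q := ⟨Ioo_subset_Icc_self hr, zero_lt_one, le_rfl⟩
    have h1 : HasDerivWithinAt (fun r => g (r, 1)) (gr (r, 1)) (Icc 0 ρ) r :=
      (hdiffQ _ hmem).comp_hasDerivWithinAt (f := fun r : ℝ => (r, (1 : ℝ))) r
        (hline r 1).hasDerivWithinAt fun s hs => ⟨hs, zero_lt_one, le_rfl⟩
    have h2 := h1.hasDerivAt (Icc_mem_nhds hr.1 hr.2)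
    refine h2.unique ((hasDerivAt_integral_mul hp hr).congr_of_eventuallyEq ?_)
    filter_upwards [Icc_mem_nhds hr.1 hr.2] with s hs
    simpa [hg] using hG.initial s hs
  · intro σ hσ
    exact hG.zero _ (one_sub_sq_mem hσ)
  · intro σ hσ
    have hmem : ((0 : ℝ), σ) ∈ Q := ⟨⟨le_rfl, hρ.le⟩, Ioo_subset_Ioc_self hσ⟩
    have h1 : HasDerivWithinAt (fun σ => g (0, σ)) (gs (0, σ)) (Ioc 0 1) σ :=
      (hdiffQ _ hmem).comp_hasDerivWithinAt (f := fun σ : ℝ => ((0 : ℝ), σ)) σ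
        (hline' 0 σ).hasDerivWithinAt fun s hs => ⟨⟨le_rfl, hρ.le⟩, hs⟩
    have h2 := h1.hasDerivAt (Ioc_mem_nhds hσ.1 hσ.2)
    refine h2.unique ((hasDerivAt_const σ (0 : ℂ)).congr_of_eventuallyEq ?_)
    filter_upwards [Icc_mem_nhds hσ.1 hσ.2] with s hs
    exact hG.zero _ (one_sub_sq_mem hs)

/-! ### The first-order relations between the two kernels. -/

/-- The logarithmic derivative `h = f' / f` of a radial solution of `Δ f = q f`. -/
structure IsLogDeriv (ρ : ℝ) (q h : ℝ → ℂ) : Prop where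
  cont_pot : ContinuousOn q (Icc 0 ρ)
  cont : ContinuousOn h (Icc 0 ρ)
  riccati : ∀ r ∈ Ioo 0 ρ, HasDerivAt h (q r - h r ^ 2 - h r / r) r
  exists_bound : ∃ C, 0 ≤ C ∧ ∀ r ∈ Icc 0 ρ, ‖h r‖ ≤ C * r

theorem IsLogDeriv.hasDerivAt_mul {ρ : ℝ} {q h : ℝ → ℂ} (hh : IsLogDeriv ρ q h) {r : ℝ}
    (hr : r ∈ Ioo 0 ρ) :
    HasDerivAt (fun r : ℝ => (r : ℂ) * h r) (r * q r - r * h r ^ 2) r := by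
  have hrC : (r : ℂ) ≠ 0 := by exact_mod_cast hr.1.ne'
  refine ((hasDerivAt_coe r).fun_mul (hh.riccati r hr)).congr_deriv ?_
  field_simp
  ring

section FirstOrder

variable {ρ : ℝ} {q h : ℝ → ℂ} {g₁ g₁r g₁s g₁rr g₁rs g₂ g₂r g₂s g₂rr g₂rs : ℝ × ℝ → ℂ}

theorem IsPolarKernel.hasDerivAt_fst {p : ℝ → ℂ} (hg : IsPolarKernel ρ p g₁ g₁r g₁s g₁rr g₁rs)
    {x : ℝ × ℝ} (hx : x ∈ Ioo 0 ρ ×ˢ Ioo (0 : ℝ) 1) :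
    HasDerivAt (fun r => g₁ (r, x.2)) (g₁r x) x.1 :=
  ((hg.hasFDerivAt x hx).comp_hasDerivAt (f := fun r : ℝ => (r, x.2)) x.1
    ((hasDerivAt_id x.1).prodMk (hasDerivAt_const x.1 x.2))).congr_deriv (by simp)

theorem IsPolarKernel.hasDerivAt_snd {p : ℝ → ℂ} (hg : IsPolarKernel ρ p g₁ g₁r g₁s g₁rr g₁rs)
    {x : ℝ × ℝ} (hx : x ∈ Ioo 0 ρ ×ˢ Ioo (0 : ℝ) 1) :
    HasDerivAt (fun σ => g₁ (x.1, σ)) (g₁s x) x.2 :=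
  ((hg.hasFDerivAt x hx).comp_hasDerivAt (f := fun σ : ℝ => (x.1, σ)) x.2
    ((hasDerivAt_const x.2 x.1).prodMk (hasDerivAt_id x.2))).congr_deriv (by simp)

theorem IsPolarKernel.hasDerivAt_r_fst {p : ℝ → ℂ} (hg : IsPolarKernel ρ p g₁ g₁r g₁s g₁rr g₁rs)
    {x : ℝ × ℝ} (hx : x ∈ Ioo 0 ρ ×ˢ Ioo (0 : ℝ) 1) :
    HasDerivAt (fun r => g₁r (r, x.2)) (g₁rr x) x.1 :=
  ((hg.hasFDerivAt_r x hx).comp_hasDerivAt (f := fun r : ℝ => (r, x.2)) x.1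
    ((hasDerivAt_id x.1).prodMk (hasDerivAt_const x.1 x.2))).congr_deriv (by simp)

theorem hasDerivAt_char_curve {c τ : ℝ} (hτ : τ ≠ 0) :
    HasDerivAt (fun τ : ℝ => (τ, c / τ)) ((1, -(c / τ) / τ) : ℝ × ℝ) τ := by
  refine (hasDerivAt_id τ).prodMk ?_
  have := (hasDerivAt_inv hτ).const_mul c
  refine (this.congr_deriv ?_).congr_of_eventuallyEq (Eventually.of_forall fun s => ?_)
  · field_simp
  · exact div_eq_mul_inv _ _

/-- By the Riccati equation (rh)' = rq - rh², so r times the difference 2h² - 2q of the two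
potentials is -2(rh)'; both sides vanish at r = 0. -/
theorem IsPolarKernel.diff_initial (hh : IsLogDeriv ρ q h)
    (h₁ : IsPolarKernel ρ q g₁ g₁r g₁s g₁rr g₁rs)
    (h₂ : IsPolarKernel ρ (fun r => 2 * h r ^ 2 - q r) g₂ g₂r g₂s g₂rr g₂rs) {r : ℝ}
    (hr : r ∈ Icc 0 ρ) : g₂ (r, 1) - g₁ (r, 1) = -(2 * (r * h r)) := by
  have hsub : Icc 0 r ⊆ Icc 0 ρ := Icc_subset_Icc_right hr.2
  have hi : ∀ {p : ℝ → ℂ}, ContinuousOn p (Icc 0 ρ) →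
      IntervalIntegrable (fun τ : ℝ => (τ : ℂ) * p τ) volume 0 r := fun hp => by
    refine ContinuousOn.intervalIntegrable ?_
    rw [uIcc_of_le hr.1]
    exact ContinuousOn.mul (by fun_prop) (hp.mono hsub)
  have hp2 : ContinuousOn (fun r => 2 * h r ^ 2 - q r) (Icc 0 ρ) :=
    (continuousOn_const.mul (hh.cont.pow 2)).sub hh.cont_pot
  rw [h₁.initial r hr, h₂.initial r hr, ← intervalIntegral.integral_sub (hi hp2) (hi hh.cont_pot)]
  have hF : ContinuousOn (fun r : ℝ => -(2 * ((r : ℂ) * h r))) (Icc 0 r) :=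
    (continuousOn_const.mul (ContinuousOn.mul (by fun_prop) (hh.cont.mono hsub))).neg
  rw [intervalIntegral.integral_eq_sub_of_hasDerivAt_of_le hr.1 hF (fun τ hτ =>
    (((hh.hasDerivAt_mul ⟨hτ.1, hτ.2.trans_le hr.2⟩).const_mul 2).neg).congr_deriv (by ring))
    ((hi hp2).sub (hi hh.cont_pot))]
  simp

/-- First compatibility defect of the two kernels. -/
def defectX (h : ℝ → ℂ) (g₁ g₁r g₂ g₂r : ℝ × ℝ → ℂ) (x : ℝ × ℝ) : ℂ :=
  g₁r x + g₂r x + h x.1 * (g₂ x - g₁ x)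

/-- Second compatibility defect of the two kernels. -/
def defectY (h : ℝ → ℂ) (g₁ g₁r g₁s g₂ g₂r g₂s : ℝ × ℝ → ℂ) (x : ℝ × ℝ) : ℂ :=
  x.1 * (g₂r x - g₁r x) - x.2 * (g₂s x - g₁s x) - 2 * (g₂ x - g₁ x) +
    x.1 * h x.1 * (g₁ x + g₂ x)

/-- On rσ = c the tangent is (1, -σ/τ), so the sum of the two kernel equations contains exactly the
characteristic derivative of g₁_r + g₂_r; the Riccati equation handles the term with h'. Dividing by
τ removes the zeroth-order term in X. -/
theorem hasDerivAt_defectX_char (hh : IsLogDeriv ρ q h)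
    (h₁ : IsPolarKernel ρ q g₁ g₁r g₁s g₁rr g₁rs)
    (h₂ : IsPolarKernel ρ (fun r => 2 * h r ^ 2 - q r) g₂ g₂r g₂s g₂rr g₂rs) {c τ : ℝ}
    (hx : (τ, c / τ) ∈ Ioo 0 ρ ×ˢ Ioo (0 : ℝ) 1) :
    HasDerivAt (fun τ : ℝ => defectX h g₁ g₁r g₂ g₂r (τ, c / τ) / τ)
      (h τ * defectY h g₁ g₁r g₁s g₂ g₂r g₂s (τ, c / τ) / τ ^ 2) τ := by
  have hτ0 : τ ≠ 0 := hx.1.1.ne'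
  have hτC : (τ : ℂ) ≠ 0 := by exact_mod_cast hτ0
  have hc := hasDerivAt_char_curve (c := c) hτ0
  have d1 := (h₁.hasFDerivAt _ hx).comp_hasDerivAt (f := fun τ : ℝ => (τ, c / τ)) τ hc
  have d2 := (h₂.hasFDerivAt _ hx).comp_hasDerivAt (f := fun τ : ℝ => (τ, c / τ)) τ hc
  have d3 := (h₁.hasFDerivAt_r _ hx).comp_hasDerivAt (f := fun τ : ℝ => (τ, c / τ)) τ hc
  have d4 := (h₂.hasFDerivAt_r _ hx).comp_hasDerivAt (f := fun τ : ℝ => (τ, c / τ)) τ hc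
  have p1 := h₁.pde _ hx
  have p2 := h₂.pde _ hx
  have key := (((d3.add d4).add ((hh.riccati τ hx.1).mul (d2.sub d1))).div (hasDerivAt_coe τ) hτC)
  refine key.congr_deriv ?_
  simp only [ofPartials_apply, one_smul, Complex.real_smul, Pi.add_apply, Pi.mul_apply, Pi.sub_apply,
    Function.comp, defectY] at p1 p2 ⊢
  generalize c / τ = σ at *
  field_simp
  push_cast
  field_simp
  linear_combination p1 + p2

/-- The difference of the two kernel equations accounts for the second derivatives, and (rh)' = rq -
rh² for the rest. -/
theorem hasDerivAt_defectY (hh : IsLogDeriv ρ q h)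
    (h₁ : IsPolarKernel ρ q g₁ g₁r g₁s g₁rr g₁rs)
    (h₂ : IsPolarKernel ρ (fun r => 2 * h r ^ 2 - q r) g₂ g₂r g₂s g₂rr g₂rs) {x : ℝ × ℝ}
    (hx : x ∈ Ioo 0 ρ ×ˢ Ioo (0 : ℝ) 1) :
    HasDerivAt (fun r : ℝ => defectY h g₁ g₁r g₁s g₂ g₂r g₂s (r, x.2))
      (x.1 * h x.1 * defectX h g₁ g₁r g₂ g₂r x) x.1 := by
  have p1 := h₁.pde _ hx
  have p2 := h₂.pde _ hx
  have key := ((((hasDerivAt_coe x.1).mul ((h₂.hasDerivAt_r_fst hx).sub (h₁.hasDerivAt_r_fst hx))).sub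
    (((h₂.hasDerivAt_s x hx).sub (h₁.hasDerivAt_s x hx)).const_mul (x.2 : ℂ))).sub
    (((h₂.hasDerivAt_fst hx).sub (h₁.hasDerivAt_fst hx)).const_mul 2)).add
    ((hh.hasDerivAt_mul hx.1).mul ((h₁.hasDerivAt_fst hx).add (h₂.hasDerivAt_fst hx)))
  refine key.congr_deriv ?_
  simp only [defectX, Pi.sub_apply, Pi.add_apply]
  linear_combination p2 - p1

theorem continuousOn_defectX (hh : IsLogDeriv ρ q h)
    (h₁ : IsPolarKernel ρ q g₁ g₁r g₁s g₁rr g₁rs)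
    (h₂ : IsPolarKernel ρ (fun r => 2 * h r ^ 2 - q r) g₂ g₂r g₂s g₂rr g₂rs) :
    ContinuousOn (defectX h g₁ g₁r g₂ g₂r) (Icc 0 ρ ×ˢ Ioc 0 1) :=
  have hsub : Icc 0 ρ ×ˢ Ioc 0 1 ⊆ Icc 0 ρ ×ˢ Icc (0 : ℝ) 1 := prod_mono_right Ioc_subset_Icc_self
  (h₁.cont_r.add h₂.cont_r).add ((continuousOn_comp_fst hh.cont).mul
    ((h₂.cont.mono hsub).sub (h₁.cont.mono hsub)))

theorem continuousOn_defectY (hh : IsLogDeriv ρ q h)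
    (h₁ : IsPolarKernel ρ q g₁ g₁r g₁s g₁rr g₁rs)
    (h₂ : IsPolarKernel ρ (fun r => 2 * h r ^ 2 - q r) g₂ g₂r g₂s g₂rr g₂rs) :
    ContinuousOn (defectY h g₁ g₁r g₁s g₂ g₂r g₂s) (Icc 0 ρ ×ˢ Ioc 0 1) := by
  have hsub : Icc 0 ρ ×ˢ Ioc 0 1 ⊆ Icc 0 ρ ×ˢ Icc (0 : ℝ) 1 := prod_mono_right Ioc_subset_Icc_self
  have c₁ := h₁.cont.mono hsub
  have c₂ := h₂.cont.mono hsub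
  exact (((continuousOn_fst_mul (h₂.cont_r.sub h₁.cont_r)).sub
    (ContinuousOn.mul (by fun_prop) (h₂.cont_s.sub h₁.cont_s))).sub
    (continuousOn_const.mul (c₂.sub c₁))).add
    ((continuousOn_fst_mul (continuousOn_comp_fst hh.cont)).mul (c₁.add c₂))

/-- X/τ is integrated along the characteristic from τ = rσ, where σ = 1 and X = 0, up to r. One
power of τ in the source is cancelled by |h| ≤ Cτ; the other is bounded below by rσ, hence the
factor 1/σ₀. -/
theorem norm_defectX_le (hh : IsLogDeriv ρ q h)
    (h₁ : IsPolarKernel ρ q g₁ g₁r g₁s g₁rr g₁rs)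
    (h₂ : IsPolarKernel ρ (fun r => 2 * h r ^ 2 - q r) g₂ g₂r g₂s g₂rr g₂rs) {C N σ₀ : ℝ}
    (hC0 : 0 ≤ C) (hC : ∀ r ∈ Icc 0 ρ, ‖h r‖ ≤ C * r) (hN : 0 ≤ N) (hσ₀ : 0 < σ₀) {x : ℝ × ℝ}
    (hx : x ∈ Ioo 0 ρ ×ˢ Ico σ₀ 1)
    (hY : ∀ τ ∈ Ioo 0 x.1, ∀ σ ∈ Ico σ₀ 1, ‖defectY h g₁ g₁r g₁s g₂ g₂r g₂s (τ, σ)‖ ≤ N) :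
    ‖defectX h g₁ g₁r g₂ g₂r x‖ ≤ x.1 * (C * N / σ₀) := by
  obtain ⟨r, σ⟩ := x
  have hr : r ∈ Ioo 0 ρ := hx.1
  have hσ : σ ∈ Ico σ₀ 1 := hx.2
  have hr0 : 0 < r := hr.1
  have hσ0 : 0 < σ := hσ₀.trans_le hσ.1
  have hc0 : 0 < r * σ := mul_pos hr0 hσ0
  have hcr : r * σ ≤ r := mul_le_of_le_one_right hr0.le hσ.2.le
  have hmem : ∀ τ ∈ Icc (r * σ) r, (τ, r * σ / τ) ∈ Icc 0 ρ ×ˢ Ioc (0 : ℝ) 1 := fun τ hτ =>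
    have hτ0 : 0 < τ := hc0.trans_le hτ.1
    ⟨⟨hτ0.le, hτ.2.trans hr.2.le⟩, div_pos hc0 hτ0, (div_le_one hτ0).2 hτ.1⟩
  have hcont : ContinuousOn (fun τ : ℝ => defectX h g₁ g₁r g₂ g₂r (τ, r * σ / τ) / τ)
      (Icc (r * σ) r) := by
    have hne : ∀ τ ∈ Icc (r * σ) r, τ ≠ 0 := fun τ hτ => (hc0.trans_le hτ.1).ne'
    refine ContinuousOn.div ?_ (by fun_prop) fun τ hτ => by exact_mod_cast hne τ hτ
    exact (continuousOn_defectX hh h₁ h₂).comp (f := fun τ : ℝ => (τ, r * σ / τ))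
      (continuousOn_id.prodMk (continuousOn_const.div continuousOn_id hne)) hmem
  have hInt : ∀ τ ∈ Ioo (r * σ) r, r * σ / τ ∈ Ico σ₀ 1 := fun τ hτ => by
    have hτ0 : 0 < τ := hc0.trans hτ.1
    refine ⟨?_, (div_lt_one hτ0).2 hτ.1⟩
    rw [le_div_iff₀ hτ0, mul_comm]
    exact mul_le_mul hτ.2.le hσ.1 hσ₀.le hr0.le
  have key := norm_sub_le_of_hasDerivAt_Ioo (C := C * N / (r * σ)) hcr hcont
    (fun τ hτ => hasDerivAt_defectX_char hh h₁ h₂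
      ⟨⟨hc0.trans hτ.1, hτ.2.trans hr.2⟩, hσ₀.trans_le (hInt τ hτ).1, (hInt τ hτ).2⟩) (by
      intro τ hτ
      have hτ0 : 0 < τ := hc0.trans hτ.1
      rw [norm_div, norm_mul, norm_pow, Complex.norm_real, Real.norm_of_nonneg hτ0.le]
      have b1 := hC τ ⟨hτ0.le, (hτ.2.trans hr.2).le⟩
      have b2 := hY τ ⟨hτ0, hτ.2⟩ _ (hInt τ hτ)
      calc _ ≤ C * τ * N / τ ^ 2 := by gcongr
        _ = C * N / τ := by field_simp
        _ ≤ C * N / (r * σ) := by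
            have := hτ.1.le
            gcongr)
  -- At σ = 1 the r-derivatives add up to r(q + 2h² - q) = 2rh², and h times the difference of the
  -- kernels is -2rh².
  have hX1 : defectX h g₁ g₁r g₂ g₂r (r * σ, 1) = 0 := by
    have hm : r * σ ∈ Ioo 0 ρ := ⟨hc0, hcr.trans_lt hr.2⟩
    simp only [defectX]
    rw [h₁.initial_r _ hm, h₂.initial_r _ hm,
      IsPolarKernel.diff_initial hh h₁ h₂ (Ioo_subset_Icc_self hm)]
    ring
  rw [div_self hc0.ne', hX1, zero_div, sub_zero, mul_div_cancel_left₀ σ hr0.ne', norm_div,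
    Complex.norm_real, Real.norm_of_nonneg hr0.le, div_le_iff₀ hr0] at key
  refine key.trans ?_
  rw [mul_comm]
  refine mul_le_mul_of_nonneg_left ?_ hr0.le
  calc C * N / (r * σ) * (r - r * σ) ≤ C * N / (r * σ) * r := by
        refine mul_le_mul_of_nonneg_left ?_ (by positivity)
        linarith
    _ = C * N / σ := by field_simp
    _ ≤ C * N / σ₀ := by
        have := hσ.1
        gcongr

/-- One turn of the loop: a bound on Y bounds X along characteristics, and integrating Y_r = rhX
from r = 0, where Y = 0, returns to Y. The constant K collects this loop, and the rate l = 2K + 1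
makes K/l ≤ 1/2. -/
theorem norm_defectY_le (hh : IsLogDeriv ρ q h)
    (h₁ : IsPolarKernel ρ q g₁ g₁r g₁s g₁rr g₁rs)
    (h₂ : IsPolarKernel ρ (fun r => 2 * h r ^ 2 - q r) g₂ g₂r g₂s g₂rr g₂rs) {C B σ₀ : ℝ}
    (hC0 : 0 ≤ C) (hC : ∀ r ∈ Icc 0 ρ, ‖h r‖ ≤ C * r) (hB : 0 ≤ B) (hσ₀ : 0 < σ₀)
    (hY : ∀ x ∈ Ioo 0 ρ ×ˢ Ico σ₀ 1, ‖defectY h g₁ g₁r g₁s g₂ g₂r g₂s x‖ ≤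
      B * Real.exp ((2 * (|ρ| ^ 3 * C ^ 2 / σ₀) + 1) * x.1)) :
    ∀ x ∈ Ioo 0 ρ ×ˢ Ico σ₀ 1, ‖defectY h g₁ g₁r g₁s g₂ g₂r g₂s x‖ ≤
      B / 2 * Real.exp ((2 * (|ρ| ^ 3 * C ^ 2 / σ₀) + 1) * x.1) := by
  set K := |ρ| ^ 3 * C ^ 2 / σ₀ with hK
  have hK0 : 0 ≤ K := by positivity
  set l := 2 * K + 1 with hl
  have hl0 : 0 < l := by positivity
  rintro ⟨r, σ⟩ hx
  have hr : r ∈ Ioo 0 ρ := hx.1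
  have hσ : σ ∈ Ico σ₀ 1 := hx.2
  have hσ1 : σ ∈ Ioo (0 : ℝ) 1 := ⟨hσ₀.trans_le hσ.1, hσ.2⟩
  have hslice : ∀ {k : ℝ × ℝ → ℂ}, ContinuousOn k (Icc 0 ρ ×ˢ Ioc 0 1) →
      ContinuousOn (fun τ => k (τ, σ)) (Icc 0 r) := fun hk =>
    hk.comp (f := fun τ : ℝ => (τ, σ)) (by fun_prop)
      fun τ hτ => ⟨⟨hτ.1, hτ.2.trans hr.2.le⟩, Ioo_subset_Ioc_self hσ1⟩
  have hInt : IntervalIntegrable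
      (fun τ : ℝ => (τ : ℂ) * h τ * defectX h g₁ g₁r g₂ g₂r (τ, σ)) volume 0 r := by
    refine ContinuousOn.intervalIntegrable ?_
    rw [uIcc_of_le hr.1.le]
    exact (ContinuousOn.mul (by fun_prop) (hh.cont.mono (Icc_subset_Icc_right hr.2.le))).mul
      (hslice (continuousOn_defectX hh h₁ h₂))
  have hftc := intervalIntegral.integral_eq_sub_of_hasDerivAt_of_le hr.1.le
    (hslice (continuousOn_defectY hh h₁ h₂))
    (fun τ hτ => hasDerivAt_defectY hh h₁ h₂ (x := (τ, σ)) ⟨⟨hτ.1, hτ.2.trans hr.2⟩, hσ1⟩) hInt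
  have hY0 : defectY h g₁ g₁r g₁s g₂ g₂r g₂s (0, σ) = 0 := by
    simp only [defectY]
    rw [h₁.zero σ (Ioo_subset_Icc_self hσ1), h₂.zero σ (Ioo_subset_Icc_self hσ1),
      h₁.zero_s σ hσ1, h₂.zero_s σ hσ1]
    simp
  rw [hY0, sub_zero] at hftc
  rw [← hftc]
  have hb : ∀ᵐ τ : ℝ, τ ∈ Ioc 0 r → ‖(τ : ℂ) * h τ * defectX h g₁ g₁r g₂ g₂r (τ, σ)‖ ≤
      K * B * Real.exp (l * τ) := by
    refine Eventually.of_forall fun τ hτ => ?_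
    have hτ' : τ ∈ Ioo 0 ρ := ⟨hτ.1, hτ.2.trans_lt hr.2⟩
    have hτ0 := hτ.1
    have b1 := hC τ (Ioo_subset_Icc_self hτ')
    have b2 := norm_defectX_le hh h₁ h₂ hC0 hC (N := B * Real.exp (l * τ)) (by positivity) hσ₀
      (x := (τ, σ)) ⟨hτ', hσ⟩ fun s hs σ' hσ' => by
        refine (hY (s, σ') ⟨⟨hs.1, hs.2.trans hτ'.2⟩, hσ'⟩).trans ?_
        have : s ≤ τ := hs.2.le
        gcongr
    simp only at b2
    have hτρ : τ ≤ |ρ| := hτ'.2.le.trans (le_abs_self ρ)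
    rw [norm_mul, norm_mul, Complex.norm_real, Real.norm_of_nonneg hτ0.le]
    calc τ * ‖h τ‖ * ‖defectX h g₁ g₁r g₂ g₂r (τ, σ)‖
        ≤ |ρ| * (C * |ρ|) * (|ρ| * (C * (B * Real.exp (l * τ)) / σ₀)) := by
          gcongr
          · exact b1.trans (by gcongr)
          · exact b2.trans (by gcongr)
      _ = K * B * Real.exp (l * τ) := by rw [hK]; ring
  refine (intervalIntegral.norm_integral_le_of_norm_le hr.1.le hb
    (Continuous.intervalIntegrable (by fun_prop) _ _)).trans ?_
  have hexp : ∫ τ in (0 : ℝ)..r, Real.exp (l * τ) = (Real.exp (l * r) - 1) / l := by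
    rw [intervalIntegral.integral_comp_mul_left (fun x => Real.exp x) hl0.ne']
    simp
    ring
  rw [intervalIntegral.integral_const_mul, hexp]
  have he := Real.exp_pos (l * r)
  calc K * B * ((Real.exp (l * r) - 1) / l) ≤ K * B * (Real.exp (l * r) / l) := by
        gcongr
        linarith
    _ = K / l * (B * Real.exp (l * r)) := by ring
    _ ≤ 1 / 2 * (B * Real.exp (l * r)) := by
        refine mul_le_mul_of_nonneg_right ?_ (by positivity)
        rw [div_le_iff₀ hl0, hl]
        linarith
    _ = _ := by ring

/-- Followed back to its data, a characteristic from (r, σ) only meets larger σ, so the system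
closes on σ ≥ σ₀ with σ₀ the height of the given point. There the repeated halving kills Y, and the
estimate of X with N = 0 kills X. -/
theorem defects_eq_zero (hh : IsLogDeriv ρ q h)
    (h₁ : IsPolarKernel ρ q g₁ g₁r g₁s g₁rr g₁rs)
    (h₂ : IsPolarKernel ρ (fun r => 2 * h r ^ 2 - q r) g₂ g₂r g₂s g₂rr g₂rs) {x : ℝ × ℝ}
    (hx : x ∈ Ioo 0 ρ ×ˢ Ioo (0 : ℝ) 1) :
    defectX h g₁ g₁r g₂ g₂r x = 0 ∧ defectY h g₁ g₁r g₁s g₂ g₂r g₂s x = 0 := by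
  obtain ⟨C, hC0, hC⟩ := hh.exists_bound
  have hσ₀ : 0 < x.2 := hx.2.1
  have hQ : Icc 0 ρ ×ˢ Icc x.2 1 ⊆ Icc 0 ρ ×ˢ Ioc 0 1 :=
    prod_mono_right fun s hs => ⟨hσ₀.trans_le hs.1, hs.2⟩
  obtain ⟨B, hB⟩ := (isCompact_Icc.prod isCompact_Icc).exists_bound_of_continuousOn
    ((continuousOn_defectY hh h₁ h₂).mono hQ)
  have key : ∀ n : ℕ, ∀ y ∈ Ioo 0 ρ ×ˢ Ico x.2 1, ‖defectY h g₁ g₁r g₁s g₂ g₂r g₂s y‖ ≤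
      |B| * (1 / 2) ^ n * Real.exp ((2 * (|ρ| ^ 3 * C ^ 2 / x.2) + 1) * y.1) := by
    intro n
    induction n with
    | zero =>
      intro y hy
      have hy0 : (0 : ℝ) ≤ y.1 := hy.1.1.le
      have h1 : 1 ≤ Real.exp ((2 * (|ρ| ^ 3 * C ^ 2 / x.2) + 1) * y.1) :=
        Real.one_le_exp (by positivity)
      calc _ ≤ |B| := (hB y ⟨Ioo_subset_Icc_self hy.1, Ico_subset_Icc_self hy.2⟩).trans
            (le_abs_self B)
        _ ≤ |B| * (1 / 2) ^ 0 * Real.exp ((2 * (|ρ| ^ 3 * C ^ 2 / x.2) + 1) * y.1) := by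
            rw [pow_zero, mul_one]
            exact le_mul_of_one_le_right (abs_nonneg B) h1
    | succ n ih =>
      intro y hy
      refine (norm_defectY_le hh h₁ h₂ hC0 hC (by positivity) hσ₀ ih y hy).trans (le_of_eq ?_)
      rw [pow_succ]
      ring
  have hY : ∀ y ∈ Ioo 0 ρ ×ˢ Ico x.2 1, defectY h g₁ g₁r g₁s g₂ g₂r g₂s y = 0 := by
    intro y hy
    have ht : Tendsto (fun n : ℕ => |B| * (1 / 2) ^ n *
        Real.exp ((2 * (|ρ| ^ 3 * C ^ 2 / x.2) + 1) * y.1)) atTop (𝓝 0) := by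
      have := ((tendsto_pow_atTop_nhds_zero_of_lt_one (r := (1 / 2 : ℝ)) (by norm_num)
        (by norm_num)).const_mul |B|).mul_const
        (Real.exp ((2 * (|ρ| ^ 3 * C ^ 2 / x.2) + 1) * y.1))
      simpa using this
    exact norm_le_zero_iff.1 (ge_of_tendsto' ht fun n => key n y hy)
  have hx' : x ∈ Ioo 0 ρ ×ˢ Ico x.2 1 := ⟨hx.1, le_rfl, hx.2.2⟩
  refine ⟨norm_le_zero_iff.1 ?_, hY x hx'⟩
  have := norm_defectX_le hh h₁ h₂ hC0 hC le_rfl hσ₀ hx' fun τ hτ σ hσ => by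
    rw [hY (τ, σ) ⟨⟨hτ.1, hτ.2.trans hx.1.2⟩, hσ⟩, norm_zero]
  simpa using this

end FirstOrder

/-! ### Intertwining on a single ray. -/

/-- Two kernels satisfying the first order relation which makes `r (d/dr - h) T₁ = T₂ r d/dr`. -/
structure IsIntertwined (ρ : ℝ) (h : ℝ → ℂ) (g₁ g₂ gr ds : ℝ × ℝ → ℂ) : Prop where
  cont_h : ContinuousOn h (Icc 0 ρ)
  cont₁ : ContinuousOn g₁ (Icc 0 ρ ×ˢ Icc 0 1)
  cont₂ : ContinuousOn g₂ (Icc 0 ρ ×ˢ Icc 0 1)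
  cont_r : ContinuousOn gr (Icc 0 ρ ×ˢ Ioc 0 1)
  cont_ds : ContinuousOn ds (Icc 0 ρ ×ˢ Ioc 0 1)
  hasDerivAt_r : ∀ x ∈ Ioo 0 ρ ×ˢ Ioo (0 : ℝ) 1, HasDerivAt (fun r => g₁ (r, x.2)) (gr x) x.1
  hasDerivAt_s : ∀ x ∈ Ioo 0 ρ ×ˢ Ioo (0 : ℝ) 1,
    HasDerivAt (fun σ => g₂ (x.1, σ) - g₁ (x.1, σ)) (ds x) x.2
  rel : ∀ x ∈ Ioo 0 ρ ×ˢ Ioo (0 : ℝ) 1,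
    x.1 * gr x = x.1 * h x.1 * g₁ x - (x.2 * ds x + 2 * (g₂ x - g₁ x)) / 2
  initial : ∀ r ∈ Icc 0 ρ, g₂ (r, 1) - g₁ (r, 1) = -(2 * (r * h r))

/-- The integral part of `T`, cut off near `σ = 0`. -/
def cutT (g : ℝ × ℝ → ℂ) (φ : ℝ → ℂ) (ε r : ℝ) : ℂ :=
  ∫ σ in ε..1, (σ : ℂ) * g (r, σ) * φ (σ ^ 2 * r)

section Cut

variable {ρ R : ℝ} {g : ℝ × ℝ → ℂ} {φ : ℝ → ℂ}

theorem sq_mul_mem_Icc {r σ : ℝ} (hr : r ∈ Icc 0 R) (hσ : σ ∈ Icc (0 : ℝ) 1) :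
    σ ^ 2 * r ∈ Icc 0 R := by
  rw [mul_comm]; exact scale_mem hr (sq_mem_unit hσ)

theorem continuousOn_cut_integrand {S : Set ℝ} (hS : S ⊆ Icc 0 1) (hR : R ≤ ρ)
    (hg : ContinuousOn g (Icc 0 ρ ×ˢ S)) (hφ : ContinuousOn φ (Icc 0 R)) :
    ContinuousOn (fun p : ℝ × ℝ => (p.2 : ℂ) * g (p.1, p.2) * φ (p.2 ^ 2 * p.1)) (Icc 0 R ×ˢ S) := by
  refine ContinuousOn.mul (ContinuousOn.mul (by fun_prop) ?_) ?_
  · exact hg.mono (prod_mono_left (Icc_subset_Icc_right hR))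
  · exact hφ.comp (by fun_prop) fun p hp => sq_mul_mem_Icc hp.1 (hS hp.2)

theorem intervalIntegrable_cut (hR : R ≤ ρ)
    (hg : ContinuousOn g (Icc 0 ρ ×ˢ Icc 0 1)) (hφ : ContinuousOn φ (Icc 0 R)) {a b r : ℝ}
    (ha : a ∈ Icc (0 : ℝ) 1) (hb : b ∈ Icc (0 : ℝ) 1) (hr : r ∈ Icc 0 R) :
    IntervalIntegrable (fun σ : ℝ => (σ : ℂ) * g (r, σ) * φ (σ ^ 2 * r)) volume a b := by
  refine ContinuousOn.intervalIntegrable ?_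
  have h1 : ContinuousOn (fun σ : ℝ => (σ : ℂ) * g (r, σ) * φ (σ ^ 2 * r)) (Icc 0 1) :=
    (continuousOn_cut_integrand subset_rfl hR hg hφ).comp (f := fun σ : ℝ => (r, σ)) (by fun_prop)
      fun σ hσ => ⟨hr, hσ⟩
  exact h1.mono (uIcc_subset_Icc ha hb)

theorem norm_cutT_sub_le (hR : R ≤ ρ)
    (hg : ContinuousOn g (Icc 0 ρ ×ˢ Icc 0 1)) (hφ : ContinuousOn φ (Icc 0 R)) {M N ε r : ℝ}
    (hM : ∀ x ∈ Icc 0 ρ ×ˢ Icc (0 : ℝ) 1, ‖g x‖ ≤ M) (hN : ∀ x ∈ Icc 0 R, ‖φ x‖ ≤ N)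
    (hε : ε ∈ Icc (0 : ℝ) 1) (hr : r ∈ Icc 0 R) :
    ‖cutT g φ 0 r - cutT g φ ε r‖ ≤ M * N * ε := by
  have h0 : (0 : ℝ) ∈ Icc (0 : ℝ) 1 := ⟨le_rfl, zero_le_one⟩
  have h1 : (1 : ℝ) ∈ Icc (0 : ℝ) 1 := ⟨zero_le_one, le_rfl⟩
  have heq : cutT g φ 0 r - cutT g φ ε r =
      ∫ σ in (0 : ℝ)..ε, (σ : ℂ) * g (r, σ) * φ (σ ^ 2 * r) := by
    rw [cutT, cutT, ← intervalIntegral.integral_add_adjacent_intervals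
      (intervalIntegrable_cut hR hg hφ h0 hε hr) (intervalIntegrable_cut hR hg hφ hε h1 hr)]
    ring
  rw [heq]
  have := intervalIntegral.norm_integral_le_of_norm_le_const (a := 0) (b := ε) (C := M * N)
    (f := fun σ : ℝ => (σ : ℂ) * g (r, σ) * φ (σ ^ 2 * r)) fun σ hσ => by
      rw [uIoc_of_le hε.1] at hσ
      have hσ' : σ ∈ Icc (0 : ℝ) 1 := ⟨hσ.1.le, hσ.2.trans hε.2⟩
      have b1 := hM (r, σ) ⟨⟨hr.1, hr.2.trans hR⟩, hσ'⟩
      have b2 := hN _ (sq_mul_mem_Icc hr hσ')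
      have hM0 := (norm_nonneg _).trans b1
      rw [norm_mul, norm_mul, Complex.norm_real, Real.norm_of_nonneg hσ'.1]
      calc σ * ‖g (r, σ)‖ * ‖φ (σ ^ 2 * r)‖ ≤ 1 * M * N := by
            gcongr
            exact hσ'.2
        _ = M * N := by ring
  simpa [abs_of_nonneg hε.1] using this

end Cut

section Ray

variable {ρ R : ℝ} {h φ ψ : ℝ → ℂ} {g₁ g₂ gr ds : ℝ × ℝ → ℂ}

/-- The cut at ε keeps the integral where the kernel derivatives are continuous. The first-order
relation replaces r g_r, and the terms in g₂ - g₁ become an exact σ-derivative whose boundary values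
are hφ from σ = 1 and an error of order ε². -/
theorem IsIntertwined.hasDerivAt_cutT (H : IsIntertwined ρ h g₁ g₂ gr ds) (hR : R ≤ ρ)
    (hφ : ContinuousOn φ (Icc 0 R)) (hψ : ContinuousOn ψ (Icc 0 R))
    (hd : ∀ r ∈ Ioo 0 R, HasDerivAt φ (ψ r / r) r) {ε r : ℝ} (hε : ε ∈ Ioo (0 : ℝ) 1)
    (hr : r ∈ Ioo 0 R) :
    HasDerivAt (cutT g₁ φ ε) (h r * cutT g₁ φ ε r + h r * φ r + cutT g₂ ψ ε r / r +
      ε ^ 2 * (g₂ (r, ε) - g₁ (r, ε)) * φ (ε ^ 2 * r) / (2 * r)) r := by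
  have hε' : ε ∈ Icc (0 : ℝ) 1 := Ioo_subset_Icc_self hε
  have h1' : (1 : ℝ) ∈ Icc (0 : ℝ) 1 := ⟨zero_le_one, le_rfl⟩
  have hS : Icc ε 1 ⊆ Ioc 0 1 := fun σ hσ => ⟨hε.1.trans_le hσ.1, hσ.2⟩
  have hS' : Icc ε 1 ⊆ Icc 0 1 := Icc_subset_Icc_left hε.1.le
  have hrρ : r ∈ Ioo 0 ρ := ⟨hr.1, hr.2.trans_le hR⟩
  have hrC : (r : ℂ) ≠ 0 := by exact_mod_cast hr.1.ne'
  have hmono : ∀ {k : ℝ × ℝ → ℂ}, ContinuousOn k (Icc 0 R ×ˢ Icc ε 1) →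
      ContinuousOn k (Ioo 0 R ×ˢ Icc ε 1) := fun hk => hk.mono (prod_mono_left Ioo_subset_Icc_self)
  have c₁ := H.cont₁.mono (prod_mono_right (s := Icc 0 ρ) hS')
  have c₂ := H.cont₂.mono (prod_mono_right (s := Icc 0 ρ) hS')
  have cr := H.cont_r.mono (prod_mono_right (s := Icc 0 ρ) hS)
  have cd := H.cont_ds.mono (prod_mono_right (s := Icc 0 ρ) hS)
  have e₁ := continuousOn_cut_integrand hS' hR c₁ hφ
  have e₂ := continuousOn_cut_integrand hS' hR c₁ hψ
  have e₃ := continuousOn_cut_integrand hS' hR cr hφ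
  have key := hasDerivAt_intervalIntegral (F := fun r σ => (σ : ℂ) * g₁ (r, σ) * φ (σ ^ 2 * r))
    (F' := fun r σ => (σ : ℂ) * gr (r, σ) * φ (σ ^ 2 * r) + (σ : ℂ) * g₁ (r, σ) * ψ (σ ^ 2 * r) / r)
    hε.2.le hr (hmono e₁) ?_ ?_
  · refine key.congr_deriv ?_
    -- The function integrated by parts: its derivative contains σ(σ ds + 2(g₂ - g₁))φ/2 together
    -- with σ(g₂ - g₁)ψ, and the latter turns g₁ψ into g₂ψ.
    set W : ℝ → ℂ := fun σ => (σ : ℂ) ^ 2 / 2 * (g₂ (r, σ) - g₁ (r, σ)) * φ (σ ^ 2 * r) with hW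
    have hsl : ∀ {k : ℝ × ℝ → ℂ}, ContinuousOn k (Icc 0 ρ ×ˢ Icc ε 1) →
        ContinuousOn (fun σ => k (r, σ)) (Icc ε 1) := fun hk =>
      hk.comp (f := fun σ : ℝ => (r, σ)) (by fun_prop) fun σ hσ => ⟨Ioo_subset_Icc_self hrρ, hσ⟩
    have hφs : ContinuousOn (fun σ : ℝ => φ (σ ^ 2 * r)) (Icc ε 1) :=
      hφ.comp (by fun_prop) fun σ hσ => sq_mul_mem_Icc (Ioo_subset_Icc_self hr) (hS' hσ)
    have hψs : ContinuousOn (fun σ : ℝ => ψ (σ ^ 2 * r)) (Icc ε 1) :=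
      hψ.comp (by fun_prop) fun σ hσ => sq_mul_mem_Icc (Ioo_subset_Icc_self hr) (hS' hσ)
    have hWc : ContinuousOn W (Icc ε 1) :=
      (ContinuousOn.mul (by fun_prop) ((hsl c₂).sub (hsl c₁))).mul hφs
    set W' : ℝ → ℂ := fun σ => (σ : ℂ) * (g₂ (r, σ) - g₁ (r, σ)) * φ (σ ^ 2 * r) +
      (σ : ℂ) ^ 2 / 2 * ds (r, σ) * φ (σ ^ 2 * r) +
      (σ : ℂ) * (g₂ (r, σ) - g₁ (r, σ)) * ψ (σ ^ 2 * r) with hW'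
    have hWd : ∀ σ ∈ Ioo ε 1, HasDerivAt W (W' σ) σ := by
      intro σ hσ
      have hσ0 : 0 < σ := hε.1.trans hσ.1
      have hσC : (σ : ℂ) ≠ 0 := by exact_mod_cast hσ0.ne'
      have a1 : HasDerivAt (fun σ : ℝ => (σ : ℂ) ^ 2 / 2) (σ : ℂ) σ := by
        refine (((hasDerivAt_coe σ).fun_pow 2).div_const 2).congr_deriv ?_
        simp
      have a2 := H.hasDerivAt_s (r, σ) ⟨hrρ, hσ0, hσ.2⟩
      have a3 : HasDerivAt (fun σ : ℝ => σ ^ 2 * r) (2 * σ * r) σ := by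
        simpa using (hasDerivAt_pow 2 σ).mul_const r
      have hm : σ ^ 2 * r ∈ Ioo 0 R := by
        refine ⟨by have := hr.1; positivity, lt_of_le_of_lt ?_ hr.2⟩
        exact mul_le_of_le_one_left hr.1.le (sq_mem_unit ⟨hσ0.le, hσ.2.le⟩).2
      have a4 := HasDerivAt.scomp (h := fun σ : ℝ => σ ^ 2 * r) σ (hd _ hm) a3
      refine ((a1.mul a2).mul a4).congr_deriv ?_
      simp only [hW', Complex.real_smul, Function.comp, Pi.mul_apply]
      push_cast
      field_simp
    have hWi : IntervalIntegrable W' volume ε 1 := by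
      refine ContinuousOn.intervalIntegrable ?_
      rw [uIcc_of_le hε.2.le]
      have hD := (hsl c₂).sub (hsl c₁)
      exact (((ContinuousOn.mul (by fun_prop) hD).mul hφs).add
        ((ContinuousOn.mul (by fun_prop) (hsl cd)).mul hφs)).add
        ((ContinuousOn.mul (by fun_prop) hD).mul hψs)
    have hftc := intervalIntegral.integral_eq_sub_of_hasDerivAt_of_le hε.2.le hWc hWd hWi
    have i₁ := intervalIntegrable_cut hR H.cont₁ hφ hε' h1' (Ioo_subset_Icc_self hr)
    have i₂ := intervalIntegrable_cut hR H.cont₂ hψ hε' h1' (Ioo_subset_Icc_self hr)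
    have hpt : ∫ σ in ε..1, ((σ : ℂ) * gr (r, σ) * φ (σ ^ 2 * r) +
        (σ : ℂ) * g₁ (r, σ) * ψ (σ ^ 2 * r) / r) =
        ∫ σ in ε..1, (h r * ((σ : ℂ) * g₁ (r, σ) * φ (σ ^ 2 * r)) +
          (r : ℂ)⁻¹ * ((σ : ℂ) * g₂ (r, σ) * ψ (σ ^ 2 * r)) - (r : ℂ)⁻¹ * W' σ) := by
      refine intervalIntegral.integral_congr_ae ?_
      have : ∀ᵐ t : ℝ, t ≠ 1 := by simp [ae_iff, measure_singleton]
      filter_upwards [this] with σ hσ1 hσ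
      rw [uIoc_of_le hε.2.le] at hσ
      have hrel := H.rel (r, σ) ⟨hrρ, hε.1.trans hσ.1, lt_of_le_of_ne hσ.2 hσ1⟩
      simp only at hrel
      simp only [hW']
      field_simp
      linear_combination 2 * σ * φ (σ ^ 2 * r) * hrel
    rw [hpt, intervalIntegral.integral_sub ((i₁.const_mul _).add (i₂.const_mul _)) (hWi.const_mul _),
      intervalIntegral.integral_add (i₁.const_mul _) (i₂.const_mul _),
      intervalIntegral.integral_const_mul, intervalIntegral.integral_const_mul,
      intervalIntegral.integral_const_mul, hftc]
    simp only [hW, cutT]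
    have hin := H.initial r (Ioo_subset_Icc_self hrρ)
    simp only [Complex.ofReal_one, one_pow, one_mul, hin]
    generalize (∫ σ in ε..1, (σ : ℂ) * g₁ (r, σ) * φ (σ ^ 2 * r)) = I₁
    generalize (∫ σ in ε..1, (σ : ℂ) * g₂ (r, σ) * ψ (σ ^ 2 * r)) = I₂
    generalize φ (ε ^ 2 * r) = c
    field_simp
    ring
  · refine ContinuousOn.add (hmono e₃) ?_
    exact (hmono e₂).div (by fun_prop) fun p hp => by exact_mod_cast hp.1.1.ne'
  · intro s hs σ hσ
    have hσ0 : 0 < σ := hε.1.trans hσ.1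
    have hs0 : 0 < s := hs.1
    have hm : σ ^ 2 * s ∈ Ioo 0 R := by
      refine ⟨by positivity, lt_of_le_of_lt ?_ hs.2⟩
      exact mul_le_of_le_one_left hs.1.le (sq_mem_unit ⟨hσ0.le, hσ.2.le⟩).2
    have a1 := H.hasDerivAt_r (s, σ) ⟨⟨hs.1, hs.2.trans_le hR⟩, hσ0, hσ.2⟩
    have a2 : HasDerivAt (fun s : ℝ => σ ^ 2 * s) (σ ^ 2) s := by
      simpa using (hasDerivAt_id s).const_mul (σ ^ 2)
    have a3 := HasDerivAt.scomp (h := fun s : ℝ => σ ^ 2 * s) s (hd _ hm) a2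
    refine ((a1.const_mul (σ : ℂ)).mul a3).congr_deriv ?_
    have hσC : (σ : ℂ) ≠ 0 := by exact_mod_cast hσ0.ne'
    have hsC : (s : ℂ) ≠ 0 := by exact_mod_cast hs0.ne'
    simp only [Complex.real_smul, Function.comp]
    push_cast
    field_simp

/-- As ε → 0 the derivatives converge uniformly at rate ε, using only bounds for the kernels
themselves, so nothing is required of their derivatives at σ = 0. -/
theorem IsIntertwined.hasDerivAt_add_cutT (H : IsIntertwined ρ h g₁ g₂ gr ds) (hR : R ≤ ρ)
    (hφ : ContinuousOn φ (Icc 0 R)) (hψ : ContinuousOn ψ (Icc 0 R))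
    (hd : ∀ r ∈ Ioo 0 R, HasDerivAt φ (ψ r / r) r) {r : ℝ} (hr : r ∈ Ioo 0 R) :
    HasDerivAt (fun r => φ r + cutT g₁ φ 0 r)
      (h r * (φ r + cutT g₁ φ 0 r) + (ψ r + cutT g₂ ψ 0 r) / r) r := by
  have hK : IsCompact (Icc 0 ρ ×ˢ Icc (0 : ℝ) 1) := isCompact_Icc.prod isCompact_Icc
  obtain ⟨M₁, hM₁⟩ := hK.exists_bound_of_continuousOn H.cont₁
  obtain ⟨M₂, hM₂⟩ := hK.exists_bound_of_continuousOn H.cont₂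
  obtain ⟨N, hN⟩ := isCompact_Icc.exists_bound_of_continuousOn hφ
  obtain ⟨N', hN'⟩ := isCompact_Icc.exists_bound_of_continuousOn hψ
  obtain ⟨B, hB⟩ := isCompact_Icc.exists_bound_of_continuousOn H.cont_h
  have hr0 : 0 < r := hr.1
  -- Staying above r/2 keeps the divisions by the radius uniform.
  set a : ℝ := r / 2 with ha
  have ha0 : 0 < a := by positivity
  have hs : ∀ x ∈ Ioo a R, x ∈ Ioo 0 R := fun x hx => ⟨ha0.trans hx.1, hx.2⟩
  have hev : ∀ᶠ ε : ℝ in 𝓝[>] 0, ε ∈ Ioo (0 : ℝ) 1 := Ioo_mem_nhdsGT zero_lt_one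
  have hlim : ∀ C : ℝ, Tendsto (fun ε : ℝ => C * ε) (𝓝[>] 0) (𝓝 0) := fun C => by
    have : Tendsto (fun ε : ℝ => C * ε) (𝓝 0) (𝓝 (C * 0)) := tendsto_id.const_mul C
    rw [mul_zero] at this
    exact this.mono_left nhdsWithin_le_nhds
  set g' : ℝ → ℂ := fun r => h r * (φ r + cutT g₁ φ 0 r) + (ψ r + cutT g₂ ψ 0 r) / r with hg'
  set f' : ℝ → ℝ → ℂ := fun ε r => ψ r / r + (h r * cutT g₁ φ ε r + h r * φ r +
    cutT g₂ ψ ε r / r + ε ^ 2 * (g₂ (r, ε) - g₁ (r, ε)) * φ (ε ^ 2 * r) / (2 * r)) with hf'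
  refine hasDerivAt_of_tendstoUniformlyOn (l := 𝓝[>] (0 : ℝ)) (s := Ioo a R) isOpen_Ioo
    (f := fun ε r => φ r + cutT g₁ φ ε r) (f' := f') (g' := g') ?_ ?_ ?_ ⟨by linarith, hr.2⟩
  · rw [Metric.tendstoUniformlyOn_iff]
    intro δ hδ
    filter_upwards [hev, (hlim (B * (M₁ * N) + M₂ * N' / a + (M₂ + M₁) * N / (2 * a))).eventually
      (gt_mem_nhds hδ)] with ε hε hlt x hx
    have hε' : ε ∈ Icc (0 : ℝ) 1 := Ioo_subset_Icc_self hε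
    have hxR := hs x hx
    have hxI : x ∈ Icc 0 R := Ioo_subset_Icc_self hxR
    have hxρ : x ∈ Icc 0 ρ := ⟨hxI.1, hxI.2.trans hR⟩
    have hx0 : 0 < x := hxR.1
    have hxC : (x : ℂ) ≠ 0 := by exact_mod_cast hx0.ne'
    have b1 := norm_cutT_sub_le hR H.cont₁ hφ hM₁ hN hε' hxI
    have b2 := norm_cutT_sub_le hR H.cont₂ hψ hM₂ hN' hε' hxI
    have b3 := hM₁ (x, ε) ⟨hxρ, hε'⟩
    have b4 := hM₂ (x, ε) ⟨hxρ, hε'⟩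
    have b5 := hN _ (sq_mul_mem_Icc hxI hε')
    have b6 := hB x hxρ
    have hM₁0 := (norm_nonneg _).trans b3
    have hM₂0 := (norm_nonneg _).trans b4
    have hN0 := (norm_nonneg _).trans b5
    have hB0 := (norm_nonneg _).trans b6
    have hN'0 := (norm_nonneg _).trans (hN' x hxI)
    refine lt_of_le_of_lt ?_ hlt
    have heq : g' x - f' ε x = h x * (cutT g₁ φ 0 x - cutT g₁ φ ε x) +
        (cutT g₂ ψ 0 x - cutT g₂ ψ ε x) / x -
        ε ^ 2 * (g₂ (x, ε) - g₁ (x, ε)) * φ (ε ^ 2 * x) / (2 * x) := by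
      simp only [hg', hf']
      generalize φ (ε ^ 2 * x) = c
      field_simp
      ring
    rw [dist_eq_norm, heq]
    refine (norm_sub_le _ _).trans ((add_le_add_left (norm_add_le _ _) _).trans ?_)
    have t1 : ‖h x * (cutT g₁ φ 0 x - cutT g₁ φ ε x)‖ ≤ B * (M₁ * N * ε) := by
      rw [norm_mul]
      gcongr
    have t2 : ‖(cutT g₂ ψ 0 x - cutT g₂ ψ ε x) / x‖ ≤ M₂ * N' * ε / a := by
      rw [norm_div, Complex.norm_real, Real.norm_of_nonneg hx0.le]
      have := hε.1.le
      gcongr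
      exact hx.1.le
    have t3 : ‖(ε : ℂ) ^ 2 * (g₂ (x, ε) - g₁ (x, ε)) * φ (ε ^ 2 * x) / (2 * x)‖ ≤
        ε * (M₂ + M₁) * N / (2 * a) := by
      rw [norm_div, norm_mul, norm_mul, norm_mul, norm_pow, Complex.norm_real, Complex.norm_real,
        Real.norm_of_nonneg hx0.le, Real.norm_of_nonneg hε.1.le, Complex.norm_ofNat]
      have h1 : ε ^ 2 ≤ ε := by nlinarith [hε.1, hε.2]
      have h2 : ‖g₂ (x, ε) - g₁ (x, ε)‖ ≤ M₂ + M₁ := (norm_sub_le _ _).trans (add_le_add b4 b3)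
      have := hε.1.le
      gcongr
      exact hx.1.le
    calc _ ≤ B * (M₁ * N * ε) + M₂ * N' * ε / a + ε * (M₂ + M₁) * N / (2 * a) :=
          add_le_add (add_le_add t1 t2) t3
      _ = _ := by ring
  · filter_upwards [hev] with ε hε x hx
    exact (hd x (hs x hx)).add (H.hasDerivAt_cutT hR hφ hψ hd hε (hs x hx))
  · intro x hx
    have hxI : x ∈ Icc 0 R := Ioo_subset_Icc_self (hs x hx)
    refine Tendsto.const_add _ ?_
    rw [tendsto_iff_norm_sub_tendsto_zero]
    refine squeeze_zero' (Eventually.of_forall fun _ => norm_nonneg _) ?_ (hlim (M₁ * N))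
    filter_upwards [hev] with ε hε
    rw [norm_sub_rev]
    exact norm_cutT_sub_le hR H.cont₁ hφ hM₁ hN (Ioo_subset_Icc_self hε) hxI

end Ray

section Transmutation

variable {ρ : ℝ} {q h : ℝ → ℂ} {g₁ g₁r g₁s g₁rr g₁rs g₂ g₂r g₂s g₂rr g₂rs : ℝ × ℝ → ℂ}

/-- The relation is (rX - Y)/2 = 0. -/
theorem IsPolarKernel.isIntertwined (hh : IsLogDeriv ρ q h)
    (h₁ : IsPolarKernel ρ q g₁ g₁r g₁s g₁rr g₁rs)
    (h₂ : IsPolarKernel ρ (fun r => 2 * h r ^ 2 - q r) g₂ g₂r g₂s g₂rr g₂rs) :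
    IsIntertwined ρ h g₁ g₂ g₁r (fun x => g₂s x - g₁s x) where
  cont_h := hh.cont
  cont₁ := h₁.cont
  cont₂ := h₂.cont
  cont_r := h₁.cont_r
  cont_ds := h₂.cont_s.sub h₁.cont_s
  hasDerivAt_r x hx := h₁.hasDerivAt_fst hx
  hasDerivAt_s x hx := (h₂.hasDerivAt_snd hx).sub (h₁.hasDerivAt_snd hx)
  rel x hx := by
    obtain ⟨hX, hY⟩ := defects_eq_zero hh h₁ h₂ hx
    simp only [defectX, defectY] at hX hY
    linear_combination (x.1 / 2 : ℂ) * hX - hY / 2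
  initial r hr := IsPolarKernel.diff_initial hh h₁ h₂ hr

/-- Passing from f to 1/f changes h to -h and exchanges the kernels; the relation is now (rX + Y)/2
= 0. -/
theorem IsPolarKernel.isIntertwined_symm (hh : IsLogDeriv ρ q h)
    (h₁ : IsPolarKernel ρ q g₁ g₁r g₁s g₁rr g₁rs)
    (h₂ : IsPolarKernel ρ (fun r => 2 * h r ^ 2 - q r) g₂ g₂r g₂s g₂rr g₂rs) :
    IsIntertwined ρ (fun r => -h r) g₂ g₁ g₂r (fun x => g₁s x - g₂s x) where
  cont_h := hh.cont.neg
  cont₁ := h₂.cont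
  cont₂ := h₁.cont
  cont_r := h₂.cont_r
  cont_ds := h₁.cont_s.sub h₂.cont_s
  hasDerivAt_r x hx := h₂.hasDerivAt_fst hx
  hasDerivAt_s x hx := (h₁.hasDerivAt_snd hx).sub (h₂.hasDerivAt_snd hx)
  rel x hx := by
    obtain ⟨hX, hY⟩ := defects_eq_zero hh h₁ h₂ hx
    simp only [defectX, defectY] at hX hY
    linear_combination (x.1 / 2 : ℂ) * hX + hY / 2
  initial r hr := by
    linear_combination -IsPolarKernel.diff_initial hh h₁ h₂ hr

/-- The operator `T₁` with kernel `G₁` intertwines `r d/dr - r h` with `r d/dr` and `T₂`. -/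
structure RayIntertwines (ρ : ℝ) (h : ℝ → ℂ) (G₁ G₂ : ℝ → ℝ → ℂ) : Prop where
  hasDerivAt : ∀ {R : ℝ} {φ ψ : ℝ → ℂ}, R ≤ ρ → ContinuousOn φ (Icc 0 R) →
    ContinuousOn ψ (Icc 0 R) → (∀ r ∈ Ioo 0 R, HasDerivAt φ (ψ r / r) r) → ∀ r ∈ Ioo 0 R,
    HasDerivAt (rayT G₁ φ) (h r * rayT G₁ φ r + rayT G₂ ψ r / r) r

theorem rayIntertwines (hρ : 0 < ρ) (hh : IsLogDeriv ρ q h) {G₁ G₂ : ℝ → ℝ → ℂ}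
    (h₁ : IsTransmutationKernel ρ q G₁)
    (h₂ : IsTransmutationKernel ρ (fun r => 2 * h r ^ 2 - q r) G₂) :
    RayIntertwines ρ h G₁ G₂ ∧ RayIntertwines ρ (fun r => -h r) G₂ G₁ := by
  obtain ⟨_, _, _, _, k₁⟩ := h₁.exists_isPolarKernel hρ hh.cont_pot
  obtain ⟨_, _, _, _, k₂⟩ := h₂.exists_isPolarKernel hρ
    ((continuousOn_const.mul (hh.cont.pow 2)).sub hh.cont_pot)
  exact ⟨⟨fun hR hφ hψ hd r hr =>
    (IsPolarKernel.isIntertwined hh k₁ k₂).hasDerivAt_add_cutT hR hφ hψ hd hr⟩,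
    ⟨fun hR hφ hψ hd r hr =>
    (IsPolarKernel.isIntertwined_symm hh k₁ k₂).hasDerivAt_add_cutT hR hφ hψ hd hr⟩⟩

end Transmutation

/-! ### The logarithmic derivative of f. -/

section LogDeriv

variable {ρ : ℝ} {q f : ℝ → ℂ}

/-- Divided by f, the equation of f is the Riccati equation. Written as f' = r(qf - f''), it extends
by continuity to the closed interval and shows h = O(r), in particular f'(0) = 0. -/
theorem isLogDeriv_derivWithin_div (hρ : 0 < ρ) (hq : ContDiffOn ℝ 1 q (Icc 0 ρ))
    (hf : ContDiffOn ℝ 2 f (Icc 0 ρ)) (hne : ∀ r ∈ Icc 0 ρ, f r ≠ 0)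
    (hode : ∀ r ∈ Ioo 0 ρ, deriv (deriv f) r + 1 / (r : ℂ) * deriv f r - q r * f r = 0) :
    IsLogDeriv ρ q (fun r => derivWithin f (Icc 0 ρ) r / f r) := by
  set F : ℝ → ℂ := derivWithin f (Icc 0 ρ) with hF
  set F₂ : ℝ → ℂ := derivWithin F (Icc 0 ρ) with hF₂
  have hu : UniqueDiffOn ℝ (Icc 0 ρ) := uniqueDiffOn_Icc hρ
  have hF1 : ContDiffOn ℝ 1 F (Icc 0 ρ) := hf.derivWithin hu (by norm_num)
  have hF2c : ContinuousOn F₂ (Icc 0 ρ) := hF1.continuousOn_derivWithin hu le_rfl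
  have hfd : ∀ r ∈ Ioo 0 ρ, HasDerivAt f (F r) r := fun r hr =>
    hasDerivAt_of_contDiffOn_Icc (hf.of_le (by norm_num)) hr
  have hFd : ∀ r ∈ Ioo 0 ρ, HasDerivAt F (F₂ r) r := fun r hr =>
    hasDerivAt_of_contDiffOn_Icc hF1 hr
  have hode' : ∀ r ∈ Ioo 0 ρ, F₂ r + F r / r = q r * f r := by
    intro r hr
    have h1 := hode r hr
    have h2 : deriv f =ᶠ[𝓝 r] F := by
      filter_upwards [isOpen_Ioo.mem_nhds hr] with s hs using (hfd s hs).deriv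
    rw [h2.deriv_eq, h2.self_of_nhds, (hFd r hr).deriv] at h1
    linear_combination h1
  have hFr : EqOn F (fun r => (r : ℂ) * (q r * f r - F₂ r)) (Icc 0 ρ) := by
    refine EqOn.of_subset_closure (s := Ioo 0 ρ) ?_ hF1.continuousOn ?_ Ioo_subset_Icc_self ?_
    · intro r hr
      have hrC : (r : ℂ) ≠ 0 := by exact_mod_cast hr.1.ne'
      have := hode' r hr
      field_simp at this
      simp only
      linear_combination this
    · exact ContinuousOn.mul (by fun_prop) ((hq.continuousOn.mul hf.continuousOn).sub hF2c)
    · rw [closure_Ioo hρ.ne]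
  refine ⟨hq.continuousOn, hF1.continuousOn.div hf.continuousOn hne, ?_, ?_⟩
  · intro r hr
    have hrC : (r : ℂ) ≠ 0 := by exact_mod_cast hr.1.ne'
    have hn := hne r (Ioo_subset_Icc_self hr)
    refine ((hFd r hr).div (hfd r hr) hn).congr_deriv ?_
    have := hode' r hr
    field_simp at this ⊢
    linear_combination f r * this
  · have hc : ContinuousOn (fun r => (q r * f r - F₂ r) / f r) (Icc 0 ρ) :=
      ((hq.continuousOn.mul hf.continuousOn).sub hF2c).div hf.continuousOn hne
    obtain ⟨C, hC⟩ := isCompact_Icc.exists_bound_of_continuousOn hc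
    refine ⟨C, (norm_nonneg _).trans (hC 0 ⟨le_rfl, hρ.le⟩), fun r hr => ?_⟩
    rw [hFr hr, mul_div_assoc, norm_mul, Complex.norm_real, Real.norm_of_nonneg hr.1, mul_comm]
    exact mul_le_mul_of_nonneg_right (hC r hr) hr.1

theorem contDiffOn_darbouxPotential (hρ : 0 < ρ) (hq : ContDiffOn ℝ 1 q (Icc 0 ρ))
    (hf : ContDiffOn ℝ 2 f (Icc 0 ρ)) (hne : ∀ r ∈ Icc 0 ρ, f r ≠ 0) :
    ContDiffOn ℝ 1 (darbouxPotential ρ f q) (Icc 0 ρ) := by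
  have hF1 : ContDiffOn ℝ 1 (derivWithin f (Icc 0 ρ)) (Icc 0 ρ) :=
    hf.derivWithin (uniqueDiffOn_Icc hρ) (by norm_num)
  have hf1 : ContDiffOn ℝ 1 f (Icc 0 ρ) := hf.of_le (by norm_num)
  have := (contDiffOn_const (c := (2 : ℂ))).mul ((hF1.mul (hf1.inv hne)).pow 2) |>.sub hq
  refine this.congr fun r _ => ?_
  simp [darbouxPotential, div_eq_mul_inv]

end LogDeriv

/-! ### Radial functions and the polar form of the Vekua equation. -/

section Radial

variable {ρ : ℝ} {f : ℝ → ℂ}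

/-- The real-linear form `e ↦ c ⟪z, e⟫`. -/
def radialForm (c z : ℂ) : ℂ →L[ℝ] ℂ := (innerSL ℝ z).smulRight c

theorem radialForm_one (c z : ℂ) : radialForm c z 1 = z.re * c := by
  simp [radialForm, Complex.inner, Complex.real_smul]

theorem radialForm_I (c z : ℂ) : radialForm c z Complex.I = z.im * c := by
  simp [radialForm, Complex.inner, Complex.real_smul]

theorem hasFDerivAt_radial {z : ℂ} (hz : z ≠ 0) {a : ℂ} (hf : HasDerivAt f a ‖z‖) :
    HasFDerivAt (fun ζ : ℂ => f ‖ζ‖) (radialForm (a / ‖z‖) z) z := by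
  have hn : ‖z‖ ≠ 0 := norm_ne_zero_iff.2 hz
  have h1 : HasFDerivAt (fun ζ : ℂ => ‖ζ‖ ^ 2) (2 • innerSL ℝ z) z :=
    (hasStrictFDerivAt_norm_sq z).hasFDerivAt
  have h2 := (h1.sqrt (pow_ne_zero 2 hn))
  simp only [Real.sqrt_sq (norm_nonneg _)] at h2
  refine (hf.hasFDerivAt.comp z h2).congr_fderiv ?_
  ext e
  simp [radialForm, Complex.real_smul]
  field_simp

theorem hasFDerivAt_radial_zero (hρ : 0 < ρ) (hf : HasDerivWithinAt f 0 (Icc 0 ρ) 0) :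
    HasFDerivAt (fun ζ : ℂ => f ‖ζ‖) (0 : ℂ →L[ℝ] ℂ) 0 := by
  have h1 : Tendsto (fun ζ : ℂ => ‖ζ‖) (𝓝 0) (𝓝[Icc 0 ρ] 0) := by
    refine tendsto_nhdsWithin_iff.2 ⟨tendsto_norm_zero, ?_⟩
    filter_upwards [Metric.ball_mem_nhds (0 : ℂ) hρ] with ζ hζ
    exact ⟨norm_nonneg _, (mem_ball_zero_iff.1 hζ).le⟩
  rw [hasDerivWithinAt_iff_isLittleO] at hf
  rw [hasFDerivAt_iff_isLittleO]
  rw [← Asymptotics.isLittleO_norm_right]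
  simpa [Function.comp_def] using hf.comp_tendsto h1

end Radial

section Polar

variable {Ω : Set ℂ} {U V : ℂ → ℂ} {η : ℂ → ℂ}

/-- Polar form of a Vekua equation with radial coefficient: `m` is `r f'(r) / f(r)`. -/
structure IsPolarSol (Ω : Set ℂ) (m : ℂ → ℂ) (U V : ℂ → ℂ) : Prop where
  contDiffOn₁ : ContDiffOn ℝ 1 U Ω
  contDiffOn₂ : ContDiffOn ℝ 1 V Ω
  eq₁ : ∀ z ∈ Ω, fderiv ℝ U z z - fderiv ℝ V z (Complex.I * z) = m z * U z
  eq₂ : ∀ z ∈ Ω, fderiv ℝ V z z + fderiv ℝ U z (Complex.I * z) = -(m z * V z)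
  origin : ∀ e, fderiv ℝ V 0 (Complex.I * e) = fderiv ℝ U 0 e

theorem clm_apply_eq (A : ℂ →L[ℝ] ℂ) (e : ℂ) : A e = e.re * A 1 + e.im * A Complex.I := by
  conv_lhs => rw [show e = e.re • (1 : ℂ) + e.im • Complex.I by
    simp [Complex.real_smul, Complex.re_add_im]]
  rw [map_add, map_smul, map_smul, Complex.real_smul, Complex.real_smul]

theorem dbar_eq_iff {W : ℂ → Bicomplex} {f : ℝ → ℂ} {z c : ℂ} (hf : f ‖z‖ ≠ 0)
    (hfd : HasFDerivAt (fun ζ : ℂ => f ‖ζ‖) (radialForm (f ‖z‖ * c) z) z) :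
    dbar W z = ((f ‖z‖)⁻¹ • dbar (radial f) z) * star (W z) ↔
      fderiv ℝ (fun ζ => (W ζ).re) z 1 - fderiv ℝ (fun ζ => (W ζ).im) z Complex.I =
        c * (z.re * (W z).re + z.im * (W z).im) ∧
      fderiv ℝ (fun ζ => (W ζ).im) z 1 + fderiv ℝ (fun ζ => (W ζ).re) z Complex.I =
        c * (z.im * (W z).re - z.re * (W z).im) := by
  have h1 : (fun ζ => (radial f ζ).re) = fun ζ : ℂ => f ‖ζ‖ := by
    ext ζ; simp [radial]
  have h2 : (fun ζ => (radial f ζ).im) = fun ζ : ℂ => (0 : ℂ) := by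
    ext ζ; simp [radial]
  have h3 : fderiv ℝ (fun ζ : ℂ => (0 : ℂ)) z = 0 := by simp
  rw [QuadraticAlgebra.ext_iff]
  simp only [dbar, dirDeriv, h1, h2, h3, hfd.fderiv, radialForm_one, radialForm_I, j]
  simp
  constructor
  · rintro ⟨e1, e2⟩
    field_simp at e1 e2
    constructor
    · linear_combination e1
    · linear_combination e2
  · rintro ⟨e1, e2⟩
    field_simp
    constructor
    · linear_combination e1
    · linear_combination e2

/-- The two systems differ by the real matrix with rows (x, y) and (-y, x), of determinant |z|²,
which is invertible off the origin. -/
theorem polar_iff {A B : ℂ →L[ℝ] ℂ} {z c a b : ℂ} (hz : z ≠ 0) :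
    (A 1 - B Complex.I = c * (z.re * a + z.im * b) ∧
      B 1 + A Complex.I = c * (z.im * a - z.re * b)) ↔
    (A z - B (Complex.I * z) = (‖z‖ : ℂ) ^ 2 * c * a ∧
      B z + A (Complex.I * z) = -((‖z‖ : ℂ) ^ 2 * c * b)) := by
  have hn : (‖z‖ : ℂ) ^ 2 = z.re ^ 2 + z.im ^ 2 := by
    have : ‖z‖ ^ 2 = z.re ^ 2 + z.im ^ 2 := by
      rw [Complex.sq_norm, Complex.normSq_apply]; ring
    exact_mod_cast this
  have hn0 : (z.re : ℂ) ^ 2 + (z.im : ℂ) ^ 2 ≠ 0 := by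
    rw [← hn]; simpa using hz
  rw [clm_apply_eq A z, clm_apply_eq B z, clm_apply_eq A (Complex.I * z),
    clm_apply_eq B (Complex.I * z), hn]
  simp only [Complex.mul_re, Complex.mul_im, Complex.I_re, Complex.I_im, zero_mul, one_mul, zero_sub,
    zero_add, Complex.ofReal_neg]
  constructor
  · rintro ⟨e1, e2⟩
    constructor
    · linear_combination (z.re : ℂ) * e1 + (z.im : ℂ) * e2
    · linear_combination (z.re : ℂ) * e2 - (z.im : ℂ) * e1
  · rintro ⟨e1, e2⟩
    constructor <;> refine mul_left_cancel₀ hn0 ?_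
    · linear_combination (z.re : ℂ) * e1 - (z.im : ℂ) * e2
    · linear_combination (z.re : ℂ) * e2 + (z.im : ℂ) * e1

/-- At z = 0 the polar equations read 0 = 0, so the Cauchy-Riemann equations there, to which the
Vekua equation reduces, are kept separately in the field `origin`. -/
theorem mem_vekuaSol_iff {f : ℝ → ℂ} (h0 : (0 : ℂ) ∈ Ω) (hf : ∀ z ∈ Ω, f ‖z‖ ≠ 0)
    (hfd : ∀ z ∈ Ω, HasFDerivAt (fun ζ : ℂ => f ‖ζ‖) (radialForm (f ‖z‖ * η z) z) z)
    {W : ℂ → Bicomplex} : W ∈ VekuaSol Ω f ↔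
      IsPolarSol Ω (fun z => (‖z‖ : ℂ) ^ 2 * η z) (fun z => (W z).re) (fun z => (W z).im) := by
  constructor
  · rintro ⟨⟨c1, c2⟩, hW⟩
    have hW' := fun z hz => (dbar_eq_iff (hf z hz) (hfd z hz)).1 (hW z hz)
    refine ⟨c1, c2, fun z hz => ?_, fun z hz => ?_, fun e => ?_⟩
    · rcases eq_or_ne z 0 with rfl | hz0
      · simp
      · exact ((polar_iff hz0).1 (hW' z hz)).1
    · rcases eq_or_ne z 0 with rfl | hz0
      · simp
      · exact ((polar_iff hz0).1 (hW' z hz)).2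
    · obtain ⟨e1, e2⟩ := hW' 0 h0
      rw [clm_apply_eq _ (Complex.I * e), clm_apply_eq _ e]
      simp only [Complex.mul_re, Complex.mul_im, Complex.I_re, Complex.I_im, zero_mul, one_mul,
        zero_sub, zero_add, Complex.ofReal_neg]
      simp only [Complex.zero_re, Complex.zero_im, Complex.ofReal_zero, zero_mul, add_zero, mul_zero,
        sub_zero] at e1 e2
      linear_combination -(e.re : ℂ) * e1 - (e.im : ℂ) * e2
  · intro hW
    refine ⟨⟨hW.contDiffOn₁, hW.contDiffOn₂⟩, fun z hz => ?_⟩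
    refine (dbar_eq_iff (hf z hz) (hfd z hz)).2 ?_
    rcases eq_or_ne z 0 with rfl | hz0
    · have o1 := hW.origin 1
      have o2 := hW.origin Complex.I
      rw [mul_one] at o1
      rw [Complex.I_mul_I, map_neg] at o2
      simp only [Complex.zero_re, Complex.zero_im, Complex.ofReal_zero, zero_mul, add_zero, mul_zero,
        sub_zero]
      exact ⟨by rw [o1, sub_self], by rw [← o2, add_neg_cancel]⟩
    · exact (polar_iff hz0).2 ⟨hW.eq₁ z hz, hW.eq₂ z hz⟩

theorem hol_eq_vekuaSol : Hol Ω = VekuaSol Ω fun _ => 1 := by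
  have h1 : (fun ζ => (radial (fun _ => 1) ζ).re) = fun _ : ℂ => (1 : ℂ) := by
    ext ζ; simp [radial, QuadraticAlgebra.re_one]
  have h2 : (fun ζ => (radial (fun _ => 1) ζ).im) = fun _ : ℂ => (0 : ℂ) := by
    ext ζ; simp [radial, QuadraticAlgebra.im_one]
  have h3 : ∀ z, dbar (radial fun _ => 1) z = 0 := fun z => by
    rw [QuadraticAlgebra.ext_iff]
    simp [dbar, dirDeriv, h1, h2]
  simp [Hol, VekuaSol, h3]

theorem mem_hol_iff (h0 : (0 : ℂ) ∈ Ω) {W : ℂ → Bicomplex} : W ∈ Hol Ω ↔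
    IsPolarSol Ω (fun _ => 0) (fun z => (W z).re) (fun z => (W z).im) := by
  rw [hol_eq_vekuaSol, mem_vekuaSol_iff (η := fun _ => 0) h0 (fun _ _ => one_ne_zero)]
  · simp
  · intro z _
    have : radialForm (1 * 0) z = 0 := by ext; simp [radialForm]
    rw [this]
    exact hasFDerivAt_const 1 z

end Polar

/-! ### T in a star-shaped domain: rays, circles and the origin. -/

section Rays

variable {Ω : Set ℂ} {ρ : ℝ} {G : ℝ → ℝ → ℂ}

theorem norm_div_norm_self {z : ℂ} (hz : z ≠ 0) : ‖z / (‖z‖ : ℂ)‖ = 1 := by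
  simp [hz]

theorem norm_mul_div_norm_self {z : ℂ} (hz : z ≠ 0) : (‖z‖ : ℂ) * (z / (‖z‖ : ℂ)) = z :=
  mul_div_cancel₀ z (by simpa using hz)

theorem exists_radius_gt (ho : IsOpen Ω) (hs : StarConvex ℝ (0 : ℂ) Ω) (hρ : ∀ z ∈ Ω, ‖z‖ ≤ ρ)
    {z : ℂ} (hz : z ∈ Ω) (hz0 : z ≠ 0) :
    ∃ R, ‖z‖ < R ∧ R ≤ ρ ∧ ∀ s ∈ Icc 0 R, (s : ℂ) * (z / (‖z‖ : ℂ)) ∈ Ω := by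
  have hc : ContinuousAt (fun s : ℝ => (s : ℂ) * (z / (‖z‖ : ℂ))) ‖z‖ := by fun_prop
  have hev : ∀ᶠ s : ℝ in 𝓝 ‖z‖, (s : ℂ) * (z / (‖z‖ : ℂ)) ∈ Ω := by
    refine hc.eventually_mem (ho.mem_nhds ?_)
    rwa [norm_mul_div_norm_self hz0]
  obtain ⟨R, hRΩ, hR⟩ := ((hev.filter_mono nhdsWithin_le_nhds).and
    (self_mem_nhdsWithin (s := Ioi ‖z‖))).exists
  have hR0 : 0 < R := (norm_nonneg z).trans_lt hR
  refine ⟨R, hR, ?_, fun s hs' => ?_⟩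
  · have := hρ _ hRΩ
    rwa [norm_mul, norm_div_norm_self hz0, mul_one, Complex.norm_real,
      Real.norm_of_nonneg hR0.le] at this
  · have := ofReal_mul_mem hs hRΩ (t := s / R) ⟨div_nonneg hs'.1 hR0.le, div_le_one_of_le₀ hs'.2 hR0.le⟩
    rwa [← mul_assoc, ← Complex.ofReal_mul, div_mul_cancel₀ _ hR0.ne'] at this

theorem exists_angle (ho : IsOpen Ω) {z : ℂ} (hz : z ∈ Ω) :
    ∃ δ : ℝ, 0 < δ ∧ ∀ t ∈ Ioo (-δ) δ, Complex.exp (t * Complex.I) * z ∈ Ω := by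
  have hc : ContinuousAt (fun t : ℝ => Complex.exp (t * Complex.I) * z) 0 := by fun_prop
  obtain ⟨δ, hδ, h⟩ := Metric.eventually_nhds_iff.1
    (hc.eventually_mem (ho.mem_nhds (by simpa using hz)))
  exact ⟨δ, hδ, fun t ht => h (by simpa [abs_lt] using ht)⟩

theorem norm_exp_mul_I_mul (t : ℝ) (z : ℂ) : ‖Complex.exp (t * Complex.I) * z‖ = ‖z‖ := by
  rw [norm_mul, Complex.norm_exp_ofReal_mul_I, one_mul]

theorem continuousOn_ray {u : ℂ → ℂ} (hu : ContinuousOn u Ω) {e : ℂ} {R : ℝ}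
    (he : ∀ s ∈ Icc 0 R, (s : ℂ) * e ∈ Ω) : ContinuousOn (fun s : ℝ => u (s * e)) (Icc 0 R) :=
  hu.comp (by fun_prop) he

theorem rayT_sub (hG : IsVolterraKernel ρ G) {R r : ℝ} (hR : R ≤ ρ) {φ ψ : ℝ → ℂ}
    (hφ : ContinuousOn φ (Icc 0 R)) (hψ : ContinuousOn ψ (Icc 0 R)) (hr : r ∈ Icc 0 R) :
    rayT G (fun s => φ s - ψ s) r = rayT G φ r - rayT G ψ r := by
  have h0 : (0 : ℝ) ∈ Icc (0 : ℝ) 1 := ⟨le_rfl, zero_le_one⟩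
  have h1 : (1 : ℝ) ∈ Icc (0 : ℝ) 1 := ⟨zero_le_one, le_rfl⟩
  have := intervalIntegral.integral_sub
    (intervalIntegrable_cut hR hG.continuousOn_sq hφ h0 h1 hr)
    (intervalIntegrable_cut hR hG.continuousOn_sq hψ h0 h1 hr)
  simp only [rayT, mul_sub]
  rw [this]
  ring

theorem continuousOn_rayT (hG : IsVolterraKernel ρ G) {R : ℝ} (hR : R ≤ ρ) {φ : ℝ → ℂ}
    (hφ : ContinuousOn φ (Icc 0 R)) : ContinuousOn (rayT G φ) (Icc 0 R) := by
  have h1 := continuousOn_cut_integrand (g := fun x => G x.1 (1 - x.2 ^ 2)) subset_rfl hR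
    hG.continuousOn_sq hφ
  have h2 := continuousOn_intervalIntegral
    (F := fun r (σ : ℝ) => (σ : ℂ) * G r (1 - σ ^ 2) * φ (σ ^ 2 * r)) zero_le_one h1
  exact hφ.add h2

theorem rayT_zero (hG : IsVolterraKernel ρ G) (φ : ℝ → ℂ) : rayT G φ 0 = φ 0 := by
  have : ∀ σ ∈ uIcc (0 : ℝ) 1, (σ : ℂ) * G 0 (1 - σ ^ 2) * φ (σ ^ 2 * 0) = 0 := by
    intro σ hσ
    rw [uIcc_of_le zero_le_one] at hσ
    rw [hG.zero _ (one_sub_sq_mem hσ), mul_zero, zero_mul]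
  rw [rayT, intervalIntegral.integral_congr this]
  simp

theorem scalarT_zero (hG : IsVolterraKernel ρ G) (u : ℂ → ℂ) : scalarT G u 0 = u 0 := by
  have := scalarT_ray G u (e := 1) norm_one (t := 0) le_rfl
  simpa [rayT_zero hG] using this

theorem scalarT_neg (G : ℝ → ℝ → ℂ) (u : ℂ → ℂ) (z : ℂ) :
    scalarT G (fun z => -u z) z = -scalarT G u z := by
  simp only [scalarT, mul_neg, intervalIntegral.integral_neg]
  ring

/-- The total mass of the kernel tends to 0 at the origin because G(0, t) = 0, and w = O(|z|), so
the integral part is o(|z|): T does not change the linear part at 0. -/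
theorem isLittleO_scalarT (hG : IsVolterraKernel ρ G) (ho : IsOpen Ω) (h0 : (0 : ℂ) ∈ Ω)
    (hρ : ∀ z ∈ Ω, ‖z‖ ≤ ρ) {w : ℂ → ℂ} {L : ℂ →L[ℝ] ℂ}
    (hw : (fun z => w z - L z) =o[𝓝 0] fun z => z) :
    (fun z => scalarT G w z - L z) =o[𝓝 0] fun z => z := by
  set κ : ℂ → ℝ := fun z => ∫ σ in (0 : ℝ)..1, ‖(σ : ℂ) * G ‖z‖ (1 - σ ^ 2)‖ with hκ
  have hκi : ContinuousOn (fun p : ℂ × ℝ => ‖(p.2 : ℂ) * G ‖p.1‖ (1 - p.2 ^ 2)‖) (Ω ×ˢ Icc 0 1) := by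
    refine ContinuousOn.norm (ContinuousOn.mul (by fun_prop) ?_)
    exact hG.continuousOn_sq.comp (f := fun p : ℂ × ℝ => (‖p.1‖, p.2)) (by fun_prop)
      fun p hp => ⟨⟨norm_nonneg _, hρ _ hp.1⟩, hp.2⟩
  have hκc : ContinuousOn κ Ω := continuousOn_intervalIntegral
    (F := fun z (σ : ℝ) => ‖(σ : ℂ) * G ‖z‖ (1 - σ ^ 2)‖) zero_le_one hκi
  have hκ0 : κ 0 = 0 := by
    have : ∀ σ ∈ uIcc (0 : ℝ) 1, ‖(σ : ℂ) * G ‖(0 : ℂ)‖ (1 - σ ^ 2)‖ = 0 := by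
      intro σ hσ
      rw [uIcc_of_le zero_le_one] at hσ
      rw [norm_zero, hG.zero _ (one_sub_sq_mem hσ), mul_zero, norm_zero]
    rw [hκ]
    simp only
    rw [intervalIntegral.integral_congr this]
    simp
  have hκt : Tendsto κ (𝓝 0) (𝓝 0) := by
    simpa [ContinuousAt, hκ0] using hκc.continuousAt (ho.mem_nhds h0)
  have hO : w =O[𝓝 0] fun z => z := by
    have := hw.isBigO.add (L.isBigO_id (𝓝 0))
    simpa using this
  obtain ⟨C, hC0, hC⟩ := hO.exists_pos
  obtain ⟨δ, hδ, hb⟩ := Metric.eventually_nhds_iff.1 hC.bound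
  have hI : (fun z => ∫ σ in (0 : ℝ)..1, (σ : ℂ) * G ‖z‖ (1 - σ ^ 2) * w ((σ : ℂ) ^ 2 * z))
      =o[𝓝 0] fun z => z := by
    rw [Asymptotics.isLittleO_iff]
    intro c hc
    filter_upwards [hκt.eventually (gt_mem_nhds (show 0 < c / C by positivity)), ho.mem_nhds h0,
      Metric.ball_mem_nhds (0 : ℂ) hδ] with z hz hzΩ hzδ
    have hi : IntervalIntegrable (fun σ : ℝ => ‖(σ : ℂ) * G ‖z‖ (1 - σ ^ 2)‖) volume 0 1 := by
      refine ContinuousOn.intervalIntegrable ?_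
      rw [uIcc_of_le zero_le_one]
      exact hκi.comp (f := fun σ : ℝ => (z, σ)) (by fun_prop) fun σ hσ => ⟨hzΩ, hσ⟩
    calc _ ≤ ∫ σ in (0 : ℝ)..1, ‖(σ : ℂ) * G ‖z‖ (1 - σ ^ 2)‖ * (C * ‖z‖) := by
          refine intervalIntegral.norm_integral_le_of_norm_le zero_le_one ?_ (hi.mul_const _)
          refine Eventually.of_forall fun σ hσ => ?_
          have hσ' : σ ∈ Icc (0 : ℝ) 1 := ⟨hσ.1.le, hσ.2⟩
          have hn : ‖(σ : ℂ) ^ 2 * z‖ ≤ ‖z‖ := by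
            rw [norm_mul, norm_pow, Complex.norm_real, Real.norm_of_nonneg hσ'.1]
            exact mul_le_of_le_one_left (norm_nonneg _) (sq_mem_unit hσ').2
          rw [norm_mul]
          refine mul_le_mul_of_nonneg_left ?_ (norm_nonneg _)
          refine (hb ?_).trans (mul_le_mul_of_nonneg_left hn hC0.le)
          rw [dist_zero_right]
          exact hn.trans_lt (mem_ball_zero_iff.1 hzδ)
      _ = κ z * C * ‖z‖ := by
          rw [intervalIntegral.integral_mul_const, mul_assoc]
      _ ≤ c * ‖z‖ := by
          gcongr
          exact ((lt_div_iff₀ hC0).1 hz).le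
  refine (hw.add hI).congr_left fun z => ?_
  rw [scalarT]
  ring

/-- Differentiation of `T u` along circles. -/
theorem hasDerivAt_scalarT_angle (hG : IsVolterraKernel ρ G) (ho : IsOpen Ω)
    (hs : StarConvex ℝ (0 : ℂ) Ω) (hρ : ∀ z ∈ Ω, ‖z‖ ≤ ρ) {u : ℂ → ℂ} (hu : ContDiffOn ℝ 1 u Ω)
    {z : ℂ} (hz : z ∈ Ω) :
    HasDerivAt (fun t : ℝ => scalarT G u (Complex.exp (t * Complex.I) * z))
      (scalarT G (fun ζ => fderiv ℝ u ζ (Complex.I * ζ)) z) 0 := by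
  obtain ⟨δ, hδ, hδΩ⟩ := exists_angle ho hz
  have hmaps : MapsTo (fun p : ℝ × ℝ => (Complex.exp (p.1 * Complex.I) * z, p.2))
      (Ioo (-δ) δ ×ˢ Icc 0 1) (Ω ×ˢ Icc 0 1) := fun p hp => ⟨hδΩ _ hp.1, hp.2⟩
  have huθ : ContinuousOn (fun ζ => fderiv ℝ u ζ (Complex.I * ζ)) Ω :=
    (hu.continuousOn_fderiv_of_isOpen ho le_rfl).clm_apply (by fun_prop)
  have hd : ∀ ζ ∈ Ω, ∀ (t : ℝ) (a : ℂ), a * (Complex.exp (t * Complex.I) * z) = ζ →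
      HasDerivAt (fun t : ℝ => u (a * (Complex.exp (t * Complex.I) * z)))
        (fderiv ℝ u ζ (Complex.I * ζ)) t := by
    rintro _ hζ t a rfl
    have h1 : HasFDerivAt u _ _ :=
      ((hu.differentiableOn one_ne_zero).differentiableAt (ho.mem_nhds hζ)).hasFDerivAt
    have h2 : HasDerivAt (fun t : ℝ => a * (Complex.exp (t * Complex.I) * z))
        (Complex.I * (a * (Complex.exp (t * Complex.I) * z))) t := by
      refine ((((hasDerivAt_coe t).mul_const Complex.I).cexp.mul_const z).const_mul a).congr_deriv ?_
      ring
    exact h1.comp_hasDerivAt t h2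
  have h0 : (0 : ℝ) ∈ Ioo (-δ) δ := ⟨by linarith, hδ⟩
  have hcont : ContinuousOn (fun p : ℝ × ℝ => (Complex.exp (p.1 * Complex.I) * z, p.2))
      (Ioo (-δ) δ ×ˢ Icc 0 1) := by fun_prop
  have c1 := (continuousOn_scalarT_integrand hG hs hρ hu.continuousOn).comp hcont hmaps
  have c2 := (continuousOn_scalarT_integrand hG hs hρ huθ).comp hcont hmaps
  simp only [Function.comp_def] at c1 c2
  have key := hasDerivAt_intervalIntegral
    (F := fun (t σ : ℝ) => (σ : ℂ) * G ‖Complex.exp (t * Complex.I) * z‖ (1 - σ ^ 2) *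
      u ((σ : ℂ) ^ 2 * (Complex.exp (t * Complex.I) * z)))
    (F' := fun (t σ : ℝ) => (σ : ℂ) * G ‖Complex.exp (t * Complex.I) * z‖ (1 - σ ^ 2) *
      fderiv ℝ u ((σ : ℂ) ^ 2 * (Complex.exp (t * Complex.I) * z))
        (Complex.I * ((σ : ℂ) ^ 2 * (Complex.exp (t * Complex.I) * z))))
    zero_le_one h0 c1 c2 ?_
  · have h1 := hd z hz 0 1 (by simp)
    simp only [one_mul] at h1
    refine (h1.add key).congr_deriv ?_
    simp [scalarT]
  · intro t ht σ hσ
    simp only [norm_exp_mul_I_mul]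
    exact (hd _ (sq_mul_mem hs (hδΩ t ht) (Ioo_subset_Icc_self hσ)) t _ rfl).const_mul _

end Rays

/-! ### Images of holomorphic functions are solutions. -/

section Image

variable {Ω : Set ℂ} {ρ : ℝ} {h : ℝ → ℂ} {G G₁ G₂ : ℝ → ℝ → ℂ}

theorem scalarT_congr (hs : StarConvex ℝ (0 : ℂ) Ω) {u v : ℂ → ℂ} (huv : EqOn u v Ω) {z : ℂ}
    (hz : z ∈ Ω) : scalarT G u z = scalarT G v z := by
  rw [scalarT, scalarT, huv hz]
  congr 1
  refine intervalIntegral.integral_congr fun σ hσ => ?_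
  rw [uIcc_of_le zero_le_one] at hσ
  simp only [huv (sq_mul_mem hs hz hσ)]

theorem isLittleO_clm_apply {A : ℂ → ℂ →L[ℝ] ℂ} (hA : ContinuousAt A 0) {m : ℂ → ℂ}
    (hm : ∀ z, ‖m z‖ = ‖z‖) : (fun z => A z (m z) - A 0 (m z)) =o[𝓝 0] fun z => z := by
  rw [Asymptotics.isLittleO_iff]
  intro c hc
  have ht : Tendsto (fun z => ‖A z - A 0‖) (𝓝 0) (𝓝 0) := by
    have := (hA.sub (continuousAt_const (y := A 0))).norm
    simpa [ContinuousAt] using this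
  filter_upwards [ht.eventually (gt_mem_nhds hc)] with z hz
  rw [← sub_apply, ← hm z]
  exact ((A z - A 0).le_opNorm (m z)).trans (by gcongr)

theorem hasDerivAt_dilation_of_ray {U : ℂ → ℂ} {z a : ℂ} (hz : z ≠ 0)
    (hU : HasDerivAt (fun s : ℝ => U (s * (z / (‖z‖ : ℂ)))) a ‖z‖) :
    HasDerivAt (fun t : ℝ => U (t * z)) (‖z‖ * a) 1 := by
  have h1 : HasDerivAt (fun t : ℝ => t * ‖z‖) ‖z‖ 1 := by
    simpa using (hasDerivAt_id (1 : ℝ)).mul_const ‖z‖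
  have h2 := HasDerivAt.scomp_of_eq (h := fun t : ℝ => t * ‖z‖) 1 hU h1 (by simp)
  refine (h2.congr_deriv (by simp)).congr_of_eventuallyEq (Eventually.of_forall fun t => ?_)
  simp only [Function.comp, Complex.ofReal_mul, mul_assoc, norm_mul_div_norm_self hz]

theorem hasDerivAt_ray {u : ℂ → ℂ} {e : ℂ} {s : ℝ} (hs : s ≠ 0)
    (hu : DifferentiableAt ℝ u (s * e)) :
    HasDerivAt (fun s : ℝ => u (s * e)) (fderiv ℝ u (s * e) (s * e) / s) s := by
  have h1 : HasDerivAt (fun s : ℝ => (s : ℂ) * e) e s := by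
    simpa using (hasDerivAt_coe s).mul_const e
  refine (HasFDerivAt.comp_hasDerivAt s hu.hasFDerivAt h1).congr_deriv ?_
  have h2 : (s : ℂ) * e = s • e := by simp
  have hsC : (s : ℂ) ≠ 0 := by exact_mod_cast hs
  conv_rhs => rw [h2, map_smul, Complex.real_smul]
  rw [mul_div_cancel_left₀ _ hsC, h2]

theorem eventuallyEq_scalarT_ray (u : ℂ → ℂ) {z : ℂ} (hz : z ≠ 0) :
    (fun s : ℝ => scalarT G u (s * (z / (‖z‖ : ℂ)))) =ᶠ[𝓝 ‖z‖]
      rayT G fun s => u (s * (z / (‖z‖ : ℂ))) := by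
  filter_upwards [lt_mem_nhds (norm_pos_iff.2 hz)] with s hs
  exact scalarT_ray G u (norm_div_norm_self hz) hs.le

/-- The operator `T₁` maps `C¹` functions to `C¹` functions, with the intertwining relations for
the radial and the angular derivative. -/
theorem RayIntertwines.contDiffOn_scalarT (hI : RayIntertwines ρ h G₁ G₂)
    (hh : ContinuousOn h (Icc 0 ρ)) (hb : ∃ C, 0 ≤ C ∧ ∀ r ∈ Icc 0 ρ, ‖h r‖ ≤ C * r)
    (hG₁ : IsVolterraKernel ρ G₁) (hG₂ : IsVolterraKernel ρ G₂)
    (ho : IsOpen Ω) (h0 : (0 : ℂ) ∈ Ω) (hs : StarConvex ℝ (0 : ℂ) Ω) (hρ : ∀ z ∈ Ω, ‖z‖ ≤ ρ)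
    {u : ℂ → ℂ} (hu : ContDiffOn ℝ 1 u Ω) :
    ContDiffOn ℝ 1 (scalarT G₁ u) Ω ∧
    (∀ z ∈ Ω, fderiv ℝ (scalarT G₁ u) z z =
        ‖z‖ * h ‖z‖ * scalarT G₁ u z + scalarT G₂ (fun ζ => fderiv ℝ u ζ ζ) z ∧
      fderiv ℝ (scalarT G₁ u) z (Complex.I * z) =
        scalarT G₁ (fun ζ => fderiv ℝ u ζ (Complex.I * ζ)) z) ∧
    (0 ∈ Ω → fderiv ℝ (scalarT G₁ u) 0 = fderiv ℝ u 0) := by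
  have hΩ0 := ho.mem_nhds h0
  have hDc : ContinuousOn (fderiv ℝ u) Ω := hu.continuousOn_fderiv_of_isOpen ho le_rfl
  have hw : ContinuousOn (fun ζ => fderiv ℝ u ζ ζ) Ω := hDc.clm_apply continuousOn_id
  have hθ : ContinuousOn (fun ζ => fderiv ℝ u ζ (Complex.I * ζ)) Ω :=
    hDc.clm_apply (by fun_prop)
  have hU := continuousOn_scalarT hG₁ hs hρ hu.continuousOn
  have hhn : ContinuousOn (fun z : ℂ => h ‖z‖) Ω :=
    hh.comp (by fun_prop) fun z hz => ⟨norm_nonneg _, hρ z hz⟩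
  have hc : ContinuousOn (fun z : ℂ => (‖z‖ : ℂ) * h ‖z‖ * scalarT G₁ u z) Ω :=
    (ContinuousOn.mul (by fun_prop) hhn).mul hU
  refine contDiffOn_of_polar ho hU (hc.add (continuousOn_scalarT hG₂ hs hρ hw))
    (continuousOn_scalarT hG₁ hs hρ hθ) ?_ (fun z hz _ => hasDerivAt_scalarT_angle hG₁ ho hs hρ hu hz)
    ?_ ?_
  · intro z hz hz0
    obtain ⟨R, hR, hRρ, hRΩ⟩ := exists_radius_gt ho hs hρ hz hz0
    have hn : 0 < ‖z‖ := norm_pos_iff.2 hz0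
    have hnC : (‖z‖ : ℂ) ≠ 0 := by exact_mod_cast hn.ne'
    have key := hI.hasDerivAt hRρ (continuousOn_ray hu.continuousOn hRΩ) (continuousOn_ray hw hRΩ)
      (fun r hr => hasDerivAt_ray hr.1.ne' ((hu.differentiableOn one_ne_zero).differentiableAt
        (ho.mem_nhds (hRΩ r (Ioo_subset_Icc_self hr))))) ‖z‖ ⟨hn, hR⟩
    refine (hasDerivAt_dilation_of_ray hz0
      (key.congr_of_eventuallyEq (eventuallyEq_scalarT_ray u hz0))).congr_deriv ?_
    rw [← scalarT_ray G₁ u (norm_div_norm_self hz0) hn.le,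
      ← scalarT_ray G₂ (fun ζ => fderiv ℝ u ζ ζ) (norm_div_norm_self hz0) hn.le,
      norm_mul_div_norm_self hz0]
    field_simp
  · have h1 : (fun z => fderiv ℝ u z z - fderiv ℝ u 0 z) =o[𝓝 0] fun z => z :=
      isLittleO_clm_apply (hDc.continuousAt hΩ0) fun _ => rfl
    have h2 := isLittleO_scalarT hG₂ ho h0 hρ h1
    -- Of order |z|², since |h| ≤ C r.
    have h3 : (fun z : ℂ => (‖z‖ : ℂ) * h ‖z‖ * scalarT G₁ u z) =o[𝓝 0] fun z => z := by
      obtain ⟨C, hC0, hC⟩ := hb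
      have hlim : Tendsto (fun z : ℂ => C * ‖z‖ * ‖scalarT G₁ u z‖) (𝓝 0) (𝓝 0) := by
        have h1 : Tendsto (fun z : ℂ => C * ‖z‖) (𝓝 0) (𝓝 (C * 0)) :=
          tendsto_norm_zero.const_mul C
        simpa using h1.mul (hU.continuousAt hΩ0).norm
      rw [Asymptotics.isLittleO_iff]
      intro c hc
      filter_upwards [hlim.eventually (gt_mem_nhds hc), hΩ0] with z hz hzΩ
      have hb := hC ‖z‖ ⟨norm_nonneg _, hρ z hzΩ⟩
      rw [norm_mul, norm_mul, Complex.norm_real, norm_norm]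
      calc ‖z‖ * ‖h ‖z‖‖ * ‖scalarT G₁ u z‖ ≤ ‖z‖ * (C * ‖z‖) * ‖scalarT G₁ u z‖ := by gcongr
        _ = C * ‖z‖ * ‖scalarT G₁ u z‖ * ‖z‖ := by ring
        _ ≤ c * ‖z‖ := by gcongr
    refine (h3.add h2).congr_left fun z => ?_
    ring
  · have h1 : (fun z => fderiv ℝ u z (Complex.I * z) - fderiv ℝ u 0 (Complex.I * z)) =o[𝓝 0]
        fun z => z := isLittleO_clm_apply (hDc.continuousAt hΩ0) fun z => by simp
    have h2 : ∀ z, fderiv ℝ u 0 (Complex.I * z) =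
        ((fderiv ℝ u 0).comp (ContinuousLinearMap.mul ℝ ℂ Complex.I)) z := fun z => by simp
    simp only [h2] at h1 ⊢
    exact isLittleO_scalarT hG₁ ho h0 hρ h1

/-- With U = T₁u and V = T₂v: r U_r - rhU = T₂(r u_r) = T₂(v_θ) = V_θ, and likewise r V_r + rhV =
T₁(r v_r) = -T₁(u_θ) = -U_θ. At the origin the derivatives of u and v are unchanged. -/
theorem isPolarSol_scalarT (hI : RayIntertwines ρ h G₁ G₂)
    (hI' : RayIntertwines ρ (fun r => -h r) G₂ G₁)
    (hh : ContinuousOn h (Icc 0 ρ)) (hb : ∃ C, 0 ≤ C ∧ ∀ r ∈ Icc 0 ρ, ‖h r‖ ≤ C * r)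
    (hG₁ : IsVolterraKernel ρ G₁) (hG₂ : IsVolterraKernel ρ G₂)
    (ho : IsOpen Ω) (h0 : (0 : ℂ) ∈ Ω) (hs : StarConvex ℝ (0 : ℂ) Ω) (hρ : ∀ z ∈ Ω, ‖z‖ ≤ ρ)
    {u v : ℂ → ℂ} (huv : IsPolarSol Ω (fun _ => 0) u v) :
    IsPolarSol Ω (fun z => ‖z‖ * h ‖z‖) (scalarT G₁ u) (scalarT G₂ v) := by
  obtain ⟨c1, d1, o1⟩ := hI.contDiffOn_scalarT hh hb hG₁ hG₂ ho h0 hs hρ huv.contDiffOn₁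
  obtain ⟨c2, d2, o2⟩ := hI'.contDiffOn_scalarT hh.neg (by simpa using hb) hG₂ hG₁ ho h0 hs hρ
    huv.contDiffOn₂
  refine ⟨c1, c2, fun z hz => ?_, fun z hz => ?_, fun e => ?_⟩
  · have he : EqOn (fun ζ => fderiv ℝ u ζ ζ) (fun ζ => fderiv ℝ v ζ (Complex.I * ζ)) Ω :=
      fun ζ hζ => by simpa [sub_eq_zero] using huv.eq₁ ζ hζ
    rw [(d1 z hz).1, (d2 z hz).2, scalarT_congr hs he hz]
    ring
  · have he : EqOn (fun ζ => fderiv ℝ v ζ ζ) (fun ζ => -fderiv ℝ u ζ (Complex.I * ζ)) Ω :=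
      fun ζ hζ => by simpa [add_eq_zero_iff_eq_neg] using huv.eq₂ ζ hζ
    rw [(d2 z hz).1, (d1 z hz).2, scalarT_congr hs he hz, scalarT_neg]
    ring
  · rw [o1 h0, o2 h0, huv.origin]

end Image

/-! ### Regularity of preimages. -/

section Primitive

theorem hasDerivAt_primitive {k : ℝ → ℂ} {a b x : ℝ} (hk : ContinuousOn k (Icc a b))
    (hx : x ∈ Ioo a b) : HasDerivAt (fun s => ∫ τ in a..s, k τ) (k x) x := by
  refine intervalIntegral.integral_hasDerivAt_right ?_ ?_ ?_
  · refine ContinuousOn.intervalIntegrable (hk.mono ?_)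
    rw [uIcc_of_le hx.1.le]
    exact Icc_subset_Icc_right hx.2.le
  · exact (hk.mono Ioo_subset_Icc_self).stronglyMeasurableAtFilter isOpen_Ioo x hx
  · exact hk.continuousAt (Icc_mem_nhds hx.1 hx.2)

theorem continuousOn_primitive {k : ℝ → ℂ} {a b : ℝ} (hab : a ≤ b) (hk : ContinuousOn k (Icc a b)) :
    ContinuousOn (fun s => ∫ τ in a..s, k τ) (Icc a b) := by
  have := intervalIntegral.continuousOn_primitive_interval (μ := volume) (f := k) (a := a) (b := b)
    (by rw [uIcc_of_le hab]; exact hk.integrableOn_Icc)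
  rwa [uIcc_of_le hab] at this

/-- A solution of `y' = h y` that vanishes at the left end point is zero. -/
theorem eq_zero_of_hasDerivAt_mul {h y : ℝ → ℂ} {R : ℝ} (hh : ContinuousOn h (Icc 0 R))
    (hy : ContinuousOn y (Icc 0 R)) (hd : ∀ r ∈ Ioo 0 R, HasDerivAt y (h r * y r) r)
    (h0 : y 0 = 0) : ∀ r ∈ Icc 0 R, y r = 0 := by
  intro r hr
  set E : ℝ → ℂ := fun s => Complex.exp (-∫ τ in (0 : ℝ)..s, h τ) with hE
  have hR : 0 ≤ R := hr.1.trans hr.2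
  have hEc : ContinuousOn E (Icc 0 R) := (continuousOn_primitive hR hh).neg.cexp
  have hsub : Icc 0 r ⊆ Icc 0 R := Icc_subset_Icc_right hr.2
  have hd' : ∀ s ∈ Ioo 0 r, HasDerivAt (fun s => y s * E s) 0 s := by
    intro s hs
    have hs' : s ∈ Ioo 0 R := ⟨hs.1, hs.2.trans_le hr.2⟩
    refine ((hd s hs').mul (hasDerivAt_primitive hh hs').neg.cexp).congr_deriv ?_
    simp only [Pi.neg_apply]
    ring
  have := norm_sub_le_of_hasDerivAt_Ioo (f' := fun _ => 0) (C := 0) hr.1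
    ((hy.mono hsub).mul (hEc.mono hsub)) hd' (by simp)
  simp only [h0, zero_mul, sub_zero, Pi.mul_apply] at this
  have h1 : y r * E r = 0 := norm_le_zero_iff.1 this
  exact (mul_eq_zero.1 h1).resolve_right (Complex.exp_ne_zero _)

end Primitive

section Inverse

variable {Ω : Set ℂ} {ρ : ℝ} {h : ℝ → ℂ} {G G₁ G₂ : ℝ → ℝ → ℂ}

theorem eqOn_of_rayT_eq (hG : IsVolterraKernel ρ G) {R : ℝ} (hR : R ≤ ρ) {φ ψ : ℝ → ℂ}
    (hφ : ContinuousOn φ (Icc 0 R)) (hψ : ContinuousOn ψ (Icc 0 R))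
    (hT : EqOn (rayT G φ) (rayT G ψ) (Icc 0 R)) : EqOn φ ψ (Icc 0 R) := by
  intro r hr
  refine sub_eq_zero.1 (eq_zero_of_rayT_eq_zero hG hR (hφ.sub hψ) (fun s hs => ?_) r hr)
  exact (rayT_sub hG hR hφ hψ hs).trans (sub_eq_zero.2 (hT hs))

/-- Fubini, used to move T inside an integral over the angle. -/
theorem rayT_integral (hG : IsVolterraKernel ρ G) {R a b r : ℝ} (hR : R ≤ ρ) (hab : a ≤ b)
    {K : ℝ → ℝ → ℂ} (hK : ContinuousOn (fun p : ℝ × ℝ => K p.1 p.2) (Icc 0 R ×ˢ Icc a b))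
    (hr : r ∈ Icc 0 R) :
    rayT G (fun s => ∫ τ in a..b, K s τ) r = ∫ τ in a..b, rayT G (fun s => K s τ) r := by
  have hF : ContinuousOn (fun p : ℝ × ℝ => (p.1 : ℂ) * G r (1 - p.1 ^ 2) * K (p.1 ^ 2 * r) p.2)
      (Icc 0 1 ×ˢ Icc a b) := by
    refine ContinuousOn.mul (ContinuousOn.mul (by fun_prop) ?_) ?_
    · exact hG.continuousOn_sq.comp (f := fun p : ℝ × ℝ => (r, p.1)) (by fun_prop)
        fun p hp => ⟨⟨hr.1, hr.2.trans hR⟩, hp.1⟩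
    · exact hK.comp (f := fun p : ℝ × ℝ => (p.1 ^ 2 * r, p.2)) (by fun_prop)
        fun p hp => ⟨sq_mul_mem_Icc hr hp.1, hp.2⟩
  have hswap := intervalIntegral_intervalIntegral_swap (a := 0) (b := 1) (c := a) (d := b)
    (F := fun σ τ : ℝ => (σ : ℂ) * G r (1 - σ ^ 2) * K (σ ^ 2 * r) τ) (by
      rw [uIoc_of_le zero_le_one, uIoc_of_le hab]
      exact (hF.integrableOn_compact (isCompact_Icc.prod isCompact_Icc)).mono_set
        (prod_mono Ioc_subset_Icc_self Ioc_subset_Icc_self))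
  have hF' : ContinuousOn (fun p : ℝ × ℝ => (p.2 : ℂ) * G r (1 - p.2 ^ 2) * K (p.2 ^ 2 * r) p.1)
      (Icc a b ×ˢ Icc 0 1) :=
    hF.comp (f := fun p : ℝ × ℝ => (p.2, p.1)) (by fun_prop) fun p hp => ⟨hp.2, hp.1⟩
  have hi₁ : IntervalIntegrable (fun τ => K r τ) volume a b := by
    refine ContinuousOn.intervalIntegrable ?_
    rw [uIcc_of_le hab]
    exact hK.comp (f := fun τ : ℝ => (r, τ)) (by fun_prop) fun τ hτ => ⟨hr, hτ⟩
  have hi₂ : IntervalIntegrable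
      (fun τ => ∫ σ in (0 : ℝ)..1, (σ : ℂ) * G r (1 - σ ^ 2) * K (σ ^ 2 * r) τ) volume a b := by
    refine ContinuousOn.intervalIntegrable ?_
    rw [uIcc_of_le hab]
    exact continuousOn_intervalIntegral
      (F := fun τ σ : ℝ => (σ : ℂ) * G r (1 - σ ^ 2) * K (σ ^ 2 * r) τ) zero_le_one hF'
  simp only [rayT, ← intervalIntegral.integral_const_mul]
  rw [hswap, ← intervalIntegral.integral_add hi₁ hi₂]

/-- If `T u` is `C¹`, then `u` is differentiable along circles. -/
theorem hasDerivAt_angle_of_scalarT (hG : IsVolterraKernel ρ G) (ho : IsOpen Ω)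
    (hs : StarConvex ℝ (0 : ℂ) Ω) (hρ : ∀ z ∈ Ω, ‖z‖ ≤ ρ) {U u w : ℂ → ℂ}
    (hU : ContDiffOn ℝ 1 U Ω) (hu : ContinuousOn u Ω) (hw : ContinuousOn w Ω)
    (hTu : ∀ z ∈ Ω, scalarT G u z = U z)
    (hTw : ∀ z ∈ Ω, scalarT G w z = fderiv ℝ U z (Complex.I * z)) {z : ℂ} (hz : z ∈ Ω)
    (hz0 : z ≠ 0) : HasDerivAt (fun t : ℝ => u (Complex.exp (t * Complex.I) * z)) (w z) 0 := by
  obtain ⟨δ, hδ, hδΩ⟩ := exists_angle ho hz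
  have hn : 0 < ‖z‖ := norm_pos_iff.2 hz0
  set e : ℂ := z / (‖z‖ : ℂ) with he
  set a : ℝ := -(δ / 2) with ha
  set b : ℝ := δ / 2 with hb
  set E : ℝ → ℂ := fun t => Complex.exp (t * Complex.I) * e with hE
  have hEn : ∀ t, ‖E t‖ = 1 := fun t => by
    rw [hE, norm_exp_mul_I_mul, he, norm_div_norm_self hz0]
  have hEz : ∀ t : ℝ, (‖z‖ : ℂ) * E t = Complex.exp (t * Complex.I) * z := fun t => by
    rw [hE, mul_left_comm, he, norm_mul_div_norm_self hz0]
  have hI : Icc a b ⊆ Ioo (-δ) δ := fun t ht => ⟨by linarith [ht.1], by linarith [ht.2]⟩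
  have hmem : ∀ s ∈ Icc 0 ‖z‖, ∀ t ∈ Icc a b, (s : ℂ) * E t ∈ Ω := by
    intro s hs' t ht
    have := ofReal_mul_mem hs (hδΩ t (hI ht)) (t := s / ‖z‖)
      ⟨div_nonneg hs'.1 hn.le, div_le_one_of_le₀ hs'.2 hn.le⟩
    rwa [← hEz, ← mul_assoc, ← Complex.ofReal_mul, div_mul_cancel₀ _ hn.ne'] at this
  have hEc : Continuous E := by fun_prop
  have hzρ : ‖z‖ ≤ ρ := hρ z hz
  have hwc : ContinuousOn (fun p : ℝ × ℝ => w (p.1 * E p.2)) (Icc 0 ‖z‖ ×ˢ Icc a b) :=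
    hw.comp (by fun_prop) fun p hp => hmem _ hp.1 _ hp.2
  have haI : a ∈ Icc a b := ⟨le_rfl, by linarith⟩
  have hray : ∀ t ∈ Icc a b, ContinuousOn (fun s : ℝ => u (s * E t)) (Icc 0 ‖z‖) := fun t ht =>
    continuousOn_ray hu fun s hs' => hmem s hs' t ht
  have hUd : ∀ s ∈ Icc 0 ‖z‖, ∀ t ∈ Icc a b, HasDerivAt (fun t : ℝ => U (s * E t))
      (fderiv ℝ U (s * E t) (Complex.I * (s * E t))) t := by
    intro s hs' t ht
    have h1 : HasFDerivAt U _ _ := ((hU.differentiableOn one_ne_zero).differentiableAt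
      (ho.mem_nhds (hmem s hs' t ht))).hasFDerivAt
    have h2 : HasDerivAt (fun t : ℝ => (s : ℂ) * E t) (Complex.I * (s * E t)) t := by
      refine ((((hasDerivAt_coe t).mul_const Complex.I).cexp.mul_const e).const_mul
        (s : ℂ)).congr_deriv ?_
      simp only [hE]
      ring
    exact h1.comp_hasDerivAt t h2
  have hDc : ContinuousOn (fun ζ => fderiv ℝ U ζ (Complex.I * ζ)) Ω :=
    (hU.continuousOn_fderiv_of_isOpen ho le_rfl).clm_apply (by fun_prop)
  -- As functions of the radius, both u(sE(t)) - u(sE(a)) and the angular integral of w are sent by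
  -- T to U(sE(t)) - U(sE(a)); injectivity on the segment [0, |z|] identifies them.
  have hformula : ∀ t ∈ Icc a b, u (‖z‖ * E t) = u (‖z‖ * E a) + ∫ τ in a..t, w (‖z‖ * E τ) := by
    intro t ht
    have hat : Icc a t ⊆ Icc a b := Icc_subset_Icc_right ht.2
    have hwt := hwc.mono (prod_mono_right (s := Icc 0 ‖z‖) hat)
    have hAc : ContinuousOn (fun s : ℝ => ∫ τ in a..t, w (s * E τ)) (Icc 0 ‖z‖) :=
      continuousOn_intervalIntegral (F := fun s τ : ℝ => w (s * E τ)) ht.1 hwt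
    have heq := eqOn_of_rayT_eq hG hzρ ((hray t ht).sub (hray a haI)) hAc (fun r hr => ?_)
      ⟨hn.le, le_rfl⟩
    · simp only [Pi.sub_apply] at heq
      rw [← heq]
      ring
    · have h1 := rayT_sub hG hzρ (hray t ht) (hray a haI) hr
      have h2 := rayT_integral hG hzρ ht.1 (K := fun s τ : ℝ => w (s * E τ)) hwt hr
      refine h1.trans (Eq.trans ?_ h2.symm)
      rw [← scalarT_ray G u (hEn t) hr.1, ← scalarT_ray G u (hEn a) hr.1,
        hTu _ (hmem r hr t ht), hTu _ (hmem r hr a haI)]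
      have h3 : ∫ τ in a..t, rayT G (fun s => w (s * E τ)) r =
          ∫ τ in a..t, fderiv ℝ U (r * E τ) (Complex.I * (r * E τ)) := by
        refine intervalIntegral.integral_congr fun τ hτ => ?_
        rw [uIcc_of_le ht.1] at hτ
        rw [← scalarT_ray G w (hEn τ) hr.1, hTw _ (hmem r hr τ (hat hτ))]
      rw [h3]
      refine (intervalIntegral.integral_eq_sub_of_hasDerivAt (f := fun τ : ℝ => U (r * E τ))
        (fun τ hτ => ?_) ?_).symm
      · rw [uIcc_of_le ht.1] at hτ
        exact hUd r hr τ (hat hτ)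
      · refine ContinuousOn.intervalIntegrable ?_
        rw [uIcc_of_le ht.1]
        exact hDc.comp (f := fun τ : ℝ => (r : ℂ) * E τ) (by fun_prop) fun τ hτ =>
          hmem r hr τ (hat hτ)
  have h0 : (0 : ℝ) ∈ Ioo a b := ⟨by linarith, by linarith⟩
  have hwz : ContinuousOn (fun τ : ℝ => w (‖z‖ * E τ)) (Icc a b) :=
    hw.comp (by fun_prop) fun τ hτ => hmem _ ⟨hn.le, le_rfl⟩ τ hτ
  have hder := (hasDerivAt_primitive hwz h0).const_add (u (‖z‖ * E a))
  refine (hder.congr_of_eventuallyEq ?_).congr_deriv ?_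
  · filter_upwards [Icc_mem_nhds h0.1 h0.2] with t ht
    rw [← hEz]
    exact hformula t ht
  · rw [hEz]
    simp

/-- On a ray, φ is u(0) plus the primitive of w/s. By intertwining, T₁φ solves the same linear
first-order equation as U with the same value at 0, so T₁φ = U and injectivity gives φ = u. The form
c₁x + c₂y of w is what makes w/s continuous down to s = 0. -/
theorem hasDerivAt_dilation_of_scalarT (hI : RayIntertwines ρ h G₁ G₂)
    (hh : ContinuousOn h (Icc 0 ρ)) (hG₁ : IsVolterraKernel ρ G₁)
    (ho : IsOpen Ω) (h0 : (0 : ℂ) ∈ Ω) (hs : StarConvex ℝ (0 : ℂ) Ω) (hρ : ∀ z ∈ Ω, ‖z‖ ≤ ρ)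
    {U u c₁ c₂ : ℂ → ℂ} (hU : ContDiffOn ℝ 1 U Ω) (hu : ContinuousOn u Ω)
    (hc₁ : ContinuousOn c₁ Ω) (hc₂ : ContinuousOn c₂ Ω) (hTu : ∀ z ∈ Ω, scalarT G₁ u z = U z)
    (hTw : ∀ z ∈ Ω, scalarT G₂ (fun ζ => c₁ ζ * ζ.re + c₂ ζ * ζ.im) z =
      fderiv ℝ U z z - ‖z‖ * h ‖z‖ * U z) {z : ℂ} (hz : z ∈ Ω) (hz0 : z ≠ 0) :
    HasDerivAt (fun t : ℝ => u (t * z)) (c₁ z * z.re + c₂ z * z.im) 1 := by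
  obtain ⟨R, hR, hRρ, hRΩ⟩ := exists_radius_gt ho hs hρ hz hz0
  have hn : 0 < ‖z‖ := norm_pos_iff.2 hz0
  have hze : ((‖z‖ : ℝ) : ℂ) * (z / (‖z‖ : ℂ)) = z := norm_mul_div_norm_self hz0
  have hR0 : 0 ≤ R := hn.le.trans hR.le
  have hen := norm_div_norm_self hz0
  set e : ℂ := z / (‖z‖ : ℂ) with he
  set b : ℝ → ℂ := fun s => c₁ (s * e) * e.re + c₂ (s * e) * e.im with hb
  have hbc : ContinuousOn b (Icc 0 R) :=
    ((continuousOn_ray hc₁ hRΩ).mul continuousOn_const).add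
      ((continuousOn_ray hc₂ hRΩ).mul continuousOn_const)
  set φ : ℝ → ℂ := fun s => u 0 + ∫ τ in (0 : ℝ)..s, b τ with hφ
  have hφc : ContinuousOn φ (Icc 0 R) := continuousOn_const.add (continuousOn_primitive hR0 hbc)
  have hφd : ∀ r ∈ Ioo 0 R, HasDerivAt φ (b r) r := fun r hr =>
    (hasDerivAt_primitive hbc hr).const_add _
  set w : ℂ → ℂ := fun ζ => c₁ ζ * ζ.re + c₂ ζ * ζ.im with hw
  have hwc : ContinuousOn w Ω :=
    (hc₁.mul (by fun_prop)).add (hc₂.mul (by fun_prop))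
  have hwb : ∀ s : ℝ, w (s * e) = s * b s := fun s => by
    simp only [hw, hb, Complex.re_ofReal_mul, Complex.im_ofReal_mul]
    push_cast
    ring
  have hUc : ContinuousOn (fun s : ℝ => U (s * e)) (Icc 0 R) := continuousOn_ray hU.continuousOn hRΩ
  have hΦ : EqOn (rayT G₁ φ) (fun s : ℝ => U (s * e)) (Icc 0 R) := by
    intro r hr
    refine sub_eq_zero.1 (eq_zero_of_hasDerivAt_mul (hh.mono (Icc_subset_Icc_right hRρ))
      ((continuousOn_rayT hG₁ hRρ hφc).sub hUc) (fun s hs' => ?_) ?_ r hr)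
    · have hsC : (s : ℂ) ≠ 0 := by exact_mod_cast hs'.1.ne'
      have hsΩ := hRΩ s (Ioo_subset_Icc_self hs')
      have k1 := hI.hasDerivAt hRρ hφc (continuousOn_ray hwc hRΩ) (fun r hr => by
        have hrC : (r : ℂ) ≠ 0 := by exact_mod_cast hr.1.ne'
        rw [hwb, mul_div_cancel_left₀ _ hrC]
        exact hφd r hr) s hs'
      have k2 := hasDerivAt_ray hs'.1.ne'
        ((hU.differentiableOn one_ne_zero).differentiableAt (ho.mem_nhds hsΩ))
      refine (k1.sub k2).congr_deriv ?_
      rw [← scalarT_ray G₂ w hen hs'.1.le, hTw _ hsΩ, norm_mul, hen, mul_one, Complex.norm_real,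
        Real.norm_of_nonneg hs'.1.le, Pi.sub_apply]
      field_simp
      ring
    · simp only [Pi.sub_apply, rayT_zero hG₁, Complex.ofReal_zero, zero_mul]
      rw [← hTu 0 h0, scalarT_zero hG₁]
      simp [hφ]
  have hφu : EqOn φ (fun s : ℝ => u (s * e)) (Icc 0 R) := by
    refine eqOn_of_rayT_eq hG₁ hRρ hφc (continuousOn_ray hu hRΩ) fun r hr => ?_
    rw [hΦ hr, ← scalarT_ray G₁ u hen hr.1, hTu _ (hRΩ r hr)]
  have hder : HasDerivAt (fun s : ℝ => u (s * e)) (b ‖z‖) ‖z‖ := by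
    refine (hφd ‖z‖ ⟨hn, hR⟩).congr_of_eventuallyEq ?_
    filter_upwards [Icc_mem_nhds hn hR] with s hs' using (hφu hs').symm
  refine (hasDerivAt_dilation_of_ray hz0 hder).congr_deriv ?_
  rw [← hwb, hze]

/-- A preimage divisible by |z| with continuous quotients: in the integral the coordinates x and y
pick up the factor σ² = 1 - t, so each coefficient is found by inverting the operator with kernel (1
- t)G on A(z)1 or A(z)i. At 0 that operator is the identity, which gives the linear part. -/
theorem exists_scalarT_eq_apply (hG : IsVolterraKernel ρ G) (ho : IsOpen Ω) (h0 : (0 : ℂ) ∈ Ω)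
    (hs : StarConvex ℝ (0 : ℂ) Ω) (hρ : ∀ z ∈ Ω, ‖z‖ ≤ ρ) {A : ℂ → ℂ →L[ℝ] ℂ}
    (hA : ContinuousOn A Ω) :
    ∃ c₁ c₂ : ℂ → ℂ, ContinuousOn c₁ Ω ∧ ContinuousOn c₂ Ω ∧
      (∀ z ∈ Ω, scalarT G (fun ζ => c₁ ζ * ζ.re + c₂ ζ * ζ.im) z = A z z) ∧
      (fun z => c₁ z * z.re + c₂ z * z.im - A 0 z) =o[𝓝 0] fun z => z := by
  obtain ⟨c₁, hc₁, h₁⟩ := exists_scalarT_eq hG.one_sub_mul ho hs hρ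
    (hA.clm_apply (continuousOn_const (c := (1 : ℂ))))
  obtain ⟨c₂, hc₂, h₂⟩ := exists_scalarT_eq hG.one_sub_mul ho hs hρ
    (hA.clm_apply (continuousOn_const (c := Complex.I)))
  refine ⟨c₁, c₂, hc₁, hc₂, fun z hz => ?_, ?_⟩
  · have i₁ := (intervalIntegrable_scalarT hG.one_sub_mul hs hρ hc₁ hz).const_mul (z.re : ℂ)
    have i₂ := (intervalIntegrable_scalarT hG.one_sub_mul hs hρ hc₂ hz).const_mul (z.im : ℂ)
    have hsum := intervalIntegral.integral_add i₁ i₂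
    rw [intervalIntegral.integral_const_mul, intervalIntegral.integral_const_mul] at hsum
    have e₁ := h₁ z hz
    have e₂ := h₂ z hz
    rw [scalarT] at e₁ e₂
    have hInt : ∫ σ in (0 : ℝ)..1, (σ : ℂ) * G ‖z‖ (1 - σ ^ 2) *
        (c₁ ((σ : ℂ) ^ 2 * z) * ((σ : ℂ) ^ 2 * z).re + c₂ ((σ : ℂ) ^ 2 * z) * ((σ : ℂ) ^ 2 * z).im) =
        ∫ σ in (0 : ℝ)..1, ((z.re : ℂ) * ((σ : ℂ) * ((1 - ((1 - σ ^ 2 : ℝ) : ℂ)) *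
          G ‖z‖ (1 - σ ^ 2)) * c₁ ((σ : ℂ) ^ 2 * z)) + (z.im : ℂ) * ((σ : ℂ) *
          ((1 - ((1 - σ ^ 2 : ℝ) : ℂ)) * G ‖z‖ (1 - σ ^ 2)) * c₂ ((σ : ℂ) ^ 2 * z))) := by
      refine intervalIntegral.integral_congr fun σ _ => ?_
      have hr : ((σ : ℂ) ^ 2 * z).re = σ ^ 2 * z.re := by
        rw [← Complex.ofReal_pow, Complex.re_ofReal_mul]
      have hi : ((σ : ℂ) ^ 2 * z).im = σ ^ 2 * z.im := by
        rw [← Complex.ofReal_pow, Complex.im_ofReal_mul]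
      simp only [hr, hi]
      push_cast
      ring
    rw [scalarT, hInt, hsum, clm_apply_eq (A z) z, ← e₁, ← e₂]
    ring
  · set B : ℂ → ℂ →L[ℝ] ℂ := fun z => Complex.reCLM.smulRight (c₁ z) + Complex.imCLM.smulRight (c₂ z)
      with hB
    have hBc : ContinuousAt B 0 := by
      have k₁ := (ContinuousLinearMap.smulRightL ℝ ℂ ℂ Complex.reCLM).continuous.continuousAt.comp
        (hc₁.continuousAt (ho.mem_nhds h0))
      have k₂ := (ContinuousLinearMap.smulRightL ℝ ℂ ℂ Complex.imCLM).continuous.continuousAt.comp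
        (hc₂.continuousAt (ho.mem_nhds h0))
      exact k₁.add k₂
    refine (isLittleO_clm_apply hBc (m := id) fun _ => rfl).congr_left fun z => ?_
    have e₁ := h₁ 0 h0
    have e₂ := h₂ 0 h0
    rw [scalarT_zero hG.one_sub_mul] at e₁ e₂
    rw [clm_apply_eq (A 0) z, ← e₁, ← e₂]
    simp [hB, Complex.real_smul]
    ring

/-- Every solution in polar form is the image of a holomorphic one. -/
theorem exists_isPolarSol_scalarT_eq (hI : RayIntertwines ρ h G₁ G₂)
    (hI' : RayIntertwines ρ (fun r => -h r) G₂ G₁) (hh : ContinuousOn h (Icc 0 ρ))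
    (hG₁ : IsVolterraKernel ρ G₁) (hG₂ : IsVolterraKernel ρ G₂)
    (ho : IsOpen Ω) (h0 : (0 : ℂ) ∈ Ω) (hs : StarConvex ℝ (0 : ℂ) Ω) (hρ : ∀ z ∈ Ω, ‖z‖ ≤ ρ)
    {U V : ℂ → ℂ} (hUV : IsPolarSol Ω (fun z => ‖z‖ * h ‖z‖) U V) :
    ∃ u v, IsPolarSol Ω (fun _ => 0) u v ∧
      ∀ z ∈ Ω, scalarT G₁ u z = U z ∧ scalarT G₂ v z = V z := by
  have hU := hUV.contDiffOn₁
  have hV := hUV.contDiffOn₂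
  set J : ℂ →L[ℝ] ℂ := ContinuousLinearMap.mul ℝ ℂ Complex.I with hJ
  have hAc : ∀ {F : ℂ → ℂ}, ContDiffOn ℝ 1 F Ω → ContinuousOn (fun z => (fderiv ℝ F z).comp J) Ω :=
    fun hF => (hF.continuousOn_fderiv_of_isOpen ho le_rfl).clm_comp continuousOn_const
  obtain ⟨u, hu, hTu⟩ := exists_scalarT_eq hG₁ ho hs hρ hU.continuousOn
  obtain ⟨v, hv, hTv⟩ := exists_scalarT_eq hG₂ ho hs hρ hV.continuousOn
  -- After composition with J the functions inverted are U_θ and V_θ. Their preimages a and b serve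
  -- twice, as in the Cauchy-Riemann equations: u_θ = a and r v_r = -a, while v_θ = b and r u_r = b.
  obtain ⟨a₁, a₂, ha₁, ha₂, hTa, hoa⟩ := exists_scalarT_eq_apply hG₁ ho h0 hs hρ (hAc hU)
  obtain ⟨b₁, b₂, hb₁, hb₂, hTb, hob⟩ := exists_scalarT_eq_apply hG₂ ho h0 hs hρ (hAc hV)
  simp only [hJ, ContinuousLinearMap.comp_apply, ContinuousLinearMap.mul_apply'] at hTa hTb hoa hob
  have hac : ContinuousOn (fun z : ℂ => a₁ z * z.re + a₂ z * z.im) Ω :=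
    (ha₁.mul (by fun_prop)).add (ha₂.mul (by fun_prop))
  have hbc : ContinuousOn (fun z : ℂ => b₁ z * z.re + b₂ z * z.im) Ω :=
    (hb₁.mul (by fun_prop)).add (hb₂.mul (by fun_prop))
  have horigin : ∀ z, fderiv ℝ U 0 (Complex.I * z) = -fderiv ℝ V 0 z := fun z => by
    rw [← hUV.origin, ← mul_assoc, Complex.I_mul_I, neg_one_mul, map_neg]
  obtain ⟨cu, du, ou⟩ := contDiffOn_of_polar ho hu hbc hac
    (fun z hz hz0 => hasDerivAt_dilation_of_scalarT hI hh hG₁ ho h0 hs hρ hU hu hb₁ hb₂ hTu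
      (fun ζ hζ => by rw [hTb ζ hζ]; linear_combination -hUV.eq₁ ζ hζ) hz hz0)
    (fun z hz hz0 => hasDerivAt_angle_of_scalarT hG₁ ho hs hρ hU hu hac hTu hTa hz hz0)
    (L := fderiv ℝ U 0) (by simpa only [hUV.origin] using hob) hoa
  obtain ⟨cv, dv, ov⟩ := contDiffOn_of_polar ho hv hac.neg hbc
    (fun z hz hz0 => (hasDerivAt_dilation_of_scalarT hI' hh.neg hG₂ ho h0 hs hρ hV hv ha₁.neg
      ha₂.neg hTv (fun ζ hζ => by
        have e1 : (fun ζ : ℂ => (-a₁) ζ * (ζ.re : ℂ) + (-a₂) ζ * (ζ.im : ℂ)) =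
            fun ζ : ℂ => -(a₁ ζ * ζ.re + a₂ ζ * ζ.im) := by
          funext ζ
          simp only [Pi.neg_apply]
          ring
        rw [e1, scalarT_neg, hTa ζ hζ]
        linear_combination -hUV.eq₂ ζ hζ) hz hz0).congr_deriv (by simp only [Pi.neg_apply]; ring))
    (fun z hz hz0 => hasDerivAt_angle_of_scalarT hG₂ ho hs hρ hV hv hbc hTv hTb hz hz0)
    (L := fderiv ℝ V 0) (by
      refine hoa.neg_left.congr_left fun z => ?_
      simp only [Pi.neg_apply]
      rw [horigin]
      ring) hob
  refine ⟨u, v, ⟨cu, cv, fun z hz => ?_, fun z hz => ?_, fun e => ?_⟩, fun z hz =>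
    ⟨hTu z hz, hTv z hz⟩⟩
  · rw [(du z hz).1, (dv z hz).2]
    ring
  · rw [(dv z hz).1, (du z hz).2]
    simp only [Pi.neg_apply]
    ring
  · rw [ou h0, ov h0, hUV.origin]

end Inverse

/-! ### The outer radius and the proof of the theorem. -/

section OuterRadius

variable {Ω : Set ℂ}

theorem norm_le_outerRadius (hb : Bornology.IsBounded Ω) {z : ℂ} (hz : z ∈ Ω) :
    ‖z‖ ≤ outerRadius Ω := by
  obtain ⟨C, hC⟩ := hb.exists_norm_le
  refine le_csSup ⟨C, ?_⟩ (mem_image_of_mem _ hz)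
  rintro _ ⟨w, hw, rfl⟩
  exact hC w hw

theorem outerRadius_pos (ho : IsOpen Ω) (hb : Bornology.IsBounded Ω) (h0 : (0 : ℂ) ∈ Ω) :
    0 < outerRadius Ω := by
  obtain ⟨ε, hε, hball⟩ := Metric.isOpen_iff.1 ho 0 h0
  have hm : ((ε / 2 : ℝ) : ℂ) ∈ Ω := hball (by
    rw [mem_ball_zero_iff, Complex.norm_real, Real.norm_of_nonneg (by positivity)]
    linarith)
  have := norm_le_outerRadius hb hm
  rw [Complex.norm_real, Real.norm_of_nonneg (by positivity)] at this
  linarith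

/-- The supremum is not attained in an open set, so for z ≠ 0 in Ω the radius |z| is interior to [0,
ρ] and f is differentiable there on both sides. -/
theorem norm_lt_outerRadius (ho : IsOpen Ω) (hb : Bornology.IsBounded Ω)
    (hs : StarConvex ℝ (0 : ℂ) Ω) (h0 : (0 : ℂ) ∈ Ω) {z : ℂ} (hz : z ∈ Ω) :
    ‖z‖ < outerRadius Ω := by
  rcases eq_or_ne z 0 with rfl | hz0
  · simpa using outerRadius_pos ho hb h0
  · obtain ⟨R, hR, hRρ, -⟩ := exists_radius_gt ho hs (fun z hz => norm_le_outerRadius hb hz) hz hz0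
    exact hR.trans_le hRρ

end OuterRadius

/-- The coefficient h/|z| takes the value 0 at z = 0 by the convention for division by zero; this is
harmless because the form is multiplied by z, and correct because f'(0) = 0. -/
theorem hasFDerivAt_radial_of_isLogDeriv {ρ : ℝ} {q f : ℝ → ℂ} (hρ : 0 < ρ)
    (hf : ContDiffOn ℝ 2 f (Icc 0 ρ)) (hne : ∀ r ∈ Icc 0 ρ, f r ≠ 0)
    (hh : IsLogDeriv ρ q fun r => derivWithin f (Icc 0 ρ) r / f r) {z : ℂ} (hz : ‖z‖ < ρ) :
    HasFDerivAt (fun ζ : ℂ => f ‖ζ‖)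
      (radialForm (f ‖z‖ * (derivWithin f (Icc 0 ρ) ‖z‖ / f ‖z‖ / ‖z‖)) z) z := by
  rcases eq_or_ne z 0 with rfl | hz0
  · have h0 : (0 : ℝ) ∈ Icc 0 ρ := ⟨le_rfl, hρ.le⟩
    have hd0 : derivWithin f (Icc 0 ρ) 0 = 0 := by
      obtain ⟨C, -, hC⟩ := hh.exists_bound
      have := hC 0 h0
      rw [mul_zero, norm_le_zero_iff, div_eq_zero_iff] at this
      exact this.resolve_right (hne 0 h0)
    have hd := ((hf.differentiableOn two_ne_zero) 0 h0).hasDerivWithinAt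
    rw [hd0] at hd
    have : radialForm (f ‖(0 : ℂ)‖ * (derivWithin f (Icc 0 ρ) ‖(0 : ℂ)‖ / f ‖(0 : ℂ)‖ / ‖(0 : ℂ)‖)) 0
        = 0 := by
      ext
      simp [radialForm]
    rw [this]
    exact hasFDerivAt_radial_zero hρ hd
  · have hn : 0 < ‖z‖ := norm_pos_iff.2 hz0
    have hd := hasDerivAt_of_contDiffOn_Icc (hf.of_le (by norm_num)) ⟨hn, hz⟩
    convert hasFDerivAt_radial hz0 hd using 2
    have := hne ‖z‖ ⟨hn.le, hz.le⟩
    field_simp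

theorem IsTransmutationKernel.isVolterraKernel {ρ : ℝ} {p : ℝ → ℂ} {G : ℝ → ℝ → ℂ}
    (hG : IsTransmutationKernel ρ p G) : IsVolterraKernel ρ G :=
  ⟨hG.continuousOn, hG.zero⟩

end Bicomplex

end

theorem mainTheorem4 (Ω : Set ℂ) (hΩ_open : IsOpen Ω) (hΩ_bdd : Bornology.IsBounded Ω)
    (hΩ_zero : (0 : ℂ) ∈ Ω) (hΩ_star : StarConvex ℝ (0 : ℂ) Ω)
    (q f : ℝ → ℂ)
    (hq : ContDiffOn ℝ 1 q (Set.Icc 0 (Bicomplex.outerRadius Ω)))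
    (hf : ContDiffOn ℝ 2 f (Set.Icc 0 (Bicomplex.outerRadius Ω)))
    (hf_ne : ∀ r ∈ Set.Icc 0 (Bicomplex.outerRadius Ω), f r ≠ 0)
    (hf_ode : ∀ r ∈ Set.Ioo 0 (Bicomplex.outerRadius Ω),
      deriv (deriv f) r + 1 / (r : ℂ) * deriv f r - q r * f r = 0)
    (hf_zero : f 0 = 1) :
    (∃ G, Bicomplex.IsTransmutationKernel (Bicomplex.outerRadius Ω) q G) ∧
    (∃ G, Bicomplex.IsTransmutationKernel (Bicomplex.outerRadius Ω)
      (Bicomplex.darbouxPotential (Bicomplex.outerRadius Ω) f q) G) ∧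
    ∀ G₁ G₂ : ℝ → ℝ → ℂ,
      Bicomplex.IsTransmutationKernel (Bicomplex.outerRadius Ω) q G₁ →
      Bicomplex.IsTransmutationKernel (Bicomplex.outerRadius Ω)
        (Bicomplex.darbouxPotential (Bicomplex.outerRadius Ω) f q) G₂ →
      Ω.domRestrict '' Bicomplex.VekuaSol Ω f =
        Ω.domRestrict '' (Bicomplex.vekuaT G₁ G₂ '' Bicomplex.Hol Ω) := by
  open Bicomplex in
  set ρ := outerRadius Ω with hρdef
  have hρ : 0 < ρ := outerRadius_pos hΩ_open hΩ_bdd hΩ_zero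
  have hle : ∀ z ∈ Ω, ‖z‖ ≤ ρ := fun z hz => norm_le_outerRadius hΩ_bdd hz
  have hlt : ∀ z ∈ Ω, ‖z‖ < ρ := fun z hz =>
    norm_lt_outerRadius hΩ_open hΩ_bdd hΩ_star hΩ_zero hz
  refine ⟨exists_isTransmutationKernel hρ hq,
    exists_isTransmutationKernel hρ (contDiffOn_darbouxPotential hρ hq hf hf_ne), ?_⟩
  intro G₁ G₂ h₁ h₂
  have hh := isLogDeriv_derivWithin_div hρ hq hf hf_ne hf_ode
  obtain ⟨hI, hI'⟩ := rayIntertwines hρ hh h₁ h₂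
  have hV : ∀ W : ℂ → Bicomplex, W ∈ VekuaSol Ω f ↔ IsPolarSol Ω
      (fun z => ‖z‖ * (derivWithin f (Set.Icc 0 ρ) ‖z‖ / f ‖z‖))
      (fun z => (W z).re) (fun z => (W z).im) := by
    intro W
    rw [mem_vekuaSol_iff hΩ_zero (fun z hz => hf_ne _ ⟨norm_nonneg z, hle z hz⟩)
      fun z hz => hasFDerivAt_radial_of_isLogDeriv hρ hf hf_ne hh (hlt z hz)]
    have : (fun z : ℂ => (‖z‖ : ℂ) ^ 2 * (derivWithin f (Set.Icc 0 ρ) ‖z‖ / f ‖z‖ / ‖z‖)) =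
        fun z : ℂ => ‖z‖ * (derivWithin f (Set.Icc 0 ρ) ‖z‖ / f ‖z‖) := by
      funext z
      rcases eq_or_ne z 0 with rfl | hz
      · simp
      · have hn : (‖z‖ : ℂ) ≠ 0 := by simpa using hz
        generalize derivWithin f (Set.Icc 0 ρ) ‖z‖ / f ‖z‖ = c
        field_simp
    rw [this]
  have hk₁ := h₁.isVolterraKernel
  have hk₂ := h₂.isVolterraKernel
  apply Set.Subset.antisymm
  · rintro _ ⟨W, hW, rfl⟩
    -- The preimage reproduces W only on Ω, which is why both sides are compared after restriction
    -- to Ω.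
    obtain ⟨u, v, huv, hT⟩ := exists_isPolarSol_scalarT_eq hI hI' hh.cont hk₁ hk₂ hΩ_open hΩ_zero
      hΩ_star hle ((hV W).1 hW)
    refine ⟨_, ⟨fun z => ⟨u z, v z⟩, (mem_hol_iff hΩ_zero).2 huv, rfl⟩, ?_⟩
    funext z
    exact QuadraticAlgebra.ext (hT z z.2).1 (hT z z.2).2
  · rintro _ ⟨_, ⟨W, hW, rfl⟩, rfl⟩
    refine ⟨_, (hV _).2 ?_, rfl⟩
    exact isPolarSol_scalarT hI hI' hh.cont hh.exists_bound hk₁ hk₂ hΩ_open hΩ_zero hΩ_star hle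
      ((mem_hol_iff hΩ_zero).1 hW)
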